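/- Let $T>0$, $\alpha\in(1/3,1)$, and let $(\zeta,\zeta^2)$ be a geometric $\alpha$-Hölder rough path on $[0,T]$ in $\mathbb R^d$: $\zeta_0=0$, $|\zeta_t-\zeta_s|\lesssim|t-s|^{\alpha}$, $|\zeta^2_{st}|\lesssim|t-s|^{2\alpha}$, $\zeta^{2;ij}_{st}-\zeta^{2;ij}_{su}-\zeta^{2;ij}_{ut}=(\zeta^i_u-\zeta^i_s)(\zeta^j_t-\zeta^j_u)$ and $\zeta^{2;ij}_{st}+\zeta^{2;ji}_{st}=(\zeta^i_t-\zeta^i_s)(\zeta^j_t-\zeta^j_s)$ for $0\le s\le u\le t\le T$. Let $U$ be a separable metric space, let $\mathcal P_2(U)$ be the set of Borel probability measures on $U$ with finite second moment, with the Wasserstein distance $W_2$, and let $\mathcal K\subset\mathcal P_2(U)$ be compact and non-empty. For $\varepsilon,L>0$ and $s\in[0,T]$ let $\mathcal V^{\varepsilon,L}([s,T])$ be the set of all $\gamma:[s,T]\to\mathcal K$ with $W_2(\gamma_r,\gamma_t)\le L|t-r|^{\varepsilon}$ for all $r,t\in[s,T]$. Assume: * $b:[0,T]\times\mathbb R^m\times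 U\to\mathbb R^m$ is bounded and continuous, it is differentiable in $x\in\mathbb R^m$ with $\partial_x b$ bounded and continuous on $[0,T]\times\mathbb R^m\times U$, and for each $x$ the maps $t\mapsto b(t,x,a)$ are uniformly continuous, uniformly in $a\in U$; * $\sigma\in\mathcal C^{1,3}_b([0,T]\times\mathbb R^m;\mathbb R^{m,d})$, that is, $\sigma$, $\partial_t\sigma$ and $\nabla^k\sigma$ ($k\le 3$) exist and are bounded and continuous on $[0,T]\times\mathbb R^m$; * $F:[0,T]\times\mathbb R^m\times\mathcal K\to\mathbb R$ is bounded, measurable in $t$, Lipschitz in $x$ uniformly in $(t,\gamma)$, and Lipschitz in $\gamma$ for $W_2$; * $G:\mathbb R^m\to\mathbb R$ is bounded and Lipschitz. For $s\in[0,T]$, $y\in\mathbb R^m$ and $\gamma\in\mathcal V^{\varepsilon,L}([s,T])$ let $x^{s,y,\gamma}$ be the solution on $[s,T]$ of the rough differential equation $$x_t=y+\int_s^t\int_U b(r,x_r,a)\,\gamma_r(da)\,dr+\int_s^t\sigma(r,x_r)\,d\zeta_r$$ in the sense of paths weakly controlled by $\zeta$: for some $\kappa\in(1/3,\alpha)$,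 $x$ is controlled of regularity $\kappa$ with derivative $\sigma(\cdot,x)$, and the last integral is the rough integral of $\sigma(\cdot,x)$, controlled with derivative $\nabla\sigma(\cdot,x)\sigma(\cdot,x)$, against $(\zeta,\zeta^2)$. Let $$V(s,y)=\sup\Big\{\int_s^T F(r,x^{s,y,\gamma}_r,\gamma_r)\,dr+G(x^{s,y,\gamma}_T)\;:\;\gamma\in\mathcal V^{\varepsilon,L}([s,T])\Big\}.$$ Then $V(s,y)$ is a well-defined real number (the supremum is over a non-empty set that is bounded above), and there is a constant $C$, which does not depend on $\varepsilon$ and $L$, such that for all $(s_1,y_1),(s_2,y_2)\in[0,T]\times\mathbb R^m$ $$|V(s_2,y_2)-V(s_1,y_1)|\le C\big(|y_1-y_2|+(1+|y_1|+|y_2|)\,|s_1-s_2|^{\alpha}\big).$$ So $V$ is Lipschitz in space (take $s_1=s_2$) and, locally uniformly in space, $\alpha$-Hölder in time (take $y_1=y_2$). -/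

import Mathlib

open Set Filter Topology MeasureTheory
open scoped ENNReal

noncomputable section

namespace RoughControl

/-- Euclidean space `ℝⁿ`. -/
abbrev Vec (n : ℕ) := EuclideanSpace ℝ (Fin n)

/-! ### Increments on `[a, b]` -/

section Increments

variable {V : Type*} [NormedAddCommGroup V]

/-- The increment `(δ f)_{st} = f_t - f_s` of a path. -/
def inc (f : ℝ → V) (s t : ℝ) : V := f t - f s

/-- The increment `(δ g)_{sut} = g_{st} - g_{su} - g_{ut}` of a two-index map. -/
def inc₂ (g : ℝ → ℝ → V) (s u t : ℝ) : V := g s t - g s u - g u t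

/-- `g ∈ 𝒞₂^μ` on `[a, b]`: the quotients `|g_{st}| / |t - s|^μ`, `a ≤ s ≤ t ≤ b`, are bounded. -/
def IsHolder₂ (μ a b : ℝ) (g : ℝ → ℝ → V) : Prop :=
  ∃ C : ℝ, ∀ s t, a ≤ s → s ≤ t → t ≤ b → ‖g s t‖ ≤ C * (t - s) ^ μ

/-- `f ∈ 𝒞₁^μ` on `[a, b]`: the path `f` is `μ`-Hölder on `[a, b]`. -/
def IsHolder₁ (μ a b : ℝ) (f : ℝ → V) : Prop := IsHolder₂ μ a b (inc f)

/-- `g = Λ(h)` on `[a, b]`, where `Λ` is the sewing map with target `𝒞₂^μ` (`μ > 1`):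
`g` is the element of `𝒞₂^μ` with `δ g = h`. -/
def IsSewing (μ a b : ℝ) (h : ℝ → ℝ → ℝ → V) (g : ℝ → ℝ → V) : Prop :=
  IsHolder₂ μ a b g ∧
    ∀ s u t, a ≤ s → s ≤ u → u ≤ t → t ≤ b → inc₂ g s u t = h s u t

end Increments

/-! ### Rough paths, controlled paths and rough integrals -/

/-- `(ζ, Z)` is a geometric `α`-Hölder rough path on `[0, T]` starting from `0`; the two-index map
`Z` is the Lévy area (second level) of `ζ`. -/
structure IsGeometricRoughPath {d : ℕ} (T α : ℝ) (ζ : ℝ → Vec d)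
    (Z : ℝ → ℝ → Fin d → Fin d → ℝ) : Prop where
  zero : ζ 0 = 0
  holder : IsHolder₁ α 0 T ζ
  holder_area : IsHolder₂ (2 * α) 0 T Z
  chen : ∀ s u t, 0 ≤ s → s ≤ u → u ≤ t → t ≤ T → ∀ i j,
    inc₂ Z s u t i j = inc ζ s u i * inc ζ u t j
  geometric : ∀ s t, 0 ≤ s → s ≤ t → t ≤ T → ∀ i j,
    Z s t i j + Z s t j i = inc ζ s t i * inc ζ s t j

section Integral

variable {d : ℕ} {V : Type*} [NormedAddCommGroup V] [NormedSpace ℝ V]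

/-- The remainder `ρ_{st} = (δ z)_{st} - z'_s (δ ζ)_{st}`. -/
def remainder (ζ : ℝ → Vec d) (z : ℝ → V) (z' : ℝ → Vec d →L[ℝ] V) (s t : ℝ) : V :=
  inc z s t - z' s (inc ζ s t)

/-- The couple `(z, z')` is a path weakly controlled by `ζ` on `[a, b]`, of regularity `κ`. -/
structure IsControlled (ζ : ℝ → Vec d) (κ a b : ℝ) (z : ℝ → V) (z' : ℝ → Vec d →L[ℝ] V) :
    Prop where
  holder : IsHolder₁ κ a b z
  holder_deriv : IsHolder₁ κ a b z'
  holder_remainder : IsHolder₂ (2 * κ) a b (remainder ζ z z')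

/-- The contraction `∑_{i,j} A(e_i)(e_j) M^{ij}` of `A` with a `d × d` matrix `M`. For the
derivative `A = μ'` of a controlled integrand `μ`, the first argument of `A` is the direction of
differentiation and the second one is the direction of integration. -/
def contract (A : Vec d →L[ℝ] Vec d →L[ℝ] V) (M : Fin d → Fin d → ℝ) : V :=
  ∑ i, ∑ j, M i j • A (EuclideanSpace.single i 1) (EuclideanSpace.single j 1)

/-- The increments of `z` on `[a, b]` are `∫_s^t μ_u dζ_u + ∫_s^t η_u du`, where `(μ, μ')` is a
path controlled by `ζ` of regularity `κ`, and the first integral is the rough integral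
`μ δζ + μ' Z + Λ(ρ δζ + δμ' Z)`, with `ρ` the remainder of `(μ, μ')`. -/
def IsRoughIntegral (ζ : ℝ → Vec d) (Z : ℝ → ℝ → Fin d → Fin d → ℝ) (κ a b : ℝ)
    (μ : ℝ → Vec d →L[ℝ] V) (μ' : ℝ → Vec d →L[ℝ] Vec d →L[ℝ] V) (η : ℝ → V)
    (z : ℝ → V) : Prop :=
  IsControlled ζ κ a b μ μ' ∧
  ∃ Λ : ℝ → ℝ → V,
    IsSewing (3 * κ) a b
      (fun s u t => remainder ζ μ μ' s u (inc ζ u t) + contract (inc μ' s u) (Z u t)) Λ ∧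
    ∀ s t, a ≤ s → s ≤ t → t ≤ b →
      inc z s t = μ s (inc ζ s t) + contract (μ' s) (Z s t) + (∫ u in s..t, η u) + Λ s t

end Integral

/-! ### Measures with finite second moment and the Wasserstein distance -/

section Wasserstein

variable (U : Type*) [MetricSpace U] [MeasurableSpace U]

/-- `𝒫₂(U)`: the probability measures on `U` with finite second moment. -/
def P2 : Type _ :=
  {μ : Measure U // IsProbabilityMeasure μ ∧ ∃ a₀ : U, ∫⁻ a, edist a a₀ ^ 2 ∂μ < ∞}

variable {U}

/-- The underlying measure of an element of `𝒫₂(U)`. -/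
def P2.toMeasure (μ : P2 U) : Measure U := μ.1

/-- The couplings of two elements of `𝒫₂(U)`. -/
def couplings (μ ν : P2 U) : Set (Measure (U × U)) :=
  {π | π.map Prod.fst = μ.toMeasure ∧ π.map Prod.snd = ν.toMeasure}

/-- The Wasserstein distance of order two. -/
def W₂ (μ ν : P2 U) : ℝ≥0∞ :=
  ⨅ π ∈ couplings μ ν, (∫⁻ p, edist p.1 p.2 ^ 2 ∂π) ^ (1 / 2 : ℝ)

/-- The topology of the distance `W₂`: a set is open if it contains a `W₂`-ball around each of
its points. -/
instance : TopologicalSpace (P2 U) where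
  IsOpen O := ∀ μ ∈ O, ∃ r : ℝ≥0∞, 0 < r ∧ ∀ ν, W₂ μ ν < r → ν ∈ O
  isOpen_univ := fun _ _ => ⟨1, one_pos, fun _ _ => mem_univ _⟩
  isOpen_inter := by
    rintro O O' h h' μ ⟨hμ, hμ'⟩
    obtain ⟨r, hr, hO⟩ := h μ hμ
    obtain ⟨r', hr', hO'⟩ := h' μ hμ'
    exact ⟨min r r', lt_min hr hr', fun ν hν =>
      ⟨hO ν (hν.trans_le (min_le_left _ _)), hO' ν (hν.trans_le (min_le_right _ _))⟩⟩
  isOpen_sUnion := by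
    rintro 𝒪 h μ ⟨O, hO, hμ⟩
    obtain ⟨r, hr, hr'⟩ := h O hO μ hμ
    exact ⟨r, hr, fun ν hν => ⟨O, hO, hr' ν hν⟩⟩

/-- `𝒱^{ε,L}([s, T])`: the paths `γ : [s, T] → K` with `W₂(γ_r, γ_t) ≤ L |t - r|^ε`. (Values of
`γ` outside `[s, T]` are irrelevant.) -/
def admissible (K : Set (P2 U)) (ε L s T : ℝ) : Set (ℝ → P2 U) :=
  {γ | (∀ r ∈ Icc s T, γ r ∈ K) ∧
    ∀ r ∈ Icc s T, ∀ t ∈ Icc s T, W₂ (γ r) (γ t) ≤ ENNReal.ofReal (L * |t - r| ^ ε)}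

end Wasserstein

/-! ### Conditions on the coefficients and on the rewards -/

/-- `σ ∈ 𝒞_b^{1,3}([0, T] × ℝᵐ; ℝ^{m,d})`: `σ`, its time derivative and its space derivatives up
to order three exist and are bounded and continuous on `[0, T] × ℝᵐ`. -/
structure IsCb13 {m d : ℕ} (T : ℝ) (σ : ℝ → Vec m → Vec d →L[ℝ] Vec m) : Prop where
  differentiable_time : ∀ x, DifferentiableOn ℝ (fun t => σ t x) (Icc 0 T)
  contDiff_space : ∀ t ∈ Icc 0 T, ContDiff ℝ 3 (σ t)
  continuous_time : ContinuousOn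
    (fun p : ℝ × Vec m => derivWithin (fun t => σ t p.2) (Icc 0 T) p.1) (Icc 0 T ×ˢ univ)
  continuous_space : ∀ k ≤ 3, ContinuousOn
    (fun p : ℝ × Vec m => iteratedFDeriv ℝ k (σ p.1) p.2) (Icc 0 T ×ˢ univ)
  bounded_time : ∃ C : ℝ, ∀ t ∈ Icc 0 T, ∀ x,
    ‖derivWithin (fun t => σ t x) (Icc 0 T) t‖ ≤ C
  bounded_space : ∃ C : ℝ, ∀ k ≤ 3, ∀ t ∈ Icc 0 T, ∀ x, ‖iteratedFDeriv ℝ k (σ t) x‖ ≤ C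

section Coefficients

variable {m : ℕ} {U : Type*} [MetricSpace U] [MeasurableSpace U]

/-- The conditions on the drift `b : [0, T] × ℝᵐ × U → ℝᵐ`: `b` and its space derivative are
bounded and continuous, and `t ↦ b(t, x, a)` is uniformly continuous, uniformly in `a`. As to the
control variable `a`, which lies in a metric space, only continuity is demanded. -/
structure IsDrift (T : ℝ) (b : ℝ → Vec m → U → Vec m) : Prop where
  differentiable_space : ∀ t ∈ Icc 0 T, ∀ a, Differentiable ℝ (fun x => b t x a)
  continuous : ContinuousOn
    (fun p : ℝ × Vec m × U => b p.1 p.2.1 p.2.2) (Icc 0 T ×ˢ univ)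
  continuous_space : ContinuousOn
    (fun p : ℝ × Vec m × U => fderiv ℝ (fun x => b p.1 x p.2.2) p.2.1) (Icc 0 T ×ˢ univ)
  bounded : ∃ C : ℝ, ∀ t ∈ Icc 0 T, ∀ x a, ‖b t x a‖ ≤ C
  bounded_space : ∃ C : ℝ, ∀ t ∈ Icc 0 T, ∀ x a, ‖fderiv ℝ (fun x => b t x a) x‖ ≤ C
  uniform_time : ∀ x, ∀ e > 0, ∃ r > 0, ∀ t ∈ Icc 0 T, ∀ t' ∈ Icc 0 T, |t - t'| < r →
    ∀ a, ‖b t x a - b t' x a‖ < e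

/-- The conditions on the running reward `F : [0, T] × ℝᵐ × K → ℝ`: it is bounded, measurable in
time, Lipschitz in space with one constant for all times and controls, and Lipschitz in the
control for the distance `W₂`. -/
structure IsRunningReward (T : ℝ) (K : Set (P2 U)) (F : ℝ → Vec m → P2 U → ℝ) : Prop where
  bounded : ∃ C : ℝ, ∀ t ∈ Icc 0 T, ∀ x, ∀ γ ∈ K, |F t x γ| ≤ C
  measurable_time : ∀ x, ∀ γ ∈ K,
    AEMeasurable (fun t => F t x γ) (volume.restrict (Icc 0 T))
  lipschitz_space : ∃ C : ℝ, ∀ t ∈ Icc 0 T, ∀ γ ∈ K, ∀ x x',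
    |F t x γ - F t x' γ| ≤ C * ‖x - x'‖
  lipschitz_control : ∀ t ∈ Icc 0 T, ∀ x, ∃ C : ℝ, ∀ γ ∈ K, ∀ γ' ∈ K,
    ENNReal.ofReal |F t x γ - F t x γ'| ≤ ENNReal.ofReal C * W₂ γ γ'

/-- The conditions on the terminal reward: bounded and continuous. -/
structure IsTerminalReward (G : Vec m → ℝ) : Prop where
  bounded : ∃ C : ℝ, ∀ x, |G x| ≤ C
  continuous : Continuous G

end Coefficients

/-! ### The controlled equation and the value function -/

section Control

variable {m d : ℕ} {U : Type*} [MetricSpace U] [MeasurableSpace U]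

/-- `x` solves, on `[s, T]`, the rough differential equation
`dx_t = ∫_U b(t, x_t, a) γ_t(da) dt + σ(t, x_t) dζ_t` with `x_s = y`.
A solution is a fixed point in the space of weakly controlled paths of some regularity
`κ ∈ (1/3, α)`. The derivative of the right-hand side, as a controlled path, is `σ(t, x_t)`, so
this is also the derivative of `x`, and the integrand `σ(t, x_t)` has the derivative
`∇σ(t, x_t) σ(t, x_t)`. -/
def IsSolution (T α : ℝ) (ζ : ℝ → Vec d) (Z : ℝ → ℝ → Fin d → Fin d → ℝ)
    (b : ℝ → Vec m → U → Vec m) (σ : ℝ → Vec m → Vec d →L[ℝ] Vec m)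
    (s : ℝ) (y : Vec m) (γ : ℝ → P2 U) (x : ℝ → Vec m) : Prop :=
  x s = y ∧ ∃ κ : ℝ, 1 / 3 < κ ∧ κ < α ∧
    IsControlled ζ κ s T x (fun t => σ t (x t)) ∧
    IsRoughIntegral ζ Z κ s T
      (fun t => σ t (x t))
      (fun t => (fderiv ℝ (σ t) (x t)).comp (σ t (x t)))
      (fun t => ∫ a, b t (x t) a ∂(γ t).toMeasure)
      x

/-- The set of the values `J_{sT}(γ, y) = ∫_s^T F(r, x_r, γ_r) dr + G(x_T)`, where `γ` runs over
the admissible controls on `[s, T]` and `x = x^{s,y,γ}` is the controlled state. -/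
def rewards (T α ε L : ℝ) (ζ : ℝ → Vec d) (Z : ℝ → ℝ → Fin d → Fin d → ℝ)
    (b : ℝ → Vec m → U → Vec m) (σ : ℝ → Vec m → Vec d →L[ℝ] Vec m)
    (K : Set (P2 U)) (F : ℝ → Vec m → P2 U → ℝ) (G : Vec m → ℝ)
    (s : ℝ) (y : Vec m) : Set ℝ :=
  {J | ∃ γ ∈ admissible K ε L s T, ∃ x : ℝ → Vec m,
    IsSolution T α ζ Z b σ s y γ x ∧ J = (∫ r in s..T, F r (x r) (γ r)) + G (x T)}

/-- The value function `V(s, y)`. -/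
def value (T α ε L : ℝ) (ζ : ℝ → Vec d) (Z : ℝ → ℝ → Fin d → Fin d → ℝ)
    (b : ℝ → Vec m → U → Vec m) (σ : ℝ → Vec m → Vec d →L[ℝ] Vec m)
    (K : Set (P2 U)) (F : ℝ → Vec m → P2 U → ℝ) (G : Vec m → ℝ)
    (s : ℝ) (y : Vec m) : ℝ :=
  sSup (rewards T α ε L ζ Z b σ K F G s y)

end Control

end RoughControl

end

set_option linter.unusedSectionVars false

/-! The equation is treated in the manner of Davie. Consider the one-step maps `x ↦ x + A_{st}(x)`
with `A_{st}(x) = σ_s(x) δζ_{st} + (∇σ_s σ_s)(x) Z_{st}`. By Chen's relation they compose up to an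
error of order `(t - s)^(2/3 + α)`, a power larger than one because `α > 1/3`, and this error is
Lipschitz in `x` with a constant of the same order (`exists_isAlmostFlow_roughGerm`). The `2/3` is
the price of time dependence: only `σ` itself is Lipschitz in time, and interpolation against the
third space derivative makes `∇σ` and `∇²σ` Hölder in time of orders `2/3` and `1/3`.

Solutions are the paths whose increments agree with the one-step maps, drift included, up to some
power larger than one (`IsSolution.isFlowLine`, `IsFlowLine.isSolution`). For such flow lines a
dyadic sewing argument (`norm_le_of_midpoint_of_small`) gives bounds with uniform constants,
existence by Euler schemes (`IsWeakFlow.exists_isFlowLine`), and Lipschitz dependence on the initial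
value (`exists_forall_flowLine_sub_le`).

The control enters the equation only through the averaged drift, whose bound and Lipschitz constant
do not see the control. Hence all constants are independent of `γ`, `ε` and `L`. The Hölder
condition on `γ` serves qualitatively, to make the drift continuous and the reward integrable along
the state.

For the value function, two states are driven by one control. If `s₁ ≤ s₂`, a control on `[s₁, T]`
restricts to `[s₂, T]`, and a control on `[s₂, T]` extends to the left by a constant; both
operations preserve `ε` and `L`. At time `s₂` the earlier state has moved by at most a multiple of
`(s₂ - s₁)^α`, so the states, the rewards and then the suprema differ by a multiple of `‖y₁ - y₂‖ +
(s₂ - s₁)^α`. Large time gaps are covered by boundedness of the rewards. -/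

namespace RoughControl

/-! ### Calculus of bounded Lipschitz maps and of second differences -/

section BoundedLipschitz

variable {E F G H : Type*} [NormedAddCommGroup E] [NormedSpace ℝ E]
  [NormedAddCommGroup F] [NormedSpace ℝ F] [NormedAddCommGroup G] [NormedSpace ℝ G]
  [NormedAddCommGroup H] [NormedSpace ℝ H]

/-- `f` is bounded by `K` and Lipschitz with constant `K`. -/
structure IsBL (K : ℝ) (f : E → F) : Prop where
  bound : ∀ x, ‖f x‖ ≤ K
  lip : ∀ x y, ‖f x - f y‖ ≤ K * ‖x - y‖

/-- `f` is bounded by `K`, Lipschitz with constant `K`, and its second differences are controlled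
by `K`, as is the case when the derivative of `f` is bounded and Lipschitz. -/
structure IsBL₂ (K : ℝ) (f : E → F) : Prop extends IsBL K f where
  second : ∀ x y v w, ‖(f (x + v) - f x) - (f (y + w) - f y)‖ ≤ K * (‖v - w‖ + ‖v‖ * ‖x - y‖)

theorem IsBL.nonneg {K : ℝ} {f : E → F} (h : IsBL K f) : 0 ≤ K :=
  (norm_nonneg _).trans (h.bound 0)

theorem IsBL.mono {K K' : ℝ} {f : E → F} (h : IsBL K f) (hK : K ≤ K') : IsBL K' f :=
  ⟨fun x => (h.bound x).trans hK, fun x y => (h.lip x y).trans (by gcongr)⟩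

theorem IsBL₂.mono {K K' : ℝ} {f : E → F} (h : IsBL₂ K f) (hK : K ≤ K') : IsBL₂ K' f :=
  ⟨h.toIsBL.mono hK, fun x y v w => (h.second x y v w).trans (by gcongr)⟩

theorem IsBL.add {K K' : ℝ} {f g : E → F} (hf : IsBL K f) (hg : IsBL K' g) :
    IsBL (K + K') (fun x => f x + g x) := by
  refine ⟨fun x => (norm_add_le _ _).trans (add_le_add (hf.bound x) (hg.bound x)), fun x y => ?_⟩
  have : f x + g x - (f y + g y) = (f x - f y) + (g x - g y) := by abel
  rw [this, add_mul]
  exact (norm_add_le _ _).trans (add_le_add (hf.lip x y) (hg.lip x y))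

theorem IsBL₂.add {K K' : ℝ} {f g : E → F} (hf : IsBL₂ K f) (hg : IsBL₂ K' g) :
    IsBL₂ (K + K') (fun x => f x + g x) := by
  refine ⟨hf.toIsBL.add hg.toIsBL, fun x y v w => ?_⟩
  have : (f (x + v) + g (x + v) - (f x + g x)) - (f (y + w) + g (y + w) - (f y + g y))
      = ((f (x + v) - f x) - (f (y + w) - f y)) + ((g (x + v) - g x) - (g (y + w) - g y)) := by
    abel
  rw [this, add_mul]
  exact (norm_add_le _ _).trans (add_le_add (hf.second x y v w) (hg.second x y v w))

theorem IsBL.linear {K c : ℝ} {f : E → F} (hf : IsBL K f) (hc : 0 ≤ c) (L : F →ₗ[ℝ] G)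
    (hL : ∀ u, ‖L u‖ ≤ c * ‖u‖) : IsBL (c * K) (fun x => L (f x)) := by
  refine ⟨fun x => (hL _).trans (by gcongr; exact hf.bound x), fun x y => ?_⟩
  rw [← map_sub, mul_assoc]
  exact (hL _).trans (by gcongr; exact hf.lip x y)

theorem IsBL₂.linear {K c : ℝ} {f : E → F} (hf : IsBL₂ K f) (hc : 0 ≤ c) (L : F →ₗ[ℝ] G)
    (hL : ∀ u, ‖L u‖ ≤ c * ‖u‖) : IsBL₂ (c * K) (fun x => L (f x)) := by
  refine ⟨hf.toIsBL.linear hc L hL, fun x y v w => ?_⟩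
  rw [← map_sub, ← map_sub, ← map_sub, mul_assoc]
  exact (hL _).trans (by gcongr; exact hf.second x y v w)

theorem IsBL.neg {K : ℝ} {f : E → F} (hf : IsBL K f) : IsBL K (fun x => - f x) :=
  ⟨fun x => by rw [norm_neg]; exact hf.bound x, fun x y => by
    rw [← norm_neg, neg_sub_neg, neg_sub]; exact hf.lip x y⟩

theorem IsBL.sub {K K' : ℝ} {f g : E → F} (hf : IsBL K f) (hg : IsBL K' g) :
    IsBL (K + K') (fun x => f x - g x) := by
  simpa only [sub_eq_add_neg] using hf.add hg.neg

theorem IsBL.comp {K c : ℝ} {f : F → G} (hf : IsBL K f) (hc : 1 ≤ c) {φ : E → F}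
    (hφ : ∀ x y, ‖φ x - φ y‖ ≤ c * ‖x - y‖) : IsBL (c * K) (fun x => f (φ x)) := by
  have hK := hf.nonneg
  refine ⟨fun x => (hf.bound _).trans (by nlinarith), fun x y => ?_⟩
  calc _ ≤ K * ‖φ x - φ y‖ := hf.lip _ _
    _ ≤ K * (c * ‖x - y‖) := by gcongr; exact hφ x y
    _ = _ := by ring

theorem IsBL.bilin {K K' : ℝ} {f : E → F} {g : E → G} (L : F →L[ℝ] G →L[ℝ] H)
    (hf : IsBL K f) (hg : IsBL K' g) : IsBL (2 * (‖L‖ * (K * K'))) (fun x => L (f x) (g x)) := by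
  have hK := hf.nonneg
  have hK' := hg.nonneg
  have hb : ∀ u v a b, ‖u‖ ≤ a → ‖v‖ ≤ b → 0 ≤ a → ‖L u v‖ ≤ ‖L‖ * (a * b) := by
    intro u v a b hu hv ha
    calc _ ≤ ‖L‖ * ‖u‖ * ‖v‖ := L.le_opNorm₂ u v
      _ ≤ ‖L‖ * a * b := by gcongr
      _ = _ := by ring
  refine ⟨fun x => ?_, fun x y => ?_⟩
  · have := hb _ _ _ _ (hf.bound x) (hg.bound x) hK
    have h0 : 0 ≤ ‖L‖ * (K * K') := by positivity
    linarith
  · have : L (f x) (g x) - L (f y) (g y) = L (f x - f y) (g x) + L (f y) (g x - g y) := by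
      simp
    rw [this]
    have h1 := hb _ _ _ _ (hf.lip x y) (hg.bound x) (by positivity)
    have h2 := hb _ _ _ _ (hf.bound y) (hg.lip x y) hK
    refine (norm_add_le _ _).trans ((add_le_add h1 h2).trans (le_of_eq ?_))
    ring

theorem IsBL₂.bilin {K K' : ℝ} {f : E → F} {g : E → G} (L : F →L[ℝ] G →L[ℝ] H)
    (hf : IsBL₂ K f) (hg : IsBL₂ K' g) :
    IsBL₂ (6 * (‖L‖ * (K * K'))) (fun x => L (f x) (g x)) := by
  have hK := hf.nonneg
  have hK' := hg.nonneg
  have h0 : 0 ≤ ‖L‖ * (K * K') := by positivity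
  have hb : ∀ u v a b, ‖u‖ ≤ a → ‖v‖ ≤ b → 0 ≤ a → ‖L u v‖ ≤ ‖L‖ * (a * b) := by
    intro u v a b hu hv ha
    calc _ ≤ ‖L‖ * ‖u‖ * ‖v‖ := L.le_opNorm₂ u v
      _ ≤ ‖L‖ * a * b := by gcongr
      _ = _ := by ring
  refine ⟨(hf.toIsBL.bilin L hg.toIsBL).mono (by linarith), fun x y v w => ?_⟩
  -- In the terms that are quadratic in increments, `g (x + v) - g (y + w)` is split into a second
  -- difference and `g x - g y`. The factor next to the second difference is bounded by `2 * K`, so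
  -- that no square of `‖v‖` appears.
  have e : (L (f (x + v)) (g (x + v)) - L (f x) (g x)) - (L (f (y + w)) (g (y + w)) - L (f y) (g y))
      = L ((f (x + v) - f x) - (f (y + w) - f y)) (g (y + w))
        + L (f (x + v) - f x) (g (x + v) - g (y + w) - (g x - g y))
        + L (f (x + v) - f x) (g x - g y)
        + L (f x - f y) (g (x + v) - g x)
        + L (f y) ((g (x + v) - g x) - (g (y + w) - g y)) := by
    simp only [map_sub, sub_apply]; abel
  have e' : g (x + v) - g (y + w) - (g x - g y) = (g (x + v) - g x) - (g (y + w) - g y) := by abel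
  have hfv : ‖f (x + v) - f x‖ ≤ K * ‖v‖ := by simpa using hf.lip (x + v) x
  have hgv : ‖g (x + v) - g x‖ ≤ K' * ‖v‖ := by simpa using hg.lip (x + v) x
  have hfv' : ‖f (x + v) - f x‖ ≤ 2 * K := by
    refine (norm_sub_le _ _).trans ?_
    linarith [hf.bound (x + v), hf.bound x]
  have h1 := hb _ _ _ _ (hf.second x y v w) (hg.bound (y + w)) (by positivity)
  have h2 := hb _ _ _ _ hfv' (hg.second x y v w) (by positivity)
  have h3 := hb _ _ _ _ hfv (hg.lip x y) (by positivity)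
  have h4 := hb _ _ _ _ (hf.lip x y) hgv (by positivity)
  have h5 := hb _ _ _ _ (hf.bound y) (hg.second x y v w) (by positivity)
  rw [e, e']
  refine (norm_add_le _ _).trans ((add_le_add ((norm_add_le _ _).trans (add_le_add
    ((norm_add_le _ _).trans (add_le_add ((norm_add_le _ _).trans (add_le_add h1 h2)) h3)) h4))
    h5).trans ?_)
  have h6 : 0 ≤ ‖L‖ * (K * K') * ‖v - w‖ := by positivity
  nlinarith [h6]

/-- A function with bounded and Lipschitz derivative has controlled second differences. -/
theorem IsBL₂.of_hasFDerivAt {K : ℝ} {f : E → F} {f' : E → E →L[ℝ] F}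
    (hf : ∀ x, HasFDerivAt f (f' x) x) (hb : ∀ x, ‖f x‖ ≤ K) (hf' : IsBL K f') : IsBL₂ K f := by
  have hlip : ∀ x y, ‖f x - f y‖ ≤ K * ‖x - y‖ := fun x y =>
    convex_univ.norm_image_sub_le_of_norm_hasFDerivWithin_le
      (fun z _ => (hf z).hasFDerivWithinAt) (fun z _ => hf'.bound z) (mem_univ y) (mem_univ x)
  refine ⟨⟨hb, hlip⟩, fun x y v w => ?_⟩
  have h1 : ‖(f (x + v) - f x) - (f (y + v) - f y)‖ ≤ K * ‖v‖ * ‖x - y‖ := by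
    refine convex_univ.norm_image_sub_le_of_norm_hasFDerivWithin_le
      (f := fun z => f (z + v) - f z) (f' := fun z => f' (z + v) - f' z)
      (fun z _ => ?_) (fun z _ => ?_) (mem_univ y) (mem_univ x)
    · exact (((hasFDerivAt_comp_add_right v).2 (hf (z + v))).sub (hf z)).hasFDerivWithinAt
    · simpa using hf'.lip (z + v) z
  have h2 : ‖f (y + v) - f (y + w)‖ ≤ K * ‖v - w‖ := by simpa using hlip (y + v) (y + w)
  have e : (f (x + v) - f x) - (f (y + w) - f y)
    = ((f (x + v) - f x) - (f (y + v) - f y)) + (f (y + v) - f (y + w)) := by abel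
  rw [e]
  refine (norm_add_le _ _).trans ((add_le_add h1 h2).trans (le_of_eq ?_))
  ring

/-- The second-difference bound with displacements `v x` and `v y`. It makes the increment small in
Lipschitz norm too, which Lipschitz continuity of `f` alone would not. -/
theorem IsBL₂.increment {K V : ℝ} {f : E → F} {v : E → E} (hf : IsBL₂ K f) (hv : IsBL V v) :
    IsBL (2 * (K * V)) (fun x => f (x + v x) - f x) := by
  have hK := hf.nonneg
  have hV := hv.nonneg
  refine ⟨fun x => ?_, fun x y => ?_⟩
  · have h1 : ‖f (x + v x) - f x‖ ≤ K * ‖v x‖ := by simpa using hf.lip (x + v x) x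
    have h2 : K * ‖v x‖ ≤ K * V := by gcongr; exact hv.bound x
    have : 0 ≤ K * V := by positivity
    linarith
  · calc _ ≤ K * (‖v x - v y‖ + ‖v x‖ * ‖x - y‖) := hf.second x y (v x) (v y)
      _ ≤ K * (V * ‖x - y‖ + V * ‖x - y‖) := by
        gcongr
        · exact hv.lip x y
        · exact hv.bound x
      _ = _ := by ring

/-- The remainder is quadratic in `V` both in sup norm and in Lipschitz norm. The second half needs
second differences of the derivative, and this is where three derivatives of `σ` are spent. -/
theorem IsBL₂.taylor {K V : ℝ} {f : E → F} {f' : E → E →L[ℝ] F} {v : E → E}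
    (hf : ∀ x, HasFDerivAt f (f' x) x) (hf' : IsBL₂ K f') (hv : IsBL V v) :
    IsBL (3 * (K * V ^ 2)) (fun x => f (x + v x) - f x - f' x (v x)) := by
  have hK := hf'.nonneg
  have hV := hv.nonneg
  -- The remainder is the increment over `[0, 1]` of `r ↦ f (x + r w) - r f'(x) w`, so it suffices
  -- to bound this derivative, and the difference of two such derivatives.
  have hd : ∀ x w (r : ℝ), HasDerivAt (fun r : ℝ => f (x + r • w) - r • f' x w)
      ((f' (x + r • w) - f' x) w) r := by
    intro x w r
    have h1 : HasDerivAt (fun r : ℝ => x + r • w) w r := by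
      simpa using ((hasDerivAt_id r).smul_const w).const_add x
    have h2 := (hf (x + r • w)).comp_hasDerivAt r h1
    have h3 : HasDerivAt (fun r : ℝ => r • f' x w) (f' x w) r := by
      simpa using (hasDerivAt_id r).smul_const (f' x w)
    exact h2.sub h3
  have hinc : ∀ x w (r : ℝ), r ∈ Ico (0 : ℝ) 1 → ‖f' (x + r • w) - f' x‖ ≤ K * ‖w‖ := by
    intro x w r hr
    have h := hf'.lip (x + r • w) x
    rw [add_sub_cancel_left, norm_smul, Real.norm_of_nonneg hr.1] at h
    exact h.trans (by gcongr; nlinarith [norm_nonneg w, hr.2])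
  refine ⟨fun x => ?_, fun x y => ?_⟩
  · have := norm_image_sub_le_of_norm_deriv_le_segment_01' (C := K * V * V)
      (fun r _ => (hd x (v x) r).hasDerivWithinAt) (fun r hr => by
        refine (ContinuousLinearMap.le_opNorm _ _).trans ?_
        gcongr
        · exact (hinc x (v x) r hr).trans (by gcongr; exact hv.bound x)
        · exact hv.bound x)
    simp only [one_smul, zero_smul, add_zero, sub_zero] at this
    have e : f (x + v x) - f x - f' x (v x) = f (x + v x) - f' x (v x) - f x := by abel
    rw [e]
    have h0 : 0 ≤ K * V * V := by positivity
    nlinarith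
  · have := norm_image_sub_le_of_norm_deriv_le_segment_01' (C := 3 * (K * V ^ 2) * ‖x - y‖)
      (fun r _ => ((hd x (v x) r).sub (hd y (v y) r)).hasDerivWithinAt) (fun r hr => by
        have e : (f' (x + r • v x) - f' x) (v x) - (f' (y + r • v y) - f' y) (v y)
          = ((f' (x + r • v x) - f' x) - (f' (y + r • v y) - f' y)) (v x)
            + (f' (y + r • v y) - f' y) (v x - v y) := by
          simp only [map_sub, sub_apply]; abel
        have h1 : ‖(f' (x + r • v x) - f' x) - (f' (y + r • v y) - f' y)‖
            ≤ K * (V * ‖x - y‖ + V * ‖x - y‖) := by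
          refine (hf'.second x y (r • v x) (r • v y)).trans ?_
          rw [← smul_sub, norm_smul, norm_smul, Real.norm_of_nonneg hr.1]
          have a1 := hv.lip x y
          have a2 := hv.bound x
          have a3 := hr.2.le
          have a4 := (mul_le_of_le_one_left (norm_nonneg (v x - v y)) a3).trans a1
          have a5 := (mul_le_of_le_one_left (norm_nonneg (v x)) a3).trans a2
          gcongr
        rw [e]
        refine (norm_add_le _ _).trans ((add_le_add (ContinuousLinearMap.le_opNorm _ _)
          (ContinuousLinearMap.le_opNorm _ _)).trans ?_)
        have h2 := hinc y (v y) r hr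
        calc _ ≤ K * (V * ‖x - y‖ + V * ‖x - y‖) * V + K * V * (V * ‖x - y‖) := by
              gcongr
              · exact hv.bound x
              · exact h2.trans (by gcongr; exact hv.bound y)
              · exact hv.lip x y
          _ = _ := by ring)
    simp only [Pi.sub_apply, one_smul, zero_smul, add_zero, sub_zero] at this
    refine le_trans (le_of_eq ?_) this
    congr 1
    abel

end BoundedLipschitz

/-- A bound that can be improved by an affine contraction is bounded by the fixed point. -/
theorem le_of_forall_improve {ι : Type*} {f g : ι → ℝ} {θ b : ℝ} (hθ : 0 ≤ θ) (hθ' : θ < 1)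
    (hb : 0 ≤ b) (hg : ∀ i, 0 ≤ g i) (h₀ : ∃ a, 0 ≤ a ∧ ∀ i, f i ≤ a * g i)
    (h : ∀ a, 0 ≤ a → (∀ i, f i ≤ a * g i) → ∀ i, f i ≤ (θ * a + b) * g i) (i : ι) :
    f i ≤ b / (1 - θ) * g i := by
  obtain ⟨a, ha, h₀⟩ := h₀
  have h1 : 0 < 1 - θ := by linarith
  -- Iterating the improvement from any finite starting bound `a` leaves only `θ ^ n * a` of it.
  have key : ∀ n : ℕ, ∀ i, f i ≤ (b / (1 - θ) + θ ^ n * a) * g i := by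
    intro n
    induction n with
    | zero =>
      intro i
      have h2 : 0 ≤ b / (1 - θ) * g i := mul_nonneg (by positivity) (hg i)
      have h3 := h₀ i
      rw [pow_zero, one_mul, add_mul]
      linarith
    | succ n ih =>
      intro i
      have := h _ (by positivity) ih i
      have e : θ * (b / (1 - θ) + θ ^ n * a) + b = b / (1 - θ) + θ ^ (n + 1) * a := by
        field_simp; ring
      rwa [e] at this
  have hlim : Tendsto (fun n : ℕ => (b / (1 - θ) + θ ^ n * a) * g i) atTop
      (𝓝 ((b / (1 - θ) + 0 * a) * g i)) :=
    (((tendsto_pow_atTop_nhds_zero_of_lt_one hθ hθ').mul_const a).const_add _).mul_const _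
  have := ge_of_tendsto' hlim (fun n => key n i)
  simpa using this

/-! ### Interpolation inequalities for derivatives -/

section Interpolation

variable {E F : Type*} [NormedAddCommGroup E] [NormedSpace ℝ E]
  [NormedAddCommGroup F] [NormedSpace ℝ F]

/-- Landau's inequality: the derivative of a bounded function with Lipschitz derivative. -/
theorem norm_deriv_le_of_bounded {f : E → F} {f' : E → E →L[ℝ] F} {A M r : ℝ}
    (hf : ∀ x, HasFDerivAt f (f' x) x) (hA : ∀ x, ‖f x‖ ≤ A)
    (hM : ∀ x y, ‖f' x - f' y‖ ≤ M * ‖x - y‖) (hM₀ : 0 ≤ M) (hr : 0 < r) (x : E) :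
    ‖f' x‖ ≤ 2 * A / r + M * r := by
  have hA₀ : 0 ≤ A := (norm_nonneg _).trans (hA x)
  refine ContinuousLinearMap.opNorm_le_of_unit_norm (by positivity) fun v hv => ?_
  -- On the ball of radius `r` the derivative varies by at most `M r`. The increment of `f` over a
  -- step `r v` is at most `2 A`, which leaves `2 A + M r²` for `r ‖f' x v‖`.
  have h1 : ‖f (x + r • v) - f x - f' x (x + r • v - x)‖ ≤ M * r * ‖x + r • v - x‖ := by
    refine (convex_closedBall x r).norm_image_sub_le_of_norm_hasFDerivWithin_le'
      (fun z _ => (hf z).hasFDerivWithinAt) (fun z hz => ?_)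
      (Metric.mem_closedBall_self hr.le) ?_
    · refine (hM z x).trans ?_
      rw [mem_closedBall_iff_norm] at hz
      gcongr
    · rw [mem_closedBall_iff_norm, add_sub_cancel_left, norm_smul, hv, mul_one,
        Real.norm_of_nonneg hr.le]
  rw [add_sub_cancel_left, norm_smul, hv, mul_one, Real.norm_of_nonneg hr.le, map_smul] at h1
  have h2 : r * ‖f' x v‖ ≤ 2 * A + M * r * r := by
    have e : r • f' x v = (f (x + r • v) - f x) - (f (x + r • v) - f x - r • f' x v) := by abel
    have h3 : ‖r • f' x v‖ ≤ A + A + M * r * r := by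
      rw [e]
      exact (norm_sub_le _ _).trans (add_le_add ((norm_sub_le _ _).trans
        (add_le_add (hA _) (hA _))) h1)
    rw [norm_smul, Real.norm_of_nonneg hr.le] at h3
    linarith
  rw [div_add' _ _ _ hr.ne', le_div_iff₀ hr]
  linarith

/-- Interpolation of the first two derivatives between a function and its third derivative. -/
theorem norm_deriv_le_of_bounded₂ {f : E → F} {f' : E → E →L[ℝ] F} {f'' : E → E →L[ℝ] E →L[ℝ] F}
    {A M r : ℝ} (hf : ∀ x, HasFDerivAt f (f' x) x) (hf' : ∀ x, HasFDerivAt f' (f'' x) x)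
    (hA : ∀ x, ‖f x‖ ≤ A) (hb : ∃ a, ∀ x, ‖f' x‖ ≤ a)
    (hM : ∀ x y, ‖f'' x - f'' y‖ ≤ M * ‖x - y‖) (hM₀ : 0 ≤ M) (hr : 0 < r) (x : E) :
    ‖f' x‖ ≤ 4 * A / r + 8 * M * r ^ 2 ∧ ‖f'' x‖ ≤ 8 * A / r ^ 2 + 17 * M * r := by
  have hA₀ : 0 ≤ A := (norm_nonneg _).trans (hA x)
  have h1 : ∀ x, ‖f' x‖ ≤ 4 * A / r + 8 * M * r ^ 2 := by
    intro x
    -- Landau's inequality for `f'` with radius `4 r` bounds `f''` by `a / (2 r) + 4 M r`; for `f`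
    -- with radius `r` it then returns `a / 2 + 2 A / r + 4 M r²` as a bound for `f'`. The radius `4
    -- r` is chosen to produce the contraction factor `1 / 2`.
    have := le_of_forall_improve (f := fun x => ‖f' x‖) (g := fun _ => 1) (θ := 1 / 2)
      (b := 2 * A / r + 4 * M * r ^ 2) (by norm_num) (by norm_num) (by positivity) (fun _ => zero_le_one)
      (by obtain ⟨a, ha⟩ := hb
          exact ⟨a, (norm_nonneg _).trans (ha x), by simpa using ha⟩) (fun a ha h y => ?_) x
    · refine this.trans (le_of_eq ?_)
      field_simp
      ring
    · have h2 : ∀ x, ‖f'' x‖ ≤ 2 * a / (4 * r) + M * (4 * r) := fun x =>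
        norm_deriv_le_of_bounded hf' (by simpa using h) hM hM₀ (by positivity) x
      have h3 : ∀ x y, ‖f' x - f' y‖ ≤ (2 * a / (4 * r) + M * (4 * r)) * ‖x - y‖ := fun x y =>
        convex_univ.norm_image_sub_le_of_norm_hasFDerivWithin_le
          (fun z _ => (hf' z).hasFDerivWithinAt) (fun z _ => h2 z) (mem_univ y) (mem_univ x)
      refine (norm_deriv_le_of_bounded hf hA h3 (by positivity) hr y).trans (le_of_eq ?_)
      field_simp
      ring
  refine ⟨h1 x, (norm_deriv_le_of_bounded hf' h1 hM hM₀ hr x).trans (le_of_eq ?_)⟩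
  field_simp
  ring

end Interpolation

/-! ### Time regularity of `σ` and of its space derivatives -/

section Coefficient

variable {E F : Type*} [NormedAddCommGroup E] [NormedSpace ℝ E]
  [NormedAddCommGroup F] [NormedSpace ℝ F]

/-- The space regularity of `σ` and of `∇σ`, and their regularity in time. -/
structure IsRegularCoefficient (T C : ℝ) (σ : ℝ → E → F) : Prop where
  nonneg : 0 ≤ C
  hasFDerivAt : ∀ t ∈ Icc 0 T, ∀ x, HasFDerivAt (σ t) (fderiv ℝ (σ t) x) x
  space : ∀ t ∈ Icc 0 T, IsBL₂ C (σ t)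
  space_deriv : ∀ t ∈ Icc 0 T, IsBL₂ C (fderiv ℝ (σ t))
  time : ∀ s ∈ Icc 0 T, ∀ t ∈ Icc 0 T, s ≤ t → ∀ x, ‖σ t x - σ s x‖ ≤ C * (t - s)
  time_deriv : ∀ s ∈ Icc 0 T, ∀ t ∈ Icc 0 T, s ≤ t → ∀ x,
    ‖fderiv ℝ (σ t) x - fderiv ℝ (σ s) x‖ ≤ C * (t - s) ^ (2 / 3 : ℝ)
  time_lip : ∀ s ∈ Icc 0 T, ∀ t ∈ Icc 0 T, s ≤ t → ∀ x y,
    ‖(σ t x - σ s x) - (σ t y - σ s y)‖ ≤ C * (t - s) ^ (2 / 3 : ℝ) * ‖x - y‖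
  time_deriv_lip : ∀ s ∈ Icc 0 T, ∀ t ∈ Icc 0 T, s ≤ t → ∀ x y,
    ‖(fderiv ℝ (σ t) x - fderiv ℝ (σ s) x) - (fderiv ℝ (σ t) y - fderiv ℝ (σ s) y)‖
      ≤ C * (t - s) ^ (1 / 3 : ℝ) * ‖x - y‖

theorem norm_sub_le_of_norm_iteratedFDeriv_one_le {f : E → F} {C : ℝ} (hf : Differentiable ℝ f)
    (hC : ∀ x, ‖iteratedFDeriv ℝ 1 f x‖ ≤ C) (x y : E) : ‖f x - f y‖ ≤ C * ‖x - y‖ :=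
  convex_univ.norm_image_sub_le_of_norm_hasFDerivWithin_le
    (fun z _ => (hf z).hasFDerivAt.hasFDerivWithinAt)
    (fun z _ => by simpa [← norm_iteratedFDeriv_fderiv] using hC z) (mem_univ y) (mem_univ x)

/-- No mixed derivative is available, so time increments of `∇σ` and `∇²σ` are obtained by
interpolating `σ_t - σ_s`, which is of order `t - s`, against its bounded third space derivative.
The Lipschitz versions follow from the mean value inequality. -/
theorem exists_isRegularCoefficient {T : ℝ} {σ : ℝ → E → F}
    (hσt : ∀ x, DifferentiableOn ℝ (fun t => σ t x) (Icc 0 T))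
    (hσ : ∀ t ∈ Icc 0 T, ContDiff ℝ 3 (σ t))
    (hbt : ∃ C : ℝ, ∀ t ∈ Icc 0 T, ∀ x, ‖derivWithin (fun t => σ t x) (Icc 0 T) t‖ ≤ C)
    (hb : ∃ C : ℝ, ∀ k ≤ 3, ∀ t ∈ Icc 0 T, ∀ x, ‖iteratedFDeriv ℝ k (σ t) x‖ ≤ C) :
    ∃ C, IsRegularCoefficient T C σ := by
  obtain ⟨Ct, hCt⟩ := hbt
  obtain ⟨C, hC⟩ := hb
  rcases (Icc 0 T).eq_empty_or_nonempty with hT | ⟨t₀, ht₀⟩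
  · refine ⟨0, ⟨le_rfl, ?_, ?_, ?_, ?_, ?_, ?_, ?_⟩⟩ <;> simp [hT]
  have hC₀ : 0 ≤ C := (norm_nonneg _).trans (hC 0 (by norm_num) t₀ ht₀ 0)
  have hCt₀ : 0 ≤ Ct := (norm_nonneg _).trans (hCt t₀ ht₀ 0)
  have d1 : ∀ t ∈ Icc 0 T, ∀ x, HasFDerivAt (σ t) (fderiv ℝ (σ t) x) x := fun t ht x =>
    (((hσ t ht).differentiable (by norm_num)) x).hasFDerivAt
  have c2 : ∀ t ∈ Icc 0 T, ContDiff ℝ 2 (fderiv ℝ (σ t)) := fun t ht =>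
    (hσ t ht).fderiv_right (by norm_num)
  have d2 : ∀ t ∈ Icc 0 T, ∀ x,
      HasFDerivAt (fderiv ℝ (σ t)) (fderiv ℝ (fderiv ℝ (σ t)) x) x := fun t ht x =>
    (((c2 t ht).differentiable (by norm_num)) x).hasFDerivAt
  have c3 : ∀ t ∈ Icc 0 T, ContDiff ℝ 1 (fderiv ℝ (fderiv ℝ (σ t))) := fun t ht =>
    (c2 t ht).fderiv_right (by norm_num)
  have b0 : ∀ t ∈ Icc 0 T, ∀ x, ‖σ t x‖ ≤ C := fun t ht x => by
    simpa using hC 0 (by norm_num) t ht x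
  have b1 : ∀ t ∈ Icc 0 T, ∀ x, ‖fderiv ℝ (σ t) x‖ ≤ C := fun t ht x => by
    simpa [← norm_iteratedFDeriv_fderiv] using hC 1 (by norm_num) t ht x
  have b2 : ∀ t ∈ Icc 0 T, ∀ x, ‖fderiv ℝ (fderiv ℝ (σ t)) x‖ ≤ C := fun t ht x => by
    have := hC 2 (by norm_num) t ht x
    rw [← norm_iteratedFDeriv_fderiv, ← norm_iteratedFDeriv_fderiv] at this
    simpa using this
  have l2 : ∀ t ∈ Icc 0 T, IsBL C (fderiv ℝ (fderiv ℝ (σ t))) := fun t ht =>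
    ⟨b2 t ht, norm_sub_le_of_norm_iteratedFDeriv_one_le ((c3 t ht).differentiable (by norm_num))
      fun x => by
        have := hC 3 (by norm_num) t ht x
        rwa [← norm_iteratedFDeriv_fderiv, ← norm_iteratedFDeriv_fderiv] at this⟩
  have s1 : ∀ t ∈ Icc 0 T, IsBL₂ C (fderiv ℝ (σ t)) := fun t ht =>
    .of_hasFDerivAt (d2 t ht) (b1 t ht) (l2 t ht)
  have s0 : ∀ t ∈ Icc 0 T, IsBL₂ C (σ t) := fun t ht =>
    .of_hasFDerivAt (d1 t ht) (b0 t ht) (s1 t ht).toIsBL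
  have tm : ∀ s ∈ Icc 0 T, ∀ t ∈ Icc 0 T, s ≤ t → ∀ x, ‖σ t x - σ s x‖ ≤ Ct * (t - s) := by
    intro s hs t ht hst x
    have := (convex_Icc 0 T).norm_image_sub_le_of_norm_derivWithin_le
      (hσt x) (fun r hr => hCt r hr x) hs ht
    rwa [Real.norm_of_nonneg (sub_nonneg.2 hst)] at this
  have interp : ∀ s ∈ Icc 0 T, ∀ t ∈ Icc 0 T, s < t → ∀ x,
      ‖fderiv ℝ (σ t) x - fderiv ℝ (σ s) x‖ ≤ (8 * Ct + 34 * C) * (t - s) ^ (2 / 3 : ℝ) ∧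
      ‖fderiv ℝ (fderiv ℝ (σ t)) x - fderiv ℝ (fderiv ℝ (σ s)) x‖
        ≤ (8 * Ct + 34 * C) * (t - s) ^ (1 / 3 : ℝ) := by
    intro s hs t ht hst x
    have hτ : 0 < t - s := sub_pos.2 hst
    -- The radius that balances the two terms of the interpolation bound: with `A = Ct r³`, both are
    -- of order `r²` for the first derivative and of order `r` for the second.
    set r := (t - s) ^ (1 / 3 : ℝ) with hr
    have hr₀ : 0 < r := Real.rpow_pos_of_pos hτ _
    have hr2 : (t - s) ^ (2 / 3 : ℝ) = r ^ 2 := by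
      rw [hr, ← Real.rpow_natCast, ← Real.rpow_mul hτ.le]; norm_num
    have hr3 : t - s = r ^ 3 := by
      rw [hr, ← Real.rpow_natCast, ← Real.rpow_mul hτ.le]; norm_num
    obtain ⟨h1, h2⟩ := norm_deriv_le_of_bounded₂ (f := fun x => σ t x - σ s x)
      (f' := fun x => fderiv ℝ (σ t) x - fderiv ℝ (σ s) x)
      (f'' := fun x => fderiv ℝ (fderiv ℝ (σ t)) x - fderiv ℝ (fderiv ℝ (σ s)) x)
      (A := Ct * (t - s)) (M := C + C)
      (fun x => (d1 t ht x).sub (d1 s hs x)) (fun x => (d2 t ht x).sub (d2 s hs x))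
      (fun x => tm s hs t ht hst.le x)
      ⟨C + C, fun x => (norm_sub_le _ _).trans (add_le_add (b1 t ht x) (b1 s hs x))⟩
      ((l2 t ht).sub (l2 s hs)).lip
      (by positivity) hr₀ x
    rw [hr2]
    refine ⟨h1.trans ?_, h2.trans ?_⟩
    · rw [hr3]
      have : 4 * (Ct * r ^ 3) / r = 4 * Ct * r ^ 2 := by field_simp
      rw [this]
      have : 0 ≤ (4 * Ct + 18 * C) * r ^ 2 := by positivity
      linarith
    · rw [hr3]
      have : 8 * (Ct * r ^ 3) / r ^ 2 = 8 * Ct * r := by field_simp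
      rw [this]
      linarith
  set K := 8 * Ct + 34 * C
  have hCK : C ≤ K := by simp only [K]; linarith
  have hCtK : Ct ≤ K := by simp only [K]; linarith
  refine ⟨K, ⟨by positivity, d1, fun t ht => (s0 t ht).mono hCK, fun t ht => (s1 t ht).mono hCK,
    fun s hs t ht hst x => (tm s hs t ht hst x).trans (by gcongr), ?_, ?_, ?_⟩⟩
  · intro s hs t ht hst x
    rcases hst.eq_or_lt with rfl | hst
    · simp
    · exact (interp s hs t ht hst x).1
  · intro s hs t ht hst x y
    rcases hst.eq_or_lt with rfl | hst
    · simp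
    · exact convex_univ.norm_image_sub_le_of_norm_hasFDerivWithin_le
        (f := fun x => σ t x - σ s x)
        (fun z _ => ((d1 t ht z).sub (d1 s hs z)).hasFDerivWithinAt)
        (fun z _ => (interp s hs t ht hst z).1) (mem_univ y) (mem_univ x)
  · intro s hs t ht hst x y
    rcases hst.eq_or_lt with rfl | hst
    · simp
    · exact convex_univ.norm_image_sub_le_of_norm_hasFDerivWithin_le
        (f := fun x => fderiv ℝ (σ t) x - fderiv ℝ (σ s) x)
        (fun z _ => ((d2 t ht z).sub (d2 s hs z)).hasFDerivWithinAt)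
        (fun z _ => (interp s hs t ht hst z).2) (mem_univ y) (mem_univ x)

end Coefficient

/-! ### Orders of magnitude for families of bounded Lipschitz maps -/

section Families

variable {ι E F G H : Type*} [NormedAddCommGroup E] [NormedSpace ℝ E]
  [NormedAddCommGroup F] [NormedSpace ℝ F] [NormedAddCommGroup G] [NormedSpace ℝ G]
  [NormedAddCommGroup H] [NormedSpace ℝ H] {w w' : ι → ℝ}

/-- The functions `f i` are bounded and Lipschitz with constants of the order of `w i`. -/
def IsBLO (w : ι → ℝ) (f : ι → E → F) : Prop := ∃ C, 0 ≤ C ∧ ∀ i, IsBL (C * w i) (f i)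

theorem IsBLO.add {f g : ι → E → F} (hf : IsBLO w f) (hg : IsBLO w g) :
    IsBLO w (fun i x => f i x + g i x) := by
  obtain ⟨C, hC, hf⟩ := hf
  obtain ⟨C', hC', hg⟩ := hg
  exact ⟨C + C', by positivity, fun i => by rw [add_mul]; exact (hf i).add (hg i)⟩

theorem IsBLO.neg {f : ι → E → F} (hf : IsBLO w f) : IsBLO w (fun i x => - f i x) := by
  obtain ⟨C, hC, hf⟩ := hf
  exact ⟨C, hC, fun i => (hf i).neg⟩

theorem IsBLO.mono {f : ι → E → F} (hf : IsBLO w f) (h : ∀ i, w i ≤ w' i) : IsBLO w' f := by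
  obtain ⟨C, hC, hf⟩ := hf
  exact ⟨C, hC, fun i => (hf i).mono (by gcongr; exact h i)⟩

theorem IsBLO.linear {f : ι → E → F} (hf : IsBLO w f) {c : ℝ} (hc : 0 ≤ c) (hw' : ∀ i, 0 ≤ w' i)
    (L : ι → F →ₗ[ℝ] G) (hL : ∀ i u, ‖L i u‖ ≤ c * w' i * ‖u‖) :
    IsBLO (fun i => w i * w' i) (fun i x => L i (f i x)) := by
  obtain ⟨C, hC, hf⟩ := hf
  refine ⟨C * c, by positivity, fun i => ?_⟩
  refine ((hf i).linear (mul_nonneg hc (hw' i)) (L i) (hL i)).mono (le_of_eq ?_)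
  ring

theorem IsBLO.bilin {f : ι → E → F} {g : ι → E → G} (L : F →L[ℝ] G →L[ℝ] H) (hf : IsBLO w f)
    (hg : IsBLO w' g) : IsBLO (fun i => w i * w' i) (fun i x => L (f i x) (g i x)) := by
  obtain ⟨C, hC, hf⟩ := hf
  obtain ⟨C', hC', hg⟩ := hg
  exact ⟨2 * (‖L‖ * (C * C')), by positivity, fun i =>
    ((hf i).bilin L (hg i)).mono (le_of_eq (by ring))⟩

theorem IsBLO.clm_apply {f : ι → E → F →L[ℝ] G} {g : ι → E → F} (hf : IsBLO w f)
    (hg : IsBLO w' g) : IsBLO (fun i => w i * w' i) (fun i x => f i x (g i x)) :=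
  hf.bilin (ContinuousLinearMap.id ℝ (F →L[ℝ] G)) hg

theorem IsBLO.clm_comp {f : ι → E → F →L[ℝ] G} {g : ι → E → H →L[ℝ] F} (hf : IsBLO w f)
    (hg : IsBLO w' g) : IsBLO (fun i => w i * w' i) (fun i x => (f i x).comp (g i x)) :=
  hf.bilin (ContinuousLinearMap.compL ℝ H F G) hg

theorem IsBL₂.clm_comp {K K' : ℝ} {f : E → F →L[ℝ] G} {g : E → H →L[ℝ] F} (hf : IsBL₂ K f)
    (hg : IsBL₂ K' g) : IsBL₂ (6 * (K * K')) (fun x => (f x).comp (g x)) := by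
  have h0 : 0 ≤ K * K' := mul_nonneg hf.nonneg hg.nonneg
  refine (hf.bilin (ContinuousLinearMap.compL ℝ H F G) hg).mono ?_
  exact mul_le_mul_of_nonneg_left
    (mul_le_of_le_one_left h0 (ContinuousLinearMap.norm_compL_le ℝ H F G)) (by norm_num)

theorem IsBLO.comp {f : ι → F → G} (hf : IsBLO w f) {c : ℝ} (hc : 1 ≤ c) {φ : ι → E → F}
    (hφ : ∀ i x y, ‖φ i x - φ i y‖ ≤ c * ‖x - y‖) : IsBLO w (fun i x => f i (φ i x)) := by
  obtain ⟨C, hC, hf⟩ := hf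
  refine ⟨c * C, by positivity, fun i => ((hf i).comp hc (hφ i)).mono (le_of_eq (by ring))⟩

theorem IsBLO.increment {f : ι → E → F} {v : ι → E → E} (hv : IsBLO w v) {K : ℝ} (hK : 0 ≤ K)
    (hf : ∀ i, IsBL₂ K (f i)) : IsBLO w (fun i x => f i (x + v i x) - f i x) := by
  obtain ⟨C, hC, hv⟩ := hv
  exact ⟨2 * (K * C), by positivity, fun i =>
    ((hf i).increment (hv i)).mono (le_of_eq (by ring))⟩

theorem IsBLO.taylor {f : ι → E → F} {f' : ι → E → E →L[ℝ] F} {v : ι → E → E} (hv : IsBLO w v)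
    {K : ℝ} (hK : 0 ≤ K) (hf : ∀ i x, HasFDerivAt (f i) (f' i x) x) (hf' : ∀ i, IsBL₂ K (f' i)) :
    IsBLO (fun i => w i ^ 2) (fun i x => f i (x + v i x) - f i x - f' i x (v i x)) := by
  obtain ⟨C, hC, hv⟩ := hv
  exact ⟨3 * (K * C ^ 2), by positivity, fun i =>
    (IsBL₂.taylor (hf i) (hf' i) (hv i)).mono (le_of_eq (by ring))⟩

end Families

/-! ### Contraction with the Lévy area -/

section Contract

variable {d : ℕ} {V W : Type*} [NormedAddCommGroup V] [NormedSpace ℝ V]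
  [NormedAddCommGroup W] [NormedSpace ℝ W]

theorem norm_contract_le (A : Vec d →L[ℝ] Vec d →L[ℝ] V) (M : Fin d → Fin d → ℝ) :
    ‖contract A M‖ ≤ (d : ℝ) ^ 2 * ‖M‖ * ‖A‖ := by
  have h : ∀ i j, ‖M i j • A (EuclideanSpace.single i 1) (EuclideanSpace.single j 1)‖
      ≤ ‖M‖ * ‖A‖ := by
    intro i j
    rw [norm_smul]
    have h1 : ‖M i j‖ ≤ ‖M‖ := (norm_le_pi_norm (M i) j).trans (norm_le_pi_norm M i)
    have h2 := A.le_opNorm₂ (EuclideanSpace.single i 1) (EuclideanSpace.single j 1)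
    simp only [PiLp.norm_single, norm_one, mul_one] at h2
    gcongr
  calc ‖contract A M‖ ≤ ∑ i : Fin d, ∑ j : Fin d, ‖M‖ * ‖A‖ :=
        (norm_sum_le _ _).trans (Finset.sum_le_sum fun i _ =>
          (norm_sum_le _ _).trans (Finset.sum_le_sum fun j _ => h i j))
    _ = _ := by simp; ring

theorem contract_add (A : Vec d →L[ℝ] Vec d →L[ℝ] V) (M N : Fin d → Fin d → ℝ) :
    contract A (M + N) = contract A M + contract A N := by
  simp [contract, add_smul, Finset.sum_add_distrib]

/-- The contraction with a matrix, as a linear map. -/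
noncomputable def contractₗ (M : Fin d → Fin d → ℝ) : (Vec d →L[ℝ] Vec d →L[ℝ] V) →ₗ[ℝ] V where
  toFun A := contract A M
  map_add' A B := by simp [contract, Finset.sum_add_distrib]
  map_smul' c A := by simp [contract, Finset.smul_sum, smul_comm c]

@[simp] theorem contractₗ_apply (M : Fin d → Fin d → ℝ) (A : Vec d →L[ℝ] Vec d →L[ℝ] V) :
    contractₗ M A = contract A M := rfl

theorem contract_sub_left (A B : Vec d →L[ℝ] Vec d →L[ℝ] V) (M : Fin d → Fin d → ℝ) :
    contract (A - B) M = contract A M - contract B M :=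
  map_sub (contractₗ M) A B

/-- Applied to the rank-one term of Chen's relation, this yields `A (δζ_{su}) (δζ_{ut})`, which
completes the first-order Taylor expansion of `σ`. -/
theorem contract_tensor (A : Vec d →L[ℝ] Vec d →L[ℝ] V) (u v : Vec d) :
    contract A (fun i j => u i * v j) = A u v := by
  have hu : ∀ u : Vec d, u = ∑ i, u i • EuclideanSpace.single i (1 : ℝ) := fun u => by
    simpa using ((EuclideanSpace.basisFun (Fin d) ℝ).sum_repr u).symm
  conv_rhs => rw [hu u, hu v]
  simp only [contract, map_sum, map_smul, sum_apply, smul_apply, Finset.smul_sum, smul_smul]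
  rw [Finset.sum_comm]
  simp only [mul_comm]

end Contract

/-! ### The one-step maps of the rough equation form an almost flow -/

section Germ

variable {E : Type*} [NormedAddCommGroup E] [NormedSpace ℝ E]

/-- `x ↦ x + A s t x` is an almost flow: the one-step maps `A s t` are regular of order
`(t - s) ^ α`, and they are additive up to an error of order `(t - s) ^ (2 / 3 + α)`. -/
structure IsAlmostFlow (T α C : ℝ) (A : ℝ → ℝ → E → E) : Prop where
  nonneg : 0 ≤ C
  regular : ∀ s t, 0 ≤ s → s ≤ t → t ≤ T → t - s ≤ 1 → IsBL₂ (C * (t - s) ^ α) (A s t)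
  almost : ∀ s u t, 0 ≤ s → s ≤ u → u ≤ t → t ≤ T → t - s ≤ 1 →
    IsBL (C * (t - s) ^ (2 / 3 + α)) (fun x => A s t x - A s u x - A u t (x + A s u x))

variable {d : ℕ}

/-- The one-step map `x ↦ σ_s(x) δζ_{st} + (∇σ_s σ_s)(x) Z_{st}`. -/
noncomputable def roughGerm (ζ : ℝ → Vec d) (Z : ℝ → ℝ → Fin d → Fin d → ℝ) (σ : ℝ → E → Vec d →L[ℝ] E)
    (s t : ℝ) (x : E) : E :=
  σ s x (inc ζ s t) + contract ((fderiv ℝ (σ s) x).comp (σ s x)) (Z s t)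

theorem inc_add (ζ : ℝ → E) (s u t : ℝ) : inc ζ s t = inc ζ s u + inc ζ u t := by
  simp [inc]

theorem IsGeometricRoughPath.area_eq {T α : ℝ} {ζ : ℝ → Vec d} {Z : ℝ → ℝ → Fin d → Fin d → ℝ}
    (hζ : IsGeometricRoughPath T α ζ Z) {s u t : ℝ} (hs : 0 ≤ s) (hsu : s ≤ u) (hut : u ≤ t)
    (ht : t ≤ T) : Z s t = Z s u + Z u t + fun i j => inc ζ s u i * inc ζ u t j := by
  ext i j
  have := hζ.chen s u t hs hsu hut ht i j
  simp only [inc₂, Pi.sub_apply] at this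
  simp only [Pi.add_apply]
  linarith

theorem IsGeometricRoughPath.exists_bound {T α : ℝ} {ζ : ℝ → Vec d}
    {Z : ℝ → ℝ → Fin d → Fin d → ℝ} (hζ : IsGeometricRoughPath T α ζ Z) :
    ∃ C, 0 ≤ C ∧ ∀ s t, 0 ≤ s → s ≤ t → t ≤ T →
      ‖inc ζ s t‖ ≤ C * (t - s) ^ α ∧ ‖Z s t‖ ≤ C * (t - s) ^ (2 * α) := by
  obtain ⟨C, hC⟩ := hζ.holder
  obtain ⟨C', hC'⟩ := hζ.holder_area
  refine ⟨max (max C C') 0, le_max_right _ _, fun s t hs hst ht => ⟨?_, ?_⟩⟩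
  · refine (hC s t hs hst ht).trans ?_
    have : 0 ≤ (t - s) ^ α := Real.rpow_nonneg (sub_nonneg.2 hst) _
    gcongr
    exact (le_max_left _ _).trans (le_max_left _ _)
  · refine (hC' s t hs hst ht).trans ?_
    have : 0 ≤ (t - s) ^ (2 * α) := Real.rpow_nonneg (sub_nonneg.2 hst) _
    gcongr
    exact (le_max_right _ _).trans (le_max_left _ _)

/-- Chen's relation turns the defect into products of one remainder and one increment of the rough
path. The point `y` is free: `y = x + A_{su}(x)` gives the almost flow property, and `y = x_u` gives
the cocycle sewn in the rough integral. -/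
theorem roughGerm_defect {T α : ℝ} {ζ : ℝ → Vec d} {Z : ℝ → ℝ → Fin d → Fin d → ℝ}
    (hζ : IsGeometricRoughPath T α ζ Z) (σ : ℝ → E → Vec d →L[ℝ] E) {s u t : ℝ} (hs : 0 ≤ s)
    (hsu : s ≤ u) (hut : u ≤ t) (ht : t ≤ T) (x y : E) :
    roughGerm ζ Z σ s t x - roughGerm ζ Z σ s u x - roughGerm ζ Z σ u t y
      = - ((σ u y - σ s x - fderiv ℝ (σ s) x (σ s x (inc ζ s u))) (inc ζ u t)
        + contract ((fderiv ℝ (σ u) y).comp (σ u y) - (fderiv ℝ (σ s) x).comp (σ s x))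
          (Z u t)) := by
  simp only [roughGerm, hζ.area_eq hs hsu hut ht, inc_add ζ s u t, contract_add, contract_tensor,
    contract_sub_left, map_add, sub_apply, ContinuousLinearMap.comp_apply]
  abel

/-- In the defect, the factor of `δζ_{ut}` is of order `2/3` and the factor of `Z_{ut}` of order
`1/3`. Since `δζ` has order `α` and `Z` has order `2 α ≥ 1/3 + α`, both products reach `2/3 + α`.
All factors are estimated in sup norm and Lipschitz norm at once. -/
theorem exists_isAlmostFlow_roughGerm {T α : ℝ} (hα : 1 / 3 < α) {ζ : ℝ → Vec d}
    {Z : ℝ → ℝ → Fin d → Fin d → ℝ} (hζ : IsGeometricRoughPath T α ζ Z) {K : ℝ}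
    {σ : ℝ → E → Vec d →L[ℝ] E} (hσ : IsRegularCoefficient T K σ) :
    ∃ C, IsAlmostFlow T α C (roughGerm ζ Z σ) := by
  obtain ⟨c, hc, hcζ⟩ := hζ.exists_bound
  have hK := hσ.nonneg
  set S : ℝ → E → Vec d →L[ℝ] Vec d →L[ℝ] E := fun s x => (fderiv ℝ (σ s) x).comp (σ s x) with hS
  have hS₂ : ∀ s ∈ Icc 0 T, IsBL₂ (6 * (K * K)) (S s) := fun s hs =>
    (hσ.space_deriv s hs).clm_comp (hσ.space s hs)
  have hgerm : ∃ C, 0 ≤ C ∧ ∀ s t, 0 ≤ s → s ≤ t → t ≤ T → t - s ≤ 1 →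
      IsBL₂ (C * (t - s) ^ α) (roughGerm ζ Z σ s t) := by
    refine ⟨c * K + (d : ℝ) ^ 2 * c * (6 * (K * K)), by positivity,
      fun s t hs hst ht h1 => ?_⟩
    have hτ : 0 ≤ t - s := sub_nonneg.2 hst
    obtain ⟨h2, h3⟩ := hcζ s t hs hst ht
    have h4 : (t - s) ^ (2 * α) ≤ (t - s) ^ α :=
      Real.rpow_le_rpow_of_exponent_ge' hτ h1 (by linarith) (by linarith)
    have hs' : s ∈ Icc 0 T := ⟨hs, hst.trans ht⟩
    have e1 := (hσ.space s hs').linear (c := c * (t - s) ^ α) (by positivity)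
      (ContinuousLinearMap.apply ℝ E (inc ζ s t)).toLinearMap (fun u => by
        refine (u.le_opNorm _).trans ?_
        rw [mul_comm]
        gcongr)
    have e2 := (hS₂ s hs').linear (c := (d : ℝ) ^ 2 * (c * (t - s) ^ α)) (by positivity)
      (contractₗ (Z s t)) (fun u => by
        refine (norm_contract_le _ _).trans ?_
        have h5 : ‖Z s t‖ ≤ c * (t - s) ^ α := h3.trans (by gcongr)
        gcongr)
    refine (e1.add e2).mono (le_of_eq ?_)
    ring
  obtain ⟨C₁, hC₁, hgerm⟩ := hgerm
  -- All triples `s ≤ u ≤ t` with `t - s ≤ 1` form the index set, so that the implied constants are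
  -- uniform in them.
  let ι := {p : ℝ × ℝ × ℝ // 0 ≤ p.1 ∧ p.1 ≤ p.2.1 ∧ p.2.1 ≤ p.2.2 ∧ p.2.2 ≤ T ∧ p.2.2 - p.1 ≤ 1}
  let s : ι → ℝ := fun i => i.1.1
  let u : ι → ℝ := fun i => i.1.2.1
  let t : ι → ℝ := fun i => i.1.2.2
  have hs : ∀ i, 0 ≤ s i := fun i => i.2.1
  have hsu : ∀ i, s i ≤ u i := fun i => i.2.2.1
  have hut : ∀ i, u i ≤ t i := fun i => i.2.2.2.1
  have htT : ∀ i, t i ≤ T := fun i => i.2.2.2.2.1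
  have h1 : ∀ i, t i - s i ≤ 1 := fun i => i.2.2.2.2.2
  have hτ : ∀ i, 0 ≤ t i - s i := fun i => by linarith [hsu i, hut i]
  have hsI : ∀ i, s i ∈ Icc 0 T := fun i => ⟨hs i, by linarith [hsu i, hut i, htT i]⟩
  have huI : ∀ i, u i ∈ Icc 0 T := fun i => ⟨by linarith [hs i, hsu i], by linarith [hut i, htT i]⟩
  let τ : ι → ℝ := fun i => t i - s i
  have hsu_pow : ∀ i (p q : ℝ), 0 ≤ q → q ≤ p → (u i - s i) ^ p ≤ τ i ^ q := fun i p q hq hqp =>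
    (Real.rpow_le_rpow_of_exponent_ge' (sub_nonneg.2 (hsu i)) (by linarith [h1 i, hut i]) hq
      hqp).trans (Real.rpow_le_rpow (sub_nonneg.2 (hsu i)) (by simp only [τ]; linarith [hut i]) hq)
  have hut_pow : ∀ i (p q : ℝ), 0 ≤ q → q ≤ p → (t i - u i) ^ p ≤ τ i ^ q := fun i p q hq hqp =>
    (Real.rpow_le_rpow_of_exponent_ge' (sub_nonneg.2 (hut i)) (by linarith [h1 i, hsu i]) hq
      hqp).trans (Real.rpow_le_rpow (sub_nonneg.2 (hut i)) (by simp only [τ]; linarith [hsu i]) hq)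
  have hτ_pow : ∀ i (p q : ℝ), 0 ≤ q → q ≤ p → τ i ^ p ≤ τ i ^ q := fun i p q hq hqp =>
    Real.rpow_le_rpow_of_exponent_ge' (hτ i) (h1 i) hq hqp
  have hτ_nonneg : ∀ i (p : ℝ), 0 ≤ τ i ^ p := fun i p => Real.rpow_nonneg (hτ i) p
  have hτ_mul : ∀ i (p q : ℝ), 0 ≤ p → 0 ≤ q → τ i ^ p * τ i ^ q = τ i ^ (p + q) :=
    fun i p q hp hq => (Real.rpow_add_of_nonneg (hτ i) hp hq).symm
  have hζut : ∀ i, ‖inc ζ (u i) (t i)‖ ≤ c * τ i ^ α := fun i =>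
    ((hcζ _ _ (huI i).1 (hut i) (htT i)).1).trans
      (mul_le_mul_of_nonneg_left (hut_pow i _ _ (by linarith) le_rfl) hc)
  have hZut : ∀ i, ‖Z (u i) (t i)‖ ≤ c * τ i ^ (1 / 3 + α) := fun i =>
    ((hcζ _ _ (huI i).1 (hut i) (htT i)).2).trans
      (mul_le_mul_of_nonneg_left (hut_pow i _ _ (by linarith) (by linarith)) hc)
  have hZsu : ∀ i, ‖Z (s i) (u i)‖ ≤ c * τ i ^ (2 / 3 : ℝ) := fun i =>
    ((hcζ _ _ (hs i) (hsu i) (huI i).2).2).trans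
      (mul_le_mul_of_nonneg_left (hsu_pow i _ _ (by norm_num) (by linarith)) hc)
  let v : ι → E → E := fun i => roughGerm ζ Z σ (s i) (u i)
  have hv : IsBLO (fun i => τ i ^ (1 / 3 : ℝ)) v := ⟨C₁, hC₁, fun i =>
    (hgerm _ _ (hs i) (hsu i) (huI i).2 (by linarith [h1 i, hut i])).toIsBL.mono
      (mul_le_mul_of_nonneg_left (hsu_pow i _ _ (by norm_num) (by linarith)) hC₁)⟩
  have hφ : ∀ i x y, ‖(x + v i x) - (y + v i y)‖ ≤ (1 + C₁) * ‖x - y‖ := by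
    intro i x y
    have h2 : ‖v i x - v i y‖ ≤ C₁ * ‖x - y‖ := by
      refine ((hgerm _ _ (hs i) (hsu i) (huI i).2 (by linarith [h1 i, hut i])).lip x y).trans ?_
      have : (u i - s i) ^ α ≤ 1 :=
        Real.rpow_le_one (sub_nonneg.2 (hsu i)) (by linarith [h1 i, hut i]) (by linarith)
      exact mul_le_mul_of_nonneg_right (mul_le_of_le_one_right hC₁ this) (norm_nonneg _)
    rw [add_sub_add_comm, add_mul, one_mul]
    exact (norm_add_le _ _).trans (by gcongr)
  have ht0 : IsBLO (fun i => τ i ^ (2 / 3 : ℝ)) (fun i x => σ (u i) x - σ (s i) x) := by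
    refine ⟨K, hK, fun i => ⟨fun x => ?_, fun x y => ?_⟩⟩
    · refine (hσ.time _ (hsI i) _ (huI i) (hsu i) x).trans (mul_le_mul_of_nonneg_left ?_ hK)
      simpa using hsu_pow i 1 (2 / 3) (by norm_num) (by norm_num)
    · refine (hσ.time_lip _ (hsI i) _ (huI i) (hsu i) x y).trans ?_
      have := hsu_pow i (2 / 3) (2 / 3) (by norm_num) le_rfl
      gcongr
  have ht1 : IsBLO (fun i => τ i ^ (1 / 3 : ℝ))
      (fun i x => fderiv ℝ (σ (u i)) x - fderiv ℝ (σ (s i)) x) := by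
    refine ⟨K, hK, fun i => ⟨fun x => ?_, fun x y => ?_⟩⟩
    · exact (hσ.time_deriv _ (hsI i) _ (huI i) (hsu i) x).trans
        (mul_le_mul_of_nonneg_left (hsu_pow i _ _ (by norm_num) (by norm_num)) hK)
    · refine (hσ.time_deriv_lip _ (hsI i) _ (huI i) (hsu i) x y).trans ?_
      have := hsu_pow i (1 / 3) (1 / 3) (by norm_num) le_rfl
      gcongr
  have hσu : IsBLO (fun _ : ι => 1) (fun i => σ (u i)) :=
    ⟨K, hK, fun i => by simpa using (hσ.space _ (huI i)).toIsBL⟩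
  have hDσs : IsBLO (fun _ : ι => 1) (fun i => fderiv ℝ (σ (s i))) :=
    ⟨K, hK, fun i => by simpa using (hσ.space_deriv _ (hsI i)).toIsBL⟩
  have hSs : IsBLO (fun _ : ι => 1) (fun i => S (s i)) := by
    simpa using hDσs.clm_comp
      (g := fun i => σ (s i)) ⟨K, hK, fun i => by simpa using (hσ.space _ (hsI i)).toIsBL⟩
  have hc1 : (1 : ℝ) ≤ 1 + C₁ := by linarith
  -- `σ_u(x + v) - σ_s(x) - ∇σ_s σ_s(x) δζ_{su}`, with `v = A_{su}(x)`, is the sum of a time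
  -- increment (`g1`), a Taylor remainder quadratic in `v` (`g2`), and `∇σ_s(x)` applied to the area
  -- part of `v` (`g3`).
  have g1 : IsBLO (fun i => τ i ^ (2 / 3 : ℝ))
      (fun i x => σ (u i) (x + v i x) - σ (s i) (x + v i x)) :=
    ht0.comp hc1 hφ
  have g2 : IsBLO (fun i => τ i ^ (2 / 3 : ℝ))
      (fun i x => σ (s i) (x + v i x) - σ (s i) x - fderiv ℝ (σ (s i)) x (v i x)) :=
    (hv.taylor hK (fun i x => hσ.hasFDerivAt _ (hsI i) x) fun i => hσ.space_deriv _ (hsI i)).mono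
      fun i => by rw [sq, hτ_mul i _ _ (by norm_num) (by norm_num)]; norm_num
  have g3 : IsBLO (fun i => τ i ^ (2 / 3 : ℝ))
      (fun i x => fderiv ℝ (σ (s i)) x (contract (S (s i) x) (Z (s i) (u i)))) := by
    have := hDσs.clm_apply (hSs.linear (c := (d : ℝ) ^ 2 * c) (by positivity)
      (fun i => hτ_nonneg i (2 / 3)) (fun i => contractₗ (Z (s i) (u i))) fun i A => by
        refine (norm_contract_le _ _).trans ?_
        rw [mul_assoc _ c]
        gcongr
        exact hZsu i)
    simpa using this
  -- The increment of `∇σ σ` splits into its time part (`g4`) and its space part (`g5`).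
  have g4 : IsBLO (fun i => τ i ^ (1 / 3 : ℝ))
      (fun i x => S (u i) (x + v i x) - S (s i) (x + v i x)) := by
    have h2 := (ht1.clm_comp hσu).mono (w' := fun i => τ i ^ (1 / 3 : ℝ)) fun i => by simp
    have h3 := (hDσs.clm_comp ht0).mono (w' := fun i => τ i ^ (1 / 3 : ℝ)) fun i => by
      simpa using hτ_pow i (2 / 3) (1 / 3) (by norm_num) (by norm_num)
    have h4 := (h2.add h3).comp hc1 hφ
    convert h4 using 3 with i x
    ext a b
    simp [hS]
  have g5 : IsBLO (fun i => τ i ^ (1 / 3 : ℝ))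
      (fun i x => S (s i) (x + v i x) - S (s i) x) :=
    hv.increment (by positivity) fun i => hS₂ _ (hsI i)
  have k1 := (((g1.add g2).add g3).linear hc (fun i => hτ_nonneg i α)
    (fun i => (ContinuousLinearMap.apply ℝ E (inc ζ (u i) (t i))).toLinearMap) fun i A => by
      refine (A.le_opNorm _).trans ?_
      rw [mul_comm]
      gcongr
      exact hζut i).mono (w' := fun i => τ i ^ (2 / 3 + α)) fun i =>
      (hτ_mul i _ _ (by norm_num) (by linarith)).le
  have k2 := ((g4.add g5).linear (c := (d : ℝ) ^ 2 * c) (by positivity)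
    (fun i => hτ_nonneg i (1 / 3 + α)) (fun i => contractₗ (Z (u i) (t i))) fun i A => by
      refine (norm_contract_le _ _).trans ?_
      rw [mul_assoc _ c]
      gcongr
      exact hZut i).mono (w' := fun i => τ i ^ (2 / 3 + α)) fun i => by
      rw [hτ_mul i _ _ (by norm_num) (by linarith)]
      exact le_of_eq (by congr 1; ring)
  obtain ⟨C₂, hC₂, hN⟩ := (k1.add k2).neg
  refine ⟨max C₁ C₂, ⟨hC₁.trans (le_max_left _ _), fun a b ha hab hb h => ?_,
    fun a b e ha hab hbe he h => ?_⟩⟩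
  · have : 0 ≤ (b - a) ^ α := Real.rpow_nonneg (sub_nonneg.2 hab) _
    exact (hgerm a b ha hab hb h).mono (by gcongr; exact le_max_left _ _)
  · have h2 := (hN ⟨(a, b, e), ha, hab, hbe, he, h⟩).mono
      (mul_le_mul_of_nonneg_right (le_max_right C₁ C₂) (hτ_nonneg _ _))
    convert h2 using 2 with x
    rw [roughGerm_defect hζ σ ha hab hbe he]
    simp [v, s, u, t, hS, roughGerm]
    abel

end Germ

/-! ### Sewing bounds -/

section Sewing

variable {E : Type*} [NormedAddCommGroup E]

theorem two_rpow_one_sub_lt_one {θ : ℝ} (hθ : 1 < θ) : (2 : ℝ) ^ (1 - θ) < 1 :=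
  Real.rpow_lt_one_of_one_lt_of_neg (by norm_num) (by linarith)

theorem two_mul_half_rpow {θ τ : ℝ} (hτ : 0 ≤ τ) :
    2 * (τ / 2) ^ θ = 2 ^ (1 - θ) * τ ^ θ := by
  rw [Real.div_rpow hτ (by norm_num), Real.rpow_sub (by norm_num), Real.rpow_one]
  ring

/-- The sewing bound: a two-index map of order larger than one, which is additive at midpoints up
to an error of order `θ > 1`, is itself of order `θ`. -/
theorem norm_le_of_midpoint {J : ℝ → ℝ → E} {a b h θ θ' L M : ℝ} (hθ : 1 < θ) (hθ' : 1 < θ')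
    (hM : 0 ≤ M)
    (hJ : ∀ s t, a ≤ s → s ≤ t → t ≤ b → t - s ≤ h → ‖J s t‖ ≤ L * (t - s) ^ θ')
    (hδ : ∀ s u t, a ≤ s → s ≤ t → t ≤ b → t - s ≤ h → u = (s + t) / 2 →
      ‖J s t‖ ≤ ‖J s u‖ + ‖J u t‖ + M * (t - s) ^ θ)
    {s t : ℝ} (hs : a ≤ s) (hst : s ≤ t) (ht : t ≤ b) (hh : t - s ≤ h) :
    ‖J s t‖ ≤ M / (1 - 2 ^ (1 - θ)) * (t - s) ^ θ := by
  set q := (2 : ℝ) ^ (1 - θ) with hq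
  set q' := (2 : ℝ) ^ (1 - θ') with hq'
  have h1 : 0 < 1 - q := by linarith [two_rpow_one_sub_lt_one hθ]
  have hq'0 : 0 ≤ q' := by positivity
  -- After `n` bisections the crude bound survives only with the factor `q' ^ n`, since `θ' > 1`,
  -- while the additivity errors sum to a geometric series of ratio `q`.
  have key : ∀ n : ℕ, ∀ s t, a ≤ s → s ≤ t → t ≤ b → t - s ≤ h →
      ‖J s t‖ ≤ M / (1 - q) * (t - s) ^ θ + q' ^ n * (L * (t - s) ^ θ') := by
    intro n
    induction n with
    | zero =>
      intro s t hs hst ht hh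
      have := hJ s t hs hst ht hh
      have : 0 ≤ M / (1 - q) * (t - s) ^ θ :=
        mul_nonneg (by positivity) (Real.rpow_nonneg (by linarith) _)
      rw [pow_zero, one_mul]
      linarith
    | succ n ih =>
      intro s t hs hst ht hh
      have e1 := ih s ((s + t) / 2) hs (by linarith) (by linarith) (by linarith)
      have e2 := ih ((s + t) / 2) t (by linarith) (by linarith) ht (by linarith)
      have e3 := hδ s _ t hs hst ht hh rfl
      rw [show (s + t) / 2 - s = (t - s) / 2 by ring] at e1
      rw [show t - (s + t) / 2 = (t - s) / 2 by ring] at e2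
      have f1 := two_mul_half_rpow (θ := θ) (sub_nonneg.2 hst)
      have f2 := two_mul_half_rpow (θ := θ') (sub_nonneg.2 hst)
      calc ‖J s t‖ ≤ M / (1 - q) * (2 * ((t - s) / 2) ^ θ)
            + q' ^ n * (L * (2 * ((t - s) / 2) ^ θ')) + M * (t - s) ^ θ := by linarith
        _ = _ := by
          rw [f1, f2, ← hq, ← hq']
          field_simp
          ring
  have hlim : Tendsto (fun n : ℕ => M / (1 - q) * (t - s) ^ θ + q' ^ n * (L * (t - s) ^ θ')) atTop
      (𝓝 (M / (1 - q) * (t - s) ^ θ + 0 * (L * (t - s) ^ θ'))) :=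
    ((tendsto_pow_atTop_nhds_zero_of_lt_one hq'0 (two_rpow_one_sub_lt_one hθ')).mul_const
      _).const_add _
  have := ge_of_tendsto' hlim fun n => key n s t hs hst ht hh
  simpa using this

/-- A variant of the sewing bound, in which the additivity error may also contain a small multiple
of the map itself. -/
theorem norm_le_of_midpoint_of_small {J : ℝ → ℝ → E} {a b h θ θ' α C L M : ℝ} (hθ : 1 < θ)
    (hθ' : 1 < θ') (hα : 0 ≤ α) (hθα : θ ≤ 1 + α) (h1 : h ≤ 1) (h0 : 0 ≤ h) (hC : 0 ≤ C)
    (hM : 0 ≤ M) (hL : 0 ≤ L) (hsmall : C * h ^ α ≤ (1 - 2 ^ (1 - θ)) / 2)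
    (hJ : ∀ s t, a ≤ s → s ≤ t → t ≤ b → t - s ≤ h → ‖J s t‖ ≤ L * (t - s) ^ θ')
    (hδ : ∀ s u t, a ≤ s → s ≤ u → u ≤ t → t ≤ b → t - s ≤ h →
      ‖J s t‖ ≤ ‖J s u‖ + ‖J u t‖ + (M * (t - s) ^ θ + C * (t - s) ^ α * ‖J s u‖))
    {s t : ℝ} (hs : a ≤ s) (hst : s ≤ t) (ht : t ≤ b) (hh : t - s ≤ h) :
    ‖J s t‖ ≤ 2 * M / (1 - 2 ^ (1 - θ)) * (t - s) ^ θ := by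
  set q := (2 : ℝ) ^ (1 - θ) with hq
  have hq0 : 0 < q := by positivity
  have hq1 : 0 < 1 - q := by linarith [two_rpow_one_sub_lt_one hθ]
  -- First a bound of the right order `θ` but with a constant depending on `L`: the crude estimate
  -- makes the self-referential error of order `1 + α ≥ θ`.
  have qual : ∀ s t, a ≤ s → s ≤ t → t ≤ b → t - s ≤ h →
      ‖J s t‖ ≤ (M + C * L) / (1 - q) * (t - s) ^ θ := by
    intro s t hs hst ht hh
    refine norm_le_of_midpoint hθ hθ' (by positivity) hJ ?_ hs hst ht hh
    intro s u t hs hst ht hh hu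
    refine (hδ s u t hs (by linarith) (by linarith) ht hh).trans ?_
    have hτ : 0 ≤ t - s := sub_nonneg.2 hst
    have e1 : ‖J s u‖ ≤ L * (t - s) ^ (1 : ℝ) := by
      refine (hJ s u hs (by linarith) (by linarith) (by linarith)).trans ?_
      gcongr
      calc (u - s) ^ θ' ≤ (t - s) ^ θ' := by
            apply Real.rpow_le_rpow <;> linarith
        _ ≤ (t - s) ^ (1 : ℝ) :=
            Real.rpow_le_rpow_of_exponent_ge' hτ (by linarith) (by norm_num) hθ'.le
    have e2 : (t - s) ^ α * (t - s) ^ (1 : ℝ) ≤ (t - s) ^ θ := by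
      rw [← Real.rpow_add_of_nonneg hτ hα (by norm_num)]
      exact Real.rpow_le_rpow_of_exponent_ge' hτ (by linarith) (by linarith) (by linarith)
    have e3 : C * (t - s) ^ α * ‖J s u‖ ≤ C * L * (t - s) ^ θ := by
      calc _ ≤ C * (t - s) ^ α * (L * (t - s) ^ (1 : ℝ)) := by gcongr
        _ = C * L * ((t - s) ^ α * (t - s) ^ (1 : ℝ)) := by ring
        _ ≤ _ := by gcongr
    linarith
  let ι := {p : ℝ × ℝ // a ≤ p.1 ∧ p.1 ≤ p.2 ∧ p.2 ≤ b ∧ p.2 - p.1 ≤ h}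
  -- Bisecting once more contributes the factor `q`, and the self-referential term at most `(1 - q)
  -- / 2`. Their sum `(1 + q) / 2` is a contraction, so `L` disappears from the constant.
  have := le_of_forall_improve (ι := ι) (f := fun p => ‖J p.1.1 p.1.2‖)
    (g := fun p => (p.1.2 - p.1.1) ^ θ) (θ := (1 + q) / 2) (b := M) (by positivity) (by linarith)
    hM (fun p => Real.rpow_nonneg (sub_nonneg.2 p.2.2.1) _)
    ⟨(M + C * L) / (1 - q), by positivity, fun p => qual _ _ p.2.1 p.2.2.1 p.2.2.2.1 p.2.2.2.2⟩
    ?_ ⟨(s, t), hs, hst, ht, hh⟩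
  · refine this.trans (le_of_eq ?_)
    simp only
    congr 1
    rw [div_eq_div_iff (by linarith) (by linarith)]
    ring
  · rintro A hA ih ⟨⟨s, t⟩, hs, hst, ht, hh⟩
    simp only at hs hst ht hh ⊢
    have hτ : 0 ≤ t - s := sub_nonneg.2 hst
    have e1 := ih ⟨(s, (s + t) / 2), hs, by simp only; linarith, by simp only; linarith,
      by simp only; linarith⟩
    have e2 := ih ⟨((s + t) / 2, t), by simp only; linarith, by simp only; linarith, ht,
      by simp only; linarith⟩
    have e3 := hδ s ((s + t) / 2) t hs (by linarith) (by linarith) ht hh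
    simp only at e1 e2
    rw [show (s + t) / 2 - s = (t - s) / 2 by ring] at e1
    rw [show t - (s + t) / 2 = (t - s) / 2 by ring] at e2
    have f1 := two_mul_half_rpow (θ := θ) hτ
    have f0 : 0 ≤ (t - s) ^ θ := Real.rpow_nonneg hτ _
    have f3 : ‖J s ((s + t) / 2)‖ ≤ A * (t - s) ^ θ := by
      refine e1.trans ?_
      gcongr
      linarith
    have f4 : C * (t - s) ^ α ≤ (1 - q) / 2 := by
      refine le_trans ?_ hsmall
      gcongr
    have f5 : C * (t - s) ^ α * ‖J s ((s + t) / 2)‖ ≤ (1 - q) / 2 * (A * (t - s) ^ θ) := by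
      gcongr
    have f6 : 2 * (A * ((t - s) / 2) ^ θ) = A * (q * (t - s) ^ θ) := by rw [hq, ← f1]; ring
    rw [add_mul]
    linarith [f6, f5, e1, e2, e3]

end Sewing

/-! ### Flow lines and their a priori bounds -/

section WeakFlow

variable {E : Type*} [NormedAddCommGroup E]

/-- A version of `IsAlmostFlow` on `[a, T]` without regularity of the additivity error. -/
structure IsWeakFlow (a T α C : ℝ) (G : ℝ → ℝ → E → E) : Prop where
  nonneg : 0 ≤ C
  bound : ∀ s t, a ≤ s → s ≤ t → t ≤ T → t - s ≤ 1 → ∀ x, ‖G s t x‖ ≤ C * (t - s) ^ α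
  lip : ∀ s t, a ≤ s → s ≤ t → t ≤ T → t - s ≤ 1 → ∀ x y,
    ‖G s t x - G s t y‖ ≤ C * (t - s) ^ α * ‖x - y‖
  defect : ∀ s u t, a ≤ s → s ≤ u → u ≤ t → t ≤ T → t - s ≤ 1 → ∀ x,
    ‖G s t x - G s u x - G u t (x + G s u x)‖ ≤ C * (t - s) ^ (2 / 3 + α)

/-- The path `x` has the increments of the flow `G`, up to an error of order larger than one. -/
def IsFlowLine (a T : ℝ) (G : ℝ → ℝ → E → E) (x : ℝ → E) : Prop :=
  ∃ θ L : ℝ, 1 < θ ∧ 0 ≤ L ∧ ∀ s t, a ≤ s → s ≤ t → t ≤ T → t - s ≤ 1 →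
    ‖x t - x s - G s t (x s)‖ ≤ L * (t - s) ^ θ

variable {a T α C : ℝ} {G : ℝ → ℝ → E → E} {x : ℝ → E}

theorem IsFlowLine.mono {a' : ℝ} (hx : IsFlowLine a T G x) (h : a ≤ a') :
    IsFlowLine a' T G x := by
  obtain ⟨θ, L, hθ, hL, hx⟩ := hx
  exact ⟨θ, L, hθ, hL, fun s t hs => hx s t (h.trans hs)⟩

/-- `x u` differs from `x s + G s u (x s)` by the error on `[s, u]`. Passing this through the
Lipschitz map `G u t` and adding the defect of `G` gives the form required by the sewing bound. -/
theorem IsWeakFlow.norm_sub_le (hG : IsWeakFlow a T α C G) (x : ℝ → E) {s u t : ℝ} (hs : a ≤ s)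
    (hsu : s ≤ u) (hut : u ≤ t) (ht : t ≤ T) (h : t - s ≤ 1) (hα : 0 ≤ α) :
    ‖x t - x s - G s t (x s)‖ ≤ ‖x u - x s - G s u (x s)‖ + ‖x t - x u - G u t (x u)‖
      + (C * (t - s) ^ (2 / 3 + α) + C * (t - s) ^ α * ‖x u - x s - G s u (x s)‖) := by
  have hC := hG.nonneg
  have e : x t - x s - G s t (x s) = (x u - x s - G s u (x s)) + (x t - x u - G u t (x u))
      + (-(G s t (x s) - G s u (x s) - G u t (x s + G s u (x s)))
        + (G u t (x u) - G u t (x s + G s u (x s)))) := by abel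
  have h1 := hG.defect s u t hs hsu hut ht h (x s)
  have h2 := hG.lip u t (by linarith) hut ht (by linarith) (x u) (x s + G s u (x s))
  have h3 : (t - u) ^ α ≤ (t - s) ^ α := by
    apply Real.rpow_le_rpow <;> linarith
  rw [e]
  refine (norm_add_le _ _).trans (add_le_add (norm_add_le _ _) ((norm_add_le _ _).trans
    (add_le_add (by rwa [norm_neg]) (h2.trans ?_))))
  rw [← sub_sub]
  gcongr

theorem IsWeakFlow.norm_increment_le (hG : IsWeakFlow a T α C G) {s t : ℝ} (hs : a ≤ s)
    (hst : s ≤ t) (ht : t ≤ T) (h : t - s ≤ 1) :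
    ‖x t - x s‖ ≤ C * (t - s) ^ α + ‖x t - x s - G s t (x s)‖ := by
  have h1 := hG.bound s t hs hst ht h (x s)
  have h2 := norm_add_le (G s t (x s)) (x t - x s - G s t (x s))
  rw [add_sub_cancel] at h2
  linarith

theorem exists_small {α C c : ℝ} (hα : 0 < α) (hc : 0 < c) :
    ∃ h, 0 < h ∧ h ≤ 1 ∧ C * h ^ α ≤ c := by
  have h1 : Tendsto (fun h : ℝ => C * h ^ α) (𝓝[>] 0) (𝓝 (C * 0 ^ α)) :=
    ((Real.continuous_rpow_const hα.le).tendsto 0).mono_left nhdsWithin_le_nhds |>.const_mul C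
  rw [Real.zero_rpow hα.ne', mul_zero] at h1
  obtain ⟨h, h2, h3⟩ := ((h1.eventually (ge_mem_nhds hc)).and
    (Ioc_mem_nhdsGT (zero_lt_one' ℝ))).exists
  exact ⟨h, h3.1, h3.2, h2⟩

/-- The a priori bound: flow lines satisfy a uniform bound, whose constants depend only on those of
the flow. -/
theorem exists_forall_isFlowLine_bound (hα : 1 / 3 < α) (hC : 0 ≤ C) :
    ∃ h L, 0 < h ∧ h ≤ 1 ∧ 0 ≤ L ∧ ∀ (a T : ℝ) (G : ℝ → ℝ → E → E) (x : ℝ → E),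
      IsWeakFlow a T α C G → IsFlowLine a T G x → ∀ s t, a ≤ s → s ≤ t → t ≤ T → t - s ≤ h →
        ‖x t - x s - G s t (x s)‖ ≤ L * (t - s) ^ (2 / 3 + α) := by
  have hq : 0 < 1 - (2 : ℝ) ^ (1 - (2 / 3 + α)) := by
    linarith [two_rpow_one_sub_lt_one (θ := 2 / 3 + α) (by linarith)]
  obtain ⟨h, h0, h1, hh⟩ := exists_small (α := α) (C := C) (by linarith) (half_pos hq)
  refine ⟨h, 2 * C / (1 - 2 ^ (1 - (2 / 3 + α))), h0, h1, by positivity,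
    fun a T G x hG hx s t hs hst ht hτ => ?_⟩
  obtain ⟨θ, L, hθ, hL, hx⟩ := hx
  exact norm_le_of_midpoint_of_small (J := fun s t => x t - x s - G s t (x s)) (by linarith) hθ
    (by linarith) (by linarith) h1 h0.le hC hC hL hh
    (fun s t hs hst ht hτ => hx s t hs hst ht (hτ.trans h1))
    (fun s u t hs hsu hut ht hτ => hG.norm_sub_le x hs hsu hut ht (hτ.trans h1) (by linarith))
    hs hst ht hτ

theorem IsFlowLine.exists_norm_sub_le (hG : IsWeakFlow a T α C G) (hx : IsFlowLine a T G x)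
    (hα : α ≤ 1) (hα₀ : 0 ≤ α) : ∃ C', 0 ≤ C' ∧ ∀ s t, a ≤ s → s ≤ t → t ≤ T → t - s ≤ 1 →
      ‖x t - x s‖ ≤ C' * (t - s) ^ α := by
  obtain ⟨θ, L, hθ, hL, hx⟩ := hx
  refine ⟨C + L, add_nonneg hG.nonneg hL, fun s t hs hst ht h => ?_⟩
  refine (hG.norm_increment_le hs hst ht h).trans ?_
  rw [add_mul]
  have := hx s t hs hst ht h
  have h2 : (t - s) ^ θ ≤ (t - s) ^ α :=
    Real.rpow_le_rpow_of_exponent_ge' (sub_nonneg.2 hst) h hα₀ (by linarith)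
  have h3 : L * (t - s) ^ θ ≤ L * (t - s) ^ α := by gcongr
  linarith

theorem continuousOn_of_norm_sub_le {C' : ℝ} (hα : 0 < α)
    (hx : ∀ s t, a ≤ s → s ≤ t → t ≤ T → t - s ≤ 1 → ‖x t - x s‖ ≤ C' * (t - s) ^ α) :
    ContinuousOn x (Icc a T) := by
  have key : ∀ s ∈ Icc a T, ∀ t ∈ Icc a T, |t - s| ≤ 1 → ‖x t - x s‖ ≤ C' * |t - s| ^ α := by
    intro s hs t ht h
    rcases le_total s t with hst | hst
    · rw [abs_of_nonneg (sub_nonneg.2 hst)] at h ⊢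
      exact hx s t hs.1 hst ht.2 h
    · rw [abs_sub_comm, abs_of_nonneg (sub_nonneg.2 hst)] at h ⊢
      rw [norm_sub_rev]
      exact hx t s ht.1 hst hs.2 h
  intro s hs
  rw [ContinuousWithinAt, tendsto_iff_norm_sub_tendsto_zero]
  have h1 : Tendsto (fun t => C' * |t - s| ^ α) (𝓝[Icc a T] s) (𝓝 0) := by
    have : Continuous fun t : ℝ => C' * |t - s| ^ α :=
      continuous_const.mul (((continuous_id.sub continuous_const).abs).rpow_const
        fun _ => Or.inr hα.le)
    have h2 := this.tendsto s
    simp only [sub_self, abs_zero, Real.zero_rpow hα.ne', mul_zero] at h2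
    exact h2.mono_left nhdsWithin_le_nhds
  refine squeeze_zero' (Eventually.of_forall fun _ => norm_nonneg _) ?_ h1
  have h3 : ∀ᶠ t in 𝓝[Icc a T] s, |t - s| ≤ 1 := by
    have : ∀ᶠ t in 𝓝 s, dist t s ≤ 1 := Metric.closedBall_mem_nhds s one_pos
    exact (this.filter_mono nhdsWithin_le_nhds).mono fun t ht => by rwa [← Real.dist_eq]
  filter_upwards [h3, self_mem_nhdsWithin] with t ht ht'
  exact key s hs t ht' ht

/-- A bound on short intervals suffices for a flow line. -/
theorem IsWeakFlow.isFlowLine_of_local (hG : IsWeakFlow a T α C G) (hα : 1 / 3 < α) {h L : ℝ}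
    (hh : 0 < h) (hL : 0 ≤ L) (hx : ∀ s t, a ≤ s → s ≤ t → t ≤ T → t - s ≤ h → t - s ≤ 1 →
      ‖x t - x s - G s t (x s)‖ ≤ L * (t - s) ^ (2 / 3 + α)) : IsFlowLine a T G x := by
  have hC := hG.nonneg
  -- Each step doubles the admissible interval length by cutting at the midpoint; finitely many
  -- steps reach length one.
  have key : ∀ n : ℕ, ∃ L, 0 ≤ L ∧ ∀ s t, a ≤ s → s ≤ t → t ≤ T → t - s ≤ 2 ^ n * h → t - s ≤ 1 →
      ‖x t - x s - G s t (x s)‖ ≤ L * (t - s) ^ (2 / 3 + α) := by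
    intro n
    induction n with
    | zero => exact ⟨L, hL, by simpa using hx⟩
    | succ n ih =>
      obtain ⟨L, hL, ih⟩ := ih
      refine ⟨L + L + (C + C * L), by positivity, fun s t hs hst ht hτ h1 => ?_⟩
      rw [pow_succ] at hτ
      have hτ0 : 0 ≤ t - s := sub_nonneg.2 hst
      have e1 := ih s ((s + t) / 2) hs (by linarith) (by linarith) (by linarith) (by linarith)
      have e2 := ih ((s + t) / 2) t (by linarith) (by linarith) ht (by linarith) (by linarith)
      have e3 := hG.norm_sub_le x (u := (s + t) / 2) hs (by linarith) (by linarith) ht h1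
        (by linarith)
      have f1 : ((s + t) / 2 - s) ^ (2 / 3 + α) ≤ (t - s) ^ (2 / 3 + α) := by
        apply Real.rpow_le_rpow <;> linarith
      have f2 : (t - (s + t) / 2) ^ (2 / 3 + α) ≤ (t - s) ^ (2 / 3 + α) := by
        apply Real.rpow_le_rpow <;> linarith
      have e1' := e1.trans (mul_le_mul_of_nonneg_left f1 hL)
      have e2' := e2.trans (mul_le_mul_of_nonneg_left f2 hL)
      have f3 : (t - s) ^ α ≤ 1 := Real.rpow_le_one hτ0 h1 (by linarith)
      have e4 : C * (t - s) ^ α * ‖x ((s + t) / 2) - x s - G s ((s + t) / 2) (x s)‖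
          ≤ C * 1 * (L * (t - s) ^ (2 / 3 + α)) := by gcongr
      linarith
  obtain ⟨n, hn⟩ := pow_unbounded_of_one_lt (1 / h) (one_lt_two (α := ℝ))
  obtain ⟨L, hL, hx⟩ := key n
  refine ⟨2 / 3 + α, L, by linarith, hL, fun s t hs hst ht h1 => hx s t hs hst ht ?_ h1⟩
  rw [div_lt_iff₀ hh] at hn
  linarith

end WeakFlow

/-! ### Existence of flow lines by Euler schemes -/

section Euler

variable {E : Type*} [NormedAddCommGroup E] {a T α C : ℝ} {G : ℝ → ℝ → E → E}

/-- The Euler scheme along a finite set of times. -/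
theorem exists_euler_scheme (G : ℝ → ℝ → E → E) (a : ℝ) (y : E) (P : Finset ℝ)
    (hP : ∀ p ∈ P, a < p) :
    ∃ x : ℝ → E, x a = y ∧ ∀ p ∈ insert a P, ∀ q ∈ insert a P, p < q →
      (∀ r ∈ insert a P, r ≤ p ∨ q ≤ r) → x q = x p + G p q (x p) := by
  induction P using Finset.induction_on_max with
  | empty => exact ⟨fun _ => y, rfl, by simp⟩
  | insert q₀ P hq₀ ih =>
    obtain ⟨x, hxa, hx⟩ := ih fun p hp => hP p (Finset.mem_insert_of_mem hp)
    have haq : a < q₀ := hP q₀ (Finset.mem_insert_self _ _)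
    have hlt : ∀ p ∈ insert a P, p < q₀ := by
      intro p hp
      rcases Finset.mem_insert.1 hp with rfl | hp
      · exact haq
      · exact hq₀ p hp
    have hne : (insert a P).Nonempty := Finset.insert_nonempty _ _
    set p₀ := (insert a P).max' hne with hp₀
    have hp₀_mem : p₀ ∈ insert a P := Finset.max'_mem _ _
    have hcomm : insert a (insert q₀ P) = insert q₀ (insert a P) := Finset.insert_comm _ _ _
    refine ⟨Function.update x q₀ (x p₀ + G p₀ q₀ (x p₀)), ?_, ?_⟩
    · rw [Function.update_of_ne haq.ne, hxa]
    · rw [hcomm]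
      intro p hp q hq hpq hr
      rcases Finset.mem_insert.1 hq with rfl | hq'
      · have hp' : p ∈ insert a P := (Finset.mem_insert.1 hp).resolve_left hpq.ne
        have hpp : p = p₀ := by
          refine le_antisymm (Finset.le_max' _ _ hp') ?_
          rcases hr p₀ (Finset.mem_insert_of_mem hp₀_mem) with h | h
          · exact h
          · exact absurd (hlt p₀ hp₀_mem) h.not_gt
        rw [Function.update_self, hpp, Function.update_of_ne (hlt p₀ hp₀_mem).ne]
      · have hqq := hlt q hq'
        have hp' : p ∈ insert a P :=
          (Finset.mem_insert.1 hp).resolve_left (hpq.trans hqq).ne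
        rw [Function.update_of_ne hqq.ne, Function.update_of_ne (hlt p hp').ne]
        exact hx p hp' q hq' hpq fun r hr' => hr r (Finset.mem_insert_of_mem hr')

/-- The bound of Davie: the Euler scheme follows the flow, uniformly in the partition. -/
theorem IsWeakFlow.euler_bound (hG : IsWeakFlow a T α C G) (hα : 1 / 3 < α) {h : ℝ}
    (h1 : h ≤ 1) (hh : C * h ^ α ≤ (1 - (2 : ℝ) ^ (1 - (2 / 3 + α))) / 2) {P : Finset ℝ}
    (hP : ∀ p ∈ P, a ≤ p ∧ p ≤ T) {x : ℝ → E}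
    (hx : ∀ p ∈ P, ∀ q ∈ P, p < q → (∀ r ∈ P, r ≤ p ∨ q ≤ r) → x q = x p + G p q (x p)) :
    ∀ s ∈ P, ∀ t ∈ P, s ≤ t → t - s ≤ h → ‖x t - x s - G s t (x s)‖
      ≤ 4 * C / (1 - 2 ^ (1 - (2 / 3 + α))) * (t - s) ^ (2 / 3 + α) := by
  set θ := 2 / 3 + α with hθ
  set q := (2 : ℝ) ^ (1 - θ) with hq
  have hθ1 : 1 < θ := by linarith
  have hq1 : 0 < 1 - q := by linarith [two_rpow_one_sub_lt_one hθ1]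
  have hC := hG.nonneg
  set L := 4 * C / (1 - q) with hL
  have hL0 : 0 ≤ L := by positivity
  -- Induction on the number of partition points in `(s, t]`. The midpoint need not belong to `P`,
  -- so it is replaced by its neighbours: `l`, the last point not after it, and `r`, the next point
  -- of `P`.
  have key : ∀ n : ℕ, ∀ s ∈ P, ∀ t ∈ P, s ≤ t → t - s ≤ h →
      (P.filter fun r => s < r ∧ r ≤ t).card ≤ n →
      ‖x t - x s - G s t (x s)‖ ≤ L * (t - s) ^ θ := by
    intro n
    induction n with
    | zero =>
      intro s hs t ht hst hτ hn
      rcases hst.eq_or_lt with rfl | hst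
      · have := hG.bound s s (hP s hs).1 le_rfl (hP s hs).2 (by simp) (x s)
        rw [sub_self, Real.zero_rpow (by linarith), mul_zero] at this
        simpa [Real.zero_rpow (show θ ≠ 0 by linarith)] using this
      · rw [Nat.le_zero, Finset.card_eq_zero] at hn
        have : t ∈ P.filter fun r => s < r ∧ r ≤ t := Finset.mem_filter.2 ⟨ht, hst, le_rfl⟩
        simp [hn] at this
    | succ n ih =>
      intro s hs t ht hst hτ hn
      rcases hst.eq_or_lt with rfl | hst'
      · exact ih s hs s hs le_rfl hτ (by
          rw [Finset.filter_false_of_mem fun r _ h => h.1.not_ge h.2]; exact Nat.zero_le _)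
      have hτ0 : 0 ≤ t - s := sub_nonneg.2 hst
      set A := P.filter fun r => s ≤ r ∧ r ≤ (s + t) / 2
      have hA : A.Nonempty := ⟨s, Finset.mem_filter.2 ⟨hs, le_rfl, by linarith⟩⟩
      obtain ⟨hlP, hsl, hlm⟩ : A.max' hA ∈ P ∧ s ≤ A.max' hA ∧ A.max' hA ≤ (s + t) / 2 :=
        Finset.mem_filter.1 (A.max'_mem hA)
      set l := A.max' hA with hl
      set B := P.filter fun r => l < r
      have hB : B.Nonempty := ⟨t, Finset.mem_filter.2 ⟨ht, by linarith⟩⟩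
      obtain ⟨hrP, hlr⟩ : B.min' hB ∈ P ∧ l < B.min' hB :=
        Finset.mem_filter.1 (B.min'_mem hB)
      set r := B.min' hB with hr
      have hrt : r ≤ t := B.min'_le t (Finset.mem_filter.2 ⟨ht, by linarith⟩)
      have hrm : (s + t) / 2 < r := by
        by_contra hcon
        push Not at hcon
        have : r ≤ l := A.le_max' r (Finset.mem_filter.2 ⟨hrP, by linarith, hcon⟩)
        linarith
      -- `l` and `r` are consecutive, so the scheme makes no error between them; both remaining
      -- pieces have length at most `(t - s) / 2`.
      have hcons : x r = x l + G l r (x l) := by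
        refine hx l hlP r hrP hlr fun p hp => ?_
        rcases le_or_gt p l with h2 | h2
        · exact Or.inl h2
        · exact Or.inr (B.min'_le p (Finset.mem_filter.2 ⟨hp, h2⟩))
      have c1 : (P.filter fun p => s < p ∧ p ≤ l).card ≤ n := by
        refine Nat.le_of_lt_succ (lt_of_lt_of_le (Finset.card_lt_card ?_) hn)
        rw [Finset.ssubset_iff_of_subset]
        · exact ⟨t, Finset.mem_filter.2 ⟨ht, hst', le_rfl⟩, by simp; intros; linarith⟩
        · intro p hp
          simp only [Finset.mem_filter] at hp ⊢
          exact ⟨hp.1, hp.2.1, by linarith [hp.2.2]⟩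
      have c2 : (P.filter fun p => r < p ∧ p ≤ t).card ≤ n := by
        refine Nat.le_of_lt_succ (lt_of_lt_of_le (Finset.card_lt_card ?_) hn)
        rw [Finset.ssubset_iff_of_subset]
        · exact ⟨r, Finset.mem_filter.2 ⟨hrP, by linarith, hrt⟩, by simp⟩
        · intro p hp
          simp only [Finset.mem_filter] at hp ⊢
          exact ⟨hp.1, by linarith [hp.2.1], hp.2.2⟩
      have e1 := ih s hs l hlP hsl (by linarith) c1
      have e2 := ih r hrP t ht hrt (by linarith) c2
      have e3 := hG.norm_sub_le x (hP s hs).1 hsl (by linarith : l ≤ t) (hP t ht).2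
        (by linarith) (by linarith)
      have e4 := hG.norm_sub_le x (hP l hlP).1 hlr.le hrt (hP t ht).2 (by linarith) (by linarith)
      have e5 : x r - x l - G l r (x l) = 0 := by rw [hcons]; abel
      rw [e5, norm_zero, mul_zero, add_zero, zero_add] at e4
      have f1 := two_mul_half_rpow (θ := θ) hτ0
      have f2 : (l - s) ^ θ ≤ ((t - s) / 2) ^ θ := by apply Real.rpow_le_rpow <;> linarith
      have f3 : (t - r) ^ θ ≤ ((t - s) / 2) ^ θ := by apply Real.rpow_le_rpow <;> linarith
      have f4 : (t - l) ^ θ ≤ (t - s) ^ θ := by apply Real.rpow_le_rpow <;> linarith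
      have f5 : (t - s) ^ α ≤ h ^ α := by apply Real.rpow_le_rpow <;> linarith
      have f0 : 0 ≤ (t - s) ^ θ := Real.rpow_nonneg hτ0 _
      have f6 : (l - s) ^ θ ≤ (t - s) ^ θ := by apply Real.rpow_le_rpow <;> linarith
      have g1 : ‖x l - x s - G s l (x s)‖ ≤ L * ((t - s) / 2) ^ θ := e1.trans (by gcongr)
      have g2 : ‖x t - x r - G r t (x r)‖ ≤ L * ((t - s) / 2) ^ θ := e2.trans (by gcongr)
      have g3 : C * (t - s) ^ α * ‖x l - x s - G s l (x s)‖
          ≤ (1 - q) / 2 * (L * (t - s) ^ θ) := by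
        have : C * (t - s) ^ α ≤ (1 - q) / 2 := le_trans (by gcongr) hh
        have h2 := e1.trans (mul_le_mul_of_nonneg_left f6 hL0)
        gcongr
      have g4 : C * (t - l) ^ θ ≤ C * (t - s) ^ θ := by gcongr
      -- The constant closes the induction: `q L` from the two halves, `2 C` from the two defects
      -- and `2 C` from the small self-referential term add up to `q L + 4 C = L`.
      have g5 : (1 - q) / 2 * (L * (t - s) ^ θ) = 2 * C * (t - s) ^ θ := by
        rw [hL]; field_simp; ring
      have g6 : L * ((t - s) / 2) ^ θ + L * ((t - s) / 2) ^ θ = L * (q * (t - s) ^ θ) := by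
        rw [hq, ← f1]; ring
      nlinarith [g1, g2, g3, g4, g5, g6]
  intro s hs t ht hst hτ
  exact key _ s hs t ht hst hτ le_rfl

/-- Existence of flow lines. -/
theorem IsWeakFlow.exists_isFlowLine [ProperSpace E] (hG : IsWeakFlow a T α C G)
    (hα : 1 / 3 < α) (y : E) : ∃ x : ℝ → E, x a = y ∧ IsFlowLine a T G x := by
  classical
  have hC := hG.nonneg
  have hq : 0 < 1 - (2 : ℝ) ^ (1 - (2 / 3 + α)) := by
    linarith [two_rpow_one_sub_lt_one (θ := 2 / 3 + α) (by linarith)]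
  obtain ⟨h, h0, h1, hh⟩ := exists_small (α := α) (C := C) (by linarith) (half_pos hq)
  set L := 4 * C / (1 - 2 ^ (1 - (2 / 3 + α)))
  have hL : 0 ≤ L := by positivity
  -- Partitions are indexed by all finite sets of times, directed by inclusion, so that every time
  -- of `[a, T]` is eventually a partition point.
  let P : Finset ℝ → Finset ℝ := fun S => S.filter fun p => a < p ∧ p ≤ T
  choose X hXa hX using fun S => exists_euler_scheme G a y (P S) fun p hp =>
    (Finset.mem_filter.1 hp).2.1
  have hmem : ∀ t ∈ Icc a T, ∀ᶠ S : Finset ℝ in atTop, t ∈ insert a (P S) := by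
    intro t ht
    filter_upwards [eventually_ge_atTop {t}] with S hS
    rcases ht.1.eq_or_lt with rfl | hat
    · exact Finset.mem_insert_self _ _
    · exact Finset.mem_insert_of_mem
        (Finset.mem_filter.2 ⟨hS (Finset.mem_singleton_self t), hat, ht.2⟩)
  have hbound : ∀ s ∈ Icc a T, ∀ t ∈ Icc a T, s ≤ t → t - s ≤ h → ∀ᶠ S : Finset ℝ in atTop,
      ‖X S t - X S s - G s t (X S s)‖ ≤ L * (t - s) ^ (2 / 3 + α) := by
    intro s hs t ht hst hτ
    filter_upwards [hmem s hs, hmem t ht] with S hsS htS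
    refine hG.euler_bound hα h1 hh (fun p hp => ?_) (hX S) s hsS t htS hst hτ
    rcases Finset.mem_insert.1 hp with rfl | hp
    · exact ⟨le_rfl, hs.1.trans hs.2⟩
    · exact ⟨(Finset.mem_filter.1 hp).2.1.le, (Finset.mem_filter.1 hp).2.2⟩
  have hbdd : ∀ n : ℕ, ∀ t ∈ Icc a T, t ≤ a + n * h → ∃ M, ∀ᶠ S : Finset ℝ in atTop,
      ‖X S t - y‖ ≤ M := by
    intro n
    induction n with
    | zero =>
      intro t ht hta
      have : t = a := le_antisymm (by simpa using hta) ht.1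
      exact ⟨0, Eventually.of_forall fun S => by rw [this, hXa]; simp⟩
    | succ n ih =>
      intro t ht hta
      push_cast at hta
      have hc : max a (t - h) ∈ Icc a T :=
        ⟨le_max_left _ _, max_le (ht.1.trans ht.2) (by linarith [ht.2])⟩
      obtain ⟨M, hM⟩ := ih (max a (t - h)) hc
        (max_le (by nlinarith [n.cast_nonneg (α := ℝ)]) (by linarith))
      have hct : max a (t - h) ≤ t := max_le ht.1 (by linarith)
      have hτ : t - max a (t - h) ≤ h := by linarith [le_max_right a (t - h)]
      refine ⟨M + (C * (t - max a (t - h)) ^ α + L * (t - max a (t - h)) ^ (2 / 3 + α)), ?_⟩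
      filter_upwards [hM, hbound _ hc t ht hct hτ] with S hS hS'
      have e1 := hG.norm_increment_le (x := X S) hc.1 hct ht.2 (hτ.trans h1)
      have e2 := norm_add_le (X S (max a (t - h)) - y) (X S t - X S (max a (t - h)))
      rw [add_comm (X S (max a (t - h)) - y), sub_add_sub_cancel] at e2
      linarith
  -- At each time the schemes are eventually bounded, so an ultrafilter finer than `atTop` gives
  -- pointwise limits at all times at once. No equicontinuity is needed, since the estimate passes
  -- to the limit for each pair of times.
  let U : Ultrafilter (Finset ℝ) := Ultrafilter.of atTop
  have hU : (U : Filter (Finset ℝ)) ≤ atTop := Ultrafilter.of_le _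
  have hlim : ∀ t ∈ Icc a T, ∃ l, Tendsto (fun S => X S t) U (𝓝 l) := by
    intro t ht
    obtain ⟨n, hn⟩ := exists_nat_ge ((t - a) / h)
    rw [div_le_iff₀ h0] at hn
    obtain ⟨M, hM⟩ := hbdd n t ht (by linarith)
    obtain ⟨l, -, hl⟩ := (isCompact_closedBall y M).ultrafilter_le_nhds
      (U.map fun S => X S t) (by
        rw [le_principal_iff]
        exact (hM.filter_mono hU).mono fun S hS => mem_closedBall_iff_norm.2 hS)
    exact ⟨l, hl⟩
  choose! x hx using hlim
  rcases lt_or_ge T a with hTa | haT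
  · exact ⟨fun _ => y, rfl, 2, 0, by norm_num, le_rfl, fun s t hs hst ht => by linarith⟩
  refine ⟨x, ?_, hG.isFlowLine_of_local hα h0 hL fun s t hs hst ht hτ hτ1 => ?_⟩
  · refine tendsto_nhds_unique (hx a ⟨le_rfl, haT⟩) ?_
    simp only [hXa]
    exact tendsto_const_nhds
  · have hs' : s ∈ Icc a T := ⟨hs, hst.trans ht⟩
    have ht' : t ∈ Icc a T := ⟨hs.trans hst, ht⟩
    have hGc : Continuous (G s t) := by
      refine continuous_iff_continuousAt.2 fun z => ?_
      rw [ContinuousAt, tendsto_iff_norm_sub_tendsto_zero]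
      refine squeeze_zero (fun _ => norm_nonneg _) (fun w => hG.lip s t hs hst ht hτ1 w z) ?_
      have : Continuous fun w : E => C * (t - s) ^ α * ‖w - z‖ := by fun_prop
      simpa using this.tendsto z
    have h2 := ((hx t ht').sub (hx s hs')).sub ((hGc.tendsto _).comp (hx s hs'))
    exact le_of_tendsto h2.norm ((hbound s hs' t ht' hst hτ).filter_mono hU)

end Euler

/-! ### Flows with drift, and stability of their flow lines -/

section Drift

variable {E : Type*} [NormedAddCommGroup E] [NormedSpace ℝ E] {a T α C : ℝ}
  {A : ℝ → ℝ → E → E} {B : ℝ → E → E} {x x' : ℝ → E}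

/-- `B` is a bounded drift on `[a, T]`, Lipschitz in space, which is continuous along continuous
paths. -/
structure IsBoundedDrift (a T C : ℝ) (B : ℝ → E → E) : Prop where
  bound : ∀ t ∈ Icc a T, ∀ x, ‖B t x‖ ≤ C
  lip : ∀ t ∈ Icc a T, ∀ x y, ‖B t x - B t y‖ ≤ C * ‖x - y‖
  continuousOn : ∀ x : ℝ → E, ContinuousOn x (Icc a T) →
    ContinuousOn (fun t => B t (x t)) (Icc a T)

/-- A path on `[c, T]` is extended to `[a, T]` by the constant `x c`, so that the continuity
property on the longer interval applies. -/
theorem IsBoundedDrift.mono {c : ℝ} (hB : IsBoundedDrift a T C B) (hc : a ≤ c) :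
    IsBoundedDrift c T C B := by
  refine ⟨fun t ht => hB.bound t ⟨hc.trans ht.1, ht.2⟩,
    fun t ht => hB.lip t ⟨hc.trans ht.1, ht.2⟩, fun x hx => ?_⟩
  rcases lt_or_ge T c with hT | hT
  · simp [Icc_eq_empty_of_lt hT]
  have h1 : ContinuousOn (fun t => x (max c t)) (Icc a T) :=
    hx.comp (by fun_prop) fun t ht => ⟨le_max_left _ _, max_le hT ht.2⟩
  refine ((hB.continuousOn _ h1).mono (Icc_subset_Icc_left hc)).congr fun t ht => ?_
  simp only [max_eq_right ht.1]

theorem IsBoundedDrift.intervalIntegrable (hB : IsBoundedDrift a T C B)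
    (hx : ContinuousOn x (Icc a T)) {s t : ℝ} (hs : a ≤ s) (hst : s ≤ t) (ht : t ≤ T) :
    IntervalIntegrable (fun r => B r (x r)) volume s t :=
  ((hB.continuousOn x hx).mono (by
    rw [uIcc_of_le hst]; exact Icc_subset_Icc hs ht)).intervalIntegrable

theorem IsBoundedDrift.norm_integral_le (hB : IsBoundedDrift a T C B) (x : ℝ → E) {s t : ℝ}
    (hs : a ≤ s) (hst : s ≤ t) (ht : t ≤ T) : ‖∫ r in s..t, B r (x r)‖ ≤ C * (t - s) := by
  have := intervalIntegral.norm_integral_le_of_norm_le_const (a := s) (b := t)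
    (f := fun r => B r (x r)) (C := C) fun r hr => by
      rw [uIoc_of_le hst] at hr
      exact hB.bound r ⟨by linarith [hr.1], by linarith [hr.2]⟩ _
  rwa [abs_of_nonneg (sub_nonneg.2 hst)] at this

theorem IsBoundedDrift.norm_integral_sub_le (hB : IsBoundedDrift a T C B) (hC : 0 ≤ C)
    (hx : ContinuousOn x (Icc a T)) (hx' : ContinuousOn x' (Icc a T)) {s t S : ℝ}
    (hs : a ≤ s) (hst : s ≤ t) (ht : t ≤ T) (hS : ∀ r ∈ Icc s t, ‖x r - x' r‖ ≤ S) :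
    ‖(∫ r in s..t, B r (x r)) - ∫ r in s..t, B r (x' r)‖ ≤ C * S * (t - s) := by
  rw [← intervalIntegral.integral_sub (hB.intervalIntegrable hx hs hst ht)
    (hB.intervalIntegrable hx' hs hst ht)]
  have := intervalIntegral.norm_integral_le_of_norm_le_const (a := s) (b := t)
    (f := fun r => B r (x r) - B r (x' r)) (C := C * S) fun r hr => by
      rw [uIoc_of_le hst] at hr
      refine (hB.lip r ⟨by linarith [hr.1], by linarith [hr.2]⟩ _ _).trans ?_
      gcongr
      exact hS r ⟨hr.1.le, hr.2⟩
  rwa [abs_of_nonneg (sub_nonneg.2 hst)] at this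

/-- The one-step map with drift. -/
noncomputable def driftGerm (A : ℝ → ℝ → E → E) (B : ℝ → E → E) (s t : ℝ) (x : E) : E :=
  A s t x + ∫ r in s..t, B r x

theorem le_rpow_of_le_one {τ α : ℝ} (hτ : 0 ≤ τ) (h1 : τ ≤ 1) (hα₀ : 0 ≤ α) (hα : α ≤ 1) :
    τ ≤ τ ^ α := by
  simpa using Real.rpow_le_rpow_of_exponent_ge' hτ h1 hα₀ hα

theorem rpow_mul_le_rpow {τ α β γ : ℝ} (hτ : 0 ≤ τ) (h1 : τ ≤ 1) (hα : 0 ≤ α) (hβ : 0 ≤ β)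
    (hγ : 0 ≤ γ) (h : γ ≤ α + β) : τ ^ α * τ ^ β ≤ τ ^ γ := by
  rw [← Real.rpow_add_of_nonneg hτ hα hβ]
  exact Real.rpow_le_rpow_of_exponent_ge' hτ h1 hγ h

/-- The drift is frozen at the starting point, which costs order `1 + α`. As it is merely Lipschitz
in space, its contribution to the defect is bounded only in sup norm; for stability, the drift is
instead integrated along the path and only `A` is expanded. -/
theorem IsAlmostFlow.isWeakFlow (hA : IsAlmostFlow T α C A) (hB : IsBoundedDrift a T C B)
    (ha : 0 ≤ a) (hα : 1 / 3 < α) (hα' : α ≤ 1) :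
    IsWeakFlow a T α (2 * C + 3 * C ^ 2) (driftGerm A B) := by
  have hC := hA.nonneg
  have bd : ∀ s t, a ≤ s → s ≤ t → t ≤ T → t - s ≤ 1 → ∀ x,
      ‖driftGerm A B s t x‖ ≤ 2 * C * (t - s) ^ α := by
    intro s t hs hst ht h1 x
    have e1 := (hA.regular s t (ha.trans hs) hst ht h1).bound x
    have e2 := hB.norm_integral_le (fun _ => x) hs hst ht
    have e3 := le_rpow_of_le_one (sub_nonneg.2 hst) h1 (by linarith) hα'
    have e4 := mul_le_mul_of_nonneg_left e3 hC
    refine (norm_add_le _ _).trans ?_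
    linarith
  refine ⟨by positivity, fun s t hs hst ht h1 x => ?_, fun s t hs hst ht h1 x y => ?_,
    fun s u t hs hsu hut ht h1 x => ?_⟩
  · have h0 : 0 ≤ (t - s) ^ α := Real.rpow_nonneg (sub_nonneg.2 hst) _
    refine (bd s t hs hst ht h1 x).trans ?_
    gcongr
    nlinarith
  · have h0 : 0 ≤ (t - s) ^ α := Real.rpow_nonneg (sub_nonneg.2 hst) _
    have e1 := (hA.regular s t (ha.trans hs) hst ht h1).lip x y
    have e2 := hB.norm_integral_sub_le hC (x := fun _ => x) (x' := fun _ => y) continuousOn_const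
      continuousOn_const hs hst ht (S := ‖x - y‖) fun _ _ => le_rfl
    have e3 := le_rpow_of_le_one (sub_nonneg.2 hst) h1 (by linarith) hα'
    have e : driftGerm A B s t x - driftGerm A B s t y = (A s t x - A s t y)
        + ((∫ r in s..t, B r x) - ∫ r in s..t, B r y) := by simp only [driftGerm]; abel
    rw [e]
    refine (norm_add_le _ _).trans ((add_le_add e1 e2).trans ?_)
    have e4 : C * ‖x - y‖ * (t - s) ≤ C * ‖x - y‖ * (t - s) ^ α := by gcongr
    have e5 : 0 ≤ 3 * C ^ 2 * (t - s) ^ α * ‖x - y‖ := by positivity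
    linarith
  · have hτ : 0 ≤ t - s := by linarith
    set v := A s u x
    set D := ∫ r in s..u, B r x
    have e : driftGerm A B s t x - driftGerm A B s u x
          - driftGerm A B u t (x + driftGerm A B s u x)
        = (A s t x - A s u x - A u t (x + A s u x))
          + (A u t (x + v) - A u t (x + (v + D)))
          + ((∫ r in u..t, B r x) - ∫ r in u..t, B r (x + (v + D))) := by
      have h2 := intervalIntegral.integral_add_adjacent_intervals
        (hB.intervalIntegrable (x := fun _ => x) continuousOn_const hs hsu (hut.trans ht))
        (hB.intervalIntegrable (x := fun _ => x) continuousOn_const (hs.trans hsu) hut ht)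
      simp only [driftGerm, v, D, ← h2]
      abel
    have e1 := (hA.almost s u t (ha.trans hs) hsu hut ht h1).bound x
    have e2 := (hA.regular u t (by linarith) hut ht (by linarith)).lip (x + v) (x + (v + D))
    have e3 := hB.norm_integral_sub_le hC (x := fun _ => x) (x' := fun _ => x + (v + D))
      continuousOn_const continuousOn_const (hs.trans hsu) hut ht (S := ‖v + D‖)
      fun _ _ => by rw [show x - (x + (v + D)) = -(v + D) by abel, norm_neg]
    have hD : ‖D‖ ≤ C * (t - s) :=
      (hB.norm_integral_le (fun _ => x) hs hsu (hut.trans ht)).trans (by gcongr)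
    have hvD : ‖v + D‖ ≤ 2 * C * (t - s) ^ α := by
      refine (bd s u hs hsu (hut.trans ht) (by linarith) x).trans ?_
      gcongr
    have e2' : ‖A u t (x + v) - A u t (x + (v + D))‖ ≤ C ^ 2 * (t - s) ^ (2 / 3 + α) := by
      refine e2.trans ?_
      rw [show x + v - (x + (v + D)) = -D by abel, norm_neg]
      calc C * (t - u) ^ α * ‖D‖ ≤ C * (t - s) ^ α * (C * (t - s) ^ (1 : ℝ)) := by
            rw [Real.rpow_one]
            gcongr
        _ = C ^ 2 * ((t - s) ^ α * (t - s) ^ (1 : ℝ)) := by ring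
        _ ≤ _ := by
            gcongr
            exact rpow_mul_le_rpow hτ h1 (by linarith) (by linarith) (by linarith) (by linarith)
    have e3' : ‖(∫ r in u..t, B r x) - ∫ r in u..t, B r (x + (v + D))‖
        ≤ 2 * C ^ 2 * (t - s) ^ (2 / 3 + α) := by
      refine e3.trans ?_
      calc C * ‖v + D‖ * (t - u) ≤ C * (2 * C * (t - s) ^ α) * (t - s) ^ (1 : ℝ) := by
            rw [Real.rpow_one]
            gcongr
        _ = 2 * C ^ 2 * ((t - s) ^ α * (t - s) ^ (1 : ℝ)) := by ring
        _ ≤ _ := by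
            gcongr
            exact rpow_mul_le_rpow hτ h1 (by linarith) (by linarith) (by linarith) (by linarith)
    rw [e]
    refine (norm_add_le _ _).trans ((add_le_add ((norm_add_le _ _).trans (add_le_add e1 e2'))
      e3').trans ?_)
    have h5 : 0 ≤ C * (t - s) ^ (2 / 3 + α) := mul_nonneg hC (Real.rpow_nonneg hτ _)
    linarith

/-- Uniform bounds for the flow lines of a flow with drift, on short intervals. -/
theorem exists_flowLine_bounds (hα : 1 / 3 < α) (hα' : α ≤ 1) (hC : 0 ≤ C) :
    ∃ h L, 0 < h ∧ h ≤ 1 ∧ 0 ≤ L ∧ ∀ (a T : ℝ) (A : ℝ → ℝ → E → E) (B : ℝ → E → E) (x : ℝ → E),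
      0 ≤ a → IsAlmostFlow T α C A → IsBoundedDrift a T C B → IsFlowLine a T (driftGerm A B) x →
      ContinuousOn x (Icc a T) ∧ ∀ s t, a ≤ s → s ≤ t → t ≤ T → t - s ≤ h →
        ‖x t - x s‖ ≤ L * (t - s) ^ α ∧
        ‖x t - x s - A s t (x s) - ∫ r in s..t, B r (x r)‖ ≤ L * (t - s) ^ (2 / 3 + α) := by
  have hC' : 0 ≤ 2 * C + 3 * C ^ 2 := by positivity
  obtain ⟨h, L, h0, h1, hL, hb⟩ := exists_forall_isFlowLine_bound (E := E) hα hC'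
  set C' := 2 * C + 3 * C ^ 2
  refine ⟨h, (C' + L) + (L + C * (C' + L)), h0, h1, by positivity,
    fun a T A B x ha hA hB hx => ?_⟩
  have hG := hA.isWeakFlow hB ha hα hα'
  have hcont : ContinuousOn x (Icc a T) := by
    obtain ⟨C'', -, h2⟩ := hx.exists_norm_sub_le hG hα' (by linarith)
    exact continuousOn_of_norm_sub_le (by linarith) h2
  have hinc : ∀ s t, a ≤ s → s ≤ t → t ≤ T → t - s ≤ h →
      ‖x t - x s‖ ≤ (C' + L) * (t - s) ^ α := by
    intro s t hs hst ht hτ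
    have hτ0 := sub_nonneg.2 hst
    refine (hG.norm_increment_le hs hst ht (hτ.trans h1)).trans ?_
    have e1 := hb a T _ x hG hx s t hs hst ht hτ
    have e2 : (t - s) ^ (2 / 3 + α) ≤ (t - s) ^ α :=
      Real.rpow_le_rpow_of_exponent_ge' hτ0 (hτ.trans h1) (by linarith) (by linarith)
    have e3 := mul_le_mul_of_nonneg_left e2 hL
    rw [add_mul]
    linarith
  refine ⟨hcont, fun s t hs hst ht hτ => ⟨?_, ?_⟩⟩
  · have : 0 ≤ (t - s) ^ α := Real.rpow_nonneg (sub_nonneg.2 hst) _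
    refine (hinc s t hs hst ht hτ).trans ?_
    refine mul_le_mul_of_nonneg_right ?_ this
    have : 0 ≤ L + C * (C' + L) := by positivity
    linarith
  · have hτ0 := sub_nonneg.2 hst
    have e1 := hb a T _ x hG hx s t hs hst ht hτ
    have e2 := hB.norm_integral_sub_le hC (x := fun _ => x s) (x' := x) continuousOn_const hcont
      hs hst ht (S := (C' + L) * (t - s) ^ α) fun r hr => by
        rw [norm_sub_rev]
        refine (hinc s r hs hr.1 (hr.2.trans ht) (by linarith [hr.2])).trans ?_
        have := hr.1
        have := hr.2
        gcongr
    have e3 : (t - s) ^ α * (t - s) ^ (1 : ℝ) ≤ (t - s) ^ (2 / 3 + α) :=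
      rpow_mul_le_rpow hτ0 (hτ.trans h1) (by linarith) (by linarith) (by linarith) (by linarith)
    rw [Real.rpow_one] at e3
    have e : x t - x s - A s t (x s) - ∫ r in s..t, B r (x r)
        = (x t - x s - driftGerm A B s t (x s))
          + ((∫ r in s..t, B r (x s)) - ∫ r in s..t, B r (x r)) := by
      simp only [driftGerm]; abel
    rw [e]
    refine (norm_add_le _ _).trans ((add_le_add e1 e2).trans ?_)
    have e4 : C * ((C' + L) * (t - s) ^ α) * (t - s) ≤ C * (C' + L) * (t - s) ^ (2 / 3 + α) := by
      calc _ = C * (C' + L) * ((t - s) ^ α * (t - s)) := by ring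
        _ ≤ _ := by gcongr
    have e5 : 0 ≤ (C' + L) * (t - s) ^ (2 / 3 + α) :=
      mul_nonneg (by positivity) (Real.rpow_nonneg hτ0 _)
    linarith

/-- Flow lines depend on their initial value in a Lipschitz way, on short intervals. -/
theorem exists_forall_flowLine_sub_le_local (hα : 1 / 3 < α) (hα' : α ≤ 1) (hC : 0 ≤ C) :
    ∃ h, 0 < h ∧ ∀ (a T : ℝ) (A : ℝ → ℝ → E → E) (B : ℝ → E → E) (x x' : ℝ → E),
      0 ≤ a → IsAlmostFlow T α C A → IsBoundedDrift a T C B →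
      IsFlowLine a T (driftGerm A B) x → IsFlowLine a T (driftGerm A B) x' →
      ∀ t ∈ Icc a T, t - a ≤ h → ‖x t - x' t‖ ≤ 2 * ‖x a - x' a‖ := by
  obtain ⟨h₁, L, h₁0, h₁1, hL, hb⟩ := exists_flowLine_bounds (E := E) hα hα' hC
  have hq : 0 < 1 - (2 : ℝ) ^ (1 - (2 / 3 + α)) := by
    linarith [two_rpow_one_sub_lt_one (θ := 2 / 3 + α) (by linarith)]
  -- The defect of `A` gives the first `C`. The second differences of `A u t` give the rest: the
  -- difference of the two drift integrals, and `‖w‖ ‖φ - φ'‖` with `‖w‖` of order `2/3`.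
  set M := C + C * (C + (C + L) * (1 + C)) with hM
  have hM0 : 0 ≤ M := by positivity
  set L' := 2 * M / (1 - 2 ^ (1 - (2 / 3 + α))) with hL'
  have hL'0 : 0 ≤ L' := by positivity
  obtain ⟨h₂, h₂0, h₂1, h₂h⟩ := exists_small (α := α) (C := C) (by linarith) (half_pos hq)
  obtain ⟨h₃, h₃0, h₃1, h₃h⟩ :=
    exists_small (α := α) (C := 2 * C + L') (by linarith) (one_half_pos (α := ℝ))
  set h := min h₁ (min h₂ h₃) with hh
  have h0 : 0 < h := lt_min h₁0 (lt_min h₂0 h₃0)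
  have hh₁ : h ≤ h₁ := min_le_left _ _
  have hh₂ : h ≤ h₂ := (min_le_right _ _).trans (min_le_left _ _)
  have hh₃ : h ≤ h₃ := (min_le_right _ _).trans (min_le_right _ _)
  have h1 : h ≤ 1 := hh₁.trans h₁1
  refine ⟨h, h0, fun a T A B x x' ha hA hB hx hx' t ht hta => ?_⟩
  obtain ⟨hxc, hxb⟩ := hb a T A B x ha hA hB hx
  obtain ⟨hxc', hxb'⟩ := hb a T A B x' ha hA hB hx'
  have small₂ : C * h ^ α ≤ (1 - 2 ^ (1 - (2 / 3 + α))) / 2 := le_trans (by gcongr) h₂h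
  have small₃ : (2 * C + L') * h ^ α ≤ 1 / 2 := le_trans (by gcongr) h₃h
  set D := fun r => x r - x' r with hD
  set J := fun s t => x t - x s - A s t (x s) - ∫ r in s..t, B r (x r) with hJ
  set J' := fun s t => x' t - x' s - A s t (x' s) - ∫ r in s..t, B r (x' r) with hJ'
  set b := min T (a + h)
  have hbT : b ≤ T := min_le_left _ _
  have hbh : b ≤ a + h := min_le_right _ _
  -- A bound `S` on the distance of the two paths improves to `‖D a‖ + S / 2` on a short window,
  -- whence the factor `2`.
  have key := le_of_forall_improve (ι := Icc a b) (f := fun r => ‖D r‖) (g := fun _ => 1)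
    (θ := 1 / 2) (b := ‖D a‖) (by norm_num) (by norm_num) (norm_nonneg _)
    (fun _ => zero_le_one) ?_ ?_ ⟨t, ht.1, le_min ht.2 (by linarith)⟩
  · refine key.trans (le_of_eq ?_)
    simp only [hD]
    ring
  · obtain ⟨c, hc⟩ := (isCompact_Icc (a := a) (b := T)).exists_bound_of_continuousOn
      (hxc.sub hxc')
    exact ⟨max c 0, le_max_right _ _, fun r => by
      rw [mul_one]; exact (hc r ⟨r.2.1, r.2.2.trans hbT⟩).trans (le_max_left _ _)⟩
  intro S hS hDS
  have hDS' : ∀ r, a ≤ r → r ≤ b → ‖D r‖ ≤ S := fun r h2 h3 => by simpa using hDS ⟨r, h2, h3⟩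
  have hE : ∀ s t, a ≤ s → s ≤ t → t ≤ b → t - s ≤ h →
      ‖J s t - J' s t‖ ≤ L' * S * (t - s) ^ (2 / 3 + α) := by
    intro s t hs hst ht hτ
    -- The crude size `L + L` carries no factor `S`, but the sewing bound eliminates it and keeps
    -- only `M * S`.
    have := norm_le_of_midpoint_of_small (J := fun s t => J s t - J' s t) (a := a) (b := b)
      (h := h) (θ := 2 / 3 + α) (θ' := 2 / 3 + α) (α := α) (C := C) (L := L + L) (M := M * S)
      (by linarith) (by linarith) (by linarith) (by linarith) h1 h0.le hC (by positivity)
      (by positivity) small₂ ?_ ?_ hs hst ht hτ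
    · refine this.trans (le_of_eq ?_)
      rw [hL']
      ring
    · intro s t hs hst ht hτ
      rw [add_mul]
      exact (norm_sub_le _ _).trans (add_le_add
        (hxb s t hs hst (ht.trans hbT) (hτ.trans hh₁)).2
        (hxb' s t hs hst (ht.trans hbT) (hτ.trans hh₁)).2)
    · intro s u t hs hsu hut ht hτ
      have hτ0 : 0 ≤ t - s := by linarith
      have hτ1 : t - s ≤ 1 := hτ.trans h1
      have htT : t ≤ T := ht.trans hbT
      -- `x u` is written as the one-step image `φ` plus a correction `w` of order `2/3`, so that
      -- the difference of the two paths meets `A u t` only through a Lipschitz defect and a second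
      -- difference.
      have split : ∀ (x : ℝ → E), ContinuousOn x (Icc a T) →
          (x t - x s - A s t (x s) - ∫ r in s..t, B r (x r))
            = (x u - x s - A s u (x s) - ∫ r in s..u, B r (x r))
              + (x t - x u - A u t (x u) - ∫ r in u..t, B r (x r))
              + (-(A s t (x s) - A s u (x s) - A u t (x s + A s u (x s)))
                + (A u t (x s + A s u (x s) + ((∫ r in s..u, B r (x r))
                    + (x u - x s - A s u (x s) - ∫ r in s..u, B r (x r))))
                  - A u t (x s + A s u (x s)))) := by
        intro x hx
        have h2 := intervalIntegral.integral_add_adjacent_intervals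
          (hB.intervalIntegrable hx hs hsu (hut.trans htT))
          (hB.intervalIntegrable hx (hs.trans hsu) hut htT)
        have h3 : x s + A s u (x s) + ((∫ r in s..u, B r (x r))
                    + (x u - x s - A s u (x s) - ∫ r in s..u, B r (x r))) = x u := by abel
        rw [h3, ← h2]
        abel
      have eJ := split x hxc
      have eJ' := split x' hxc'
      set I := ∫ r in s..u, B r (x r) with hI
      set I' := ∫ r in s..u, B r (x' r) with hI'
      set φ := x s + A s u (x s) with hφ
      set φ' := x' s + A s u (x' s) with hφ'
      set w := I + J s u with hw
      set w' := I' + J' s u with hw'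
      have eδ : J s t - J' s t = (J s u - J' s u) + (J u t - J' u t)
          + (-((A s t (x s) - A s u (x s) - A u t φ) - (A s t (x' s) - A s u (x' s) - A u t φ'))
            + ((A u t (φ + w) - A u t φ) - (A u t (φ' + w') - A u t φ'))) := by
        have e1 : J s t = J s u + J u t + (-(A s t (x s) - A s u (x s) - A u t φ)
          + (A u t (φ + w) - A u t φ)) := eJ
        have e2 : J' s t = J' s u + J' u t + (-(A s t (x' s) - A s u (x' s) - A u t φ')
          + (A u t (φ' + w') - A u t φ')) := eJ'
        rw [e1, e2]
        abel
      have hut1 : t - u ≤ 1 := by linarith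
      have hsu1 : u - s ≤ 1 := by linarith
      have hDs : ‖x s - x' s‖ ≤ S := hDS' s hs (by linarith)
      have n1 : ‖(A s t (x s) - A s u (x s) - A u t φ) - (A s t (x' s) - A s u (x' s) - A u t φ')‖
          ≤ C * (t - s) ^ (2 / 3 + α) * S := by
        refine ((hA.almost s u t (ha.trans hs) hsu hut htT hτ1).lip (x s) (x' s)).trans ?_
        gcongr
      have n2 : ‖φ - φ'‖ ≤ (1 + C) * S := by
        have e1 := (hA.regular s u (ha.trans hs) hsu (hut.trans htT) hsu1).lip (x s) (x' s)
        have e2 : (u - s) ^ α ≤ 1 := Real.rpow_le_one (by linarith) hsu1 (by linarith)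
        have e3 : C * (u - s) ^ α * ‖x s - x' s‖ ≤ C * 1 * S := by
          have : 0 ≤ (u - s) ^ α := Real.rpow_nonneg (by linarith) _
          gcongr
        have e4 : φ - φ' = (x s - x' s) + (A s u (x s) - A s u (x' s)) := by
          simp only [hφ, hφ']; abel
        rw [e4]
        refine (norm_add_le _ _).trans ?_
        linarith
      have n3 : ‖w‖ ≤ (C + L) * (t - s) ^ (2 / 3 : ℝ) := by
        have e1 := hB.norm_integral_le x hs hsu (hut.trans htT)
        have e2 := (hxb s u hs hsu (hut.trans htT) (by linarith)).2
        have e3 : (u - s) ≤ (t - s) ^ (2 / 3 : ℝ) :=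
          (by linarith : u - s ≤ t - s).trans
            (le_rpow_of_le_one hτ0 hτ1 (by norm_num) (by norm_num))
        have e4 : (u - s) ^ (2 / 3 + α) ≤ (t - s) ^ (2 / 3 : ℝ) :=
          (Real.rpow_le_rpow (by linarith) (by linarith) (by linarith)).trans
            (Real.rpow_le_rpow_of_exponent_ge' hτ0 hτ1 (by norm_num) (by linarith))
        have e5 := mul_le_mul_of_nonneg_left e3 hC
        have e6 := mul_le_mul_of_nonneg_left e4 hL
        refine (norm_add_le _ _).trans ?_
        simp only [hI, hJ]
        linarith
      have n4 : ‖w - w'‖ ≤ C * S * (t - s) + ‖J s u - J' s u‖ := by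
        have e1 := hB.norm_integral_sub_le hC hxc hxc' hs hsu (hut.trans htT) (S := S)
          fun r hr => hDS' r (hs.trans hr.1) (by linarith [hr.2])
        have e2 : w - w' = (I - I') + (J s u - J' s u) := by simp only [hw, hw']; abel
        rw [e2]
        refine (norm_add_le _ _).trans ?_
        have e3 : C * S * (u - s) ≤ C * S * (t - s) := by gcongr
        linarith
      have n5 : ‖(A u t (φ + w) - A u t φ) - (A u t (φ' + w') - A u t φ')‖
          ≤ C * (t - s) ^ α * (C * S * (t - s) + ‖J s u - J' s u‖
            + (C + L) * (t - s) ^ (2 / 3 : ℝ) * ((1 + C) * S)) := by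
        refine ((hA.regular u t (by linarith) hut htT hut1).second φ φ' w w').trans ?_
        have e1 : (t - u) ^ α ≤ (t - s) ^ α := by
          apply Real.rpow_le_rpow <;> linarith
        have e2 : 0 ≤ (t - u) ^ α := Real.rpow_nonneg (by linarith) _
        gcongr
      have p1 : (t - s) ^ α * (t - s) ^ (1 : ℝ) ≤ (t - s) ^ (2 / 3 + α) :=
        rpow_mul_le_rpow hτ0 hτ1 (by linarith) (by linarith) (by linarith) (by linarith)
      have p2 : (t - s) ^ α * (t - s) ^ (2 / 3 : ℝ) ≤ (t - s) ^ (2 / 3 + α) :=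
        rpow_mul_le_rpow hτ0 hτ1 (by linarith) (by linarith) (by linarith) (by linarith)
      rw [Real.rpow_one] at p1
      have p3 : C * C * S * ((t - s) ^ α * (t - s)) ≤ C * C * S * (t - s) ^ (2 / 3 + α) := by
        gcongr
      have p4 : C * (C + L) * (1 + C) * S * ((t - s) ^ α * (t - s) ^ (2 / 3 : ℝ))
          ≤ C * (C + L) * (1 + C) * S * (t - s) ^ (2 / 3 + α) := by
        gcongr
      simp only [eδ]
      refine (norm_add_le _ _).trans (add_le_add (norm_add_le _ _) ?_)
      refine (norm_add_le _ _).trans ?_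
      rw [norm_neg]
      refine (add_le_add n1 n5).trans ?_
      rw [hM]
      linarith
  rintro ⟨t, hat, htb⟩
  simp only
  have hτ0 : 0 ≤ t - a := by linarith
  have hτ : t - a ≤ h := by linarith
  have hτ1 : t - a ≤ 1 := hτ.trans h1
  have htT : t ≤ T := htb.trans hbT
  have hpow : (t - a) ^ α ≤ h ^ α := by
    apply Real.rpow_le_rpow <;> linarith
  have e1 := (hA.regular a t ha hat htT hτ1).lip (x a) (x' a)
  have e2 := hB.norm_integral_sub_le hC hxc hxc' le_rfl hat htT (S := S)
    fun r hr => hDS' r hr.1 (hr.2.trans htb)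
  have e3 := hE a t le_rfl hat htb hτ
  have e : D t = D a + (A a t (x a) - A a t (x' a))
      + ((∫ r in a..t, B r (x r)) - ∫ r in a..t, B r (x' r)) + (J a t - J' a t) := by
    simp only [hD, hJ, hJ']; abel
  have f1 : C * (t - a) ^ α * ‖x a - x' a‖ ≤ C * h ^ α * S := by
    have := hDS' a le_rfl (hat.trans htb)
    gcongr
  have f2 : C * S * (t - a) ≤ C * S * h ^ α := by
    have := (le_rpow_of_le_one hτ0 hτ1 (by linarith) hα').trans hpow
    gcongr
  have f3 : L' * S * (t - a) ^ (2 / 3 + α) ≤ L' * S * h ^ α := by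
    have := (Real.rpow_le_rpow_of_exponent_ge' (z := α) (y := 2 / 3 + α) hτ0 hτ1 (by linarith)
      (by linarith)).trans hpow
    gcongr
  have f4 : (2 * C + L') * h ^ α * S ≤ 1 / 2 * S := by gcongr
  rw [e]
  refine (norm_add_le _ _).trans ((add_le_add ((norm_add_le _ _).trans (add_le_add
    (norm_add_le _ _) le_rfl)) le_rfl).trans ?_)
  linarith

/-- Flow lines depend on their initial value in a Lipschitz way. -/
theorem exists_forall_flowLine_sub_le (T : ℝ) (hα : 1 / 3 < α) (hα' : α ≤ 1) (hC : 0 ≤ C) :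
    ∃ K, 0 ≤ K ∧ ∀ (a : ℝ) (A : ℝ → ℝ → E → E) (B : ℝ → E → E) (x x' : ℝ → E),
      0 ≤ a → IsAlmostFlow T α C A → IsBoundedDrift a T C B →
      IsFlowLine a T (driftGerm A B) x → IsFlowLine a T (driftGerm A B) x' →
      ∀ t ∈ Icc a T, ‖x t - x' t‖ ≤ K * ‖x a - x' a‖ := by
  obtain ⟨h, h0, hh⟩ := exists_forall_flowLine_sub_le_local (E := E) hα hα' hC
  obtain ⟨n, hn⟩ := exists_nat_ge (T / h)
  rw [div_le_iff₀ h0] at hn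
  refine ⟨2 ^ n, by positivity, fun a A B x x' ha hA hB hx hx' => ?_⟩
  have key : ∀ n : ℕ, ∀ t ∈ Icc a T, t ≤ a + n * h → ‖x t - x' t‖ ≤ 2 ^ n * ‖x a - x' a‖ := by
    intro n
    induction n with
    | zero =>
      intro t ht hta
      have : t = a := le_antisymm (by simpa using hta) ht.1
      simp [this]
    | succ n ih =>
      intro t ht hta
      push_cast at hta
      have hc : max a (t - h) ∈ Icc a T :=
        ⟨le_max_left _ _, max_le (ht.1.trans ht.2) (by linarith [ht.2])⟩
      have e1 := ih _ hc (max_le (by nlinarith [n.cast_nonneg (α := ℝ)]) (by linarith))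
      have e2 := hh _ T A B x x' (ha.trans hc.1) hA (hB.mono hc.1)
        (hx.mono hc.1) (hx'.mono hc.1) t ⟨max_le ht.1 (by linarith), ht.2⟩
        (by linarith [le_max_right a (t - h)])
      rw [pow_succ]
      linarith
  intro t ht
  exact key n t ht (by linarith [ht.2])

end Drift

/-! ### Wasserstein convergence and integrals of bounded continuous functions -/

section Measure

variable {U : Type*} [MetricSpace U] [SecondCountableTopology U] [MeasurableSpace U] [BorelSpace U]

instance (μ : P2 U) : IsProbabilityMeasure μ.toMeasure := μ.2.1

theorem W₂_self (μ : P2 U) : W₂ μ μ = 0 := by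
  have hm : Measurable fun a : U => (a, a) := measurable_id.prodMk measurable_id
  refine le_antisymm (iInf₂_le_of_le (μ.toMeasure.map fun a => (a, a)) ⟨?_, ?_⟩ ?_) bot_le
  · rw [Measure.map_map measurable_fst hm]; exact Measure.map_id
  · rw [Measure.map_map measurable_snd hm]; exact Measure.map_id
  · rw [lintegral_map (by fun_prop) hm]
    simp

/-- Convergence in the Wasserstein distance implies weak convergence. -/
theorem exists_forall_W₂_lt_norm_integral_sub_le {V : Type*} [NormedAddCommGroup V]
    [NormedSpace ℝ V] {f : U → V} (hf : Continuous f) {C : ℝ} (hC : 0 ≤ C)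
    (hfC : ∀ a, ‖f a‖ ≤ C) (μ : P2 U) {e : ℝ} (he : 0 < e) :
    ∃ δ : ℝ≥0∞, 0 < δ ∧ ∀ ν : P2 U, W₂ μ ν < δ →
      ‖∫ a, f a ∂μ.toMeasure - ∫ a, f a ∂ν.toMeasure‖ ≤ e := by
  -- `f` need not be uniformly continuous. `N k` collects the points near which `f` oscillates by
  -- more than `e / 3` at scale `1 / (k + 1)`; these open sets decrease to `∅`, so their mass tends
  -- to zero.
  let N : ℕ → Set U := fun k => {a | ∃ a', dist a a' < 1 / (k + 1) ∧ e / 3 < dist (f a) (f a')}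
  have hNo : ∀ k, IsOpen (N k) := by
    intro k
    have : N k = ⋃ a', {a | dist a a' < 1 / (k + 1)} ∩ {a | e / 3 < dist (f a) (f a')} := by
      ext a; simp [N]
    rw [this]
    exact isOpen_iUnion fun a' => (isOpen_lt (by fun_prop) (by fun_prop)).inter
      (isOpen_lt (by fun_prop) (by fun_prop))
  have hNa : Antitone N := by
    rintro k l hkl a ⟨a', h1, h2⟩
    exact ⟨a', h1.trans_le (one_div_le_one_div_of_le (by positivity) (by gcongr)), h2⟩
  have hN0 : ⋂ k, N k = ∅ := by
    rw [eq_empty_iff_forall_notMem]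
    intro a ha
    obtain ⟨r, hr, hra⟩ := Metric.continuous_iff.1 hf a (e / 3) (by positivity)
    obtain ⟨k, hk⟩ := exists_nat_one_div_lt hr
    obtain ⟨a', h1, h2⟩ := mem_iInter.1 ha k
    have := hra a' (by rw [dist_comm]; exact h1.trans hk)
    rw [dist_comm] at this
    exact absurd this h2.not_gt
  have hNt := tendsto_measure_iInter_atTop (μ := μ.toMeasure)
    (fun k => (hNo k).measurableSet.nullMeasurableSet) hNa ⟨0, measure_ne_top _ _⟩
  rw [hN0, measure_empty] at hNt
  have hNt' := ENNReal.Tendsto.const_mul (a := ENNReal.ofReal (2 * C)) hNt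
    (Or.inr ENNReal.ofReal_ne_top)
  rw [mul_zero] at hNt'
  obtain ⟨k, hk⟩ := (hNt'.eventually (gt_mem_nhds
    (ENNReal.ofReal_pos.2 (by positivity : 0 < e / 3)))).exists
  set c := 2 * C * ((k : ℝ) + 1) ^ 2 with hc
  have hc0 : 0 ≤ c := by positivity
  refine ⟨ENNReal.ofReal (Real.sqrt (e / 3 / (c + 1))), by
    rw [ENNReal.ofReal_pos]; positivity, fun ν hν => ?_⟩
  obtain ⟨π, ⟨hπ₁, hπ₂⟩, hπ⟩ : ∃ π ∈ couplings μ ν, (∫⁻ p, edist p.1 p.2 ^ 2 ∂π) ^ (1 / 2 : ℝ)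
      < ENNReal.ofReal (Real.sqrt (e / 3 / (c + 1))) := by
    simpa [W₂, iInf_lt_iff] using hν
  have hπ' : ∫⁻ p, edist p.1 p.2 ^ 2 ∂π ≤ ENNReal.ofReal (e / 3 / (c + 1)) := by
    have h1 := ENNReal.rpow_le_rpow hπ.le (by norm_num : (0 : ℝ) ≤ 2)
    rw [← ENNReal.rpow_mul, ENNReal.ofReal_rpow_of_nonneg (by positivity) (by norm_num)] at h1
    norm_num at h1
    rwa [← ENNReal.ofReal_pow (Real.sqrt_nonneg _), Real.sq_sqrt (by positivity)] at h1
  have hprob : IsProbabilityMeasure π := ⟨by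
    have := μ.2.1.measure_univ
    change μ.toMeasure univ = 1 at this
    rwa [← hπ₁, Measure.map_apply measurable_fst MeasurableSet.univ, preimage_univ] at this⟩
  have hint : ∀ {g : U × U → U}, Measurable g → Integrable (fun p => f (g p)) π := fun hg =>
    Integrable.of_bound (hf.stronglyMeasurable.comp_measurable hg).aestronglyMeasurable C
      (Eventually.of_forall fun p => hfC _)
  have e1 : ∫ a, f a ∂μ.toMeasure - ∫ a, f a ∂ν.toMeasure = ∫ p, (f p.1 - f p.2) ∂π := by
    rw [integral_sub (hint measurable_fst) (hint measurable_snd), ← hπ₁, ← hπ₂,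
      integral_map measurable_fst.aemeasurable hf.stronglyMeasurable.aestronglyMeasurable,
      integral_map measurable_snd.aemeasurable hf.stronglyMeasurable.aestronglyMeasurable]
  -- Three cases: `a` is a bad point; `a` is good and `a'` is close; or `a'` is far, and the bound
  -- `2 * C` is absorbed by the transport cost as in Chebyshev's inequality.
  have hpt : ∀ p : U × U, ‖f p.1 - f p.2‖ₑ ≤ ENNReal.ofReal (e / 3)
      + ENNReal.ofReal (2 * C) * (N k).indicator 1 p.1
      + ENNReal.ofReal c * edist p.1 p.2 ^ 2 := by
    rintro ⟨a, a'⟩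
    have hb : ‖f a - f a'‖ ≤ 2 * C := by
      refine (norm_sub_le _ _).trans ?_
      linarith [hfC a, hfC a']
    simp only
    rw [← ofReal_norm]
    by_cases ha : a ∈ N k
    · rw [indicator_of_mem ha, Pi.one_apply, mul_one]
      exact (ENNReal.ofReal_le_ofReal hb).trans (le_add_right le_add_self)
    · by_cases hd : dist a a' < 1 / (k + 1)
      · have : ‖f a - f a'‖ ≤ e / 3 := by
          rw [← dist_eq_norm]
          by_contra hcon
          exact ha ⟨a', hd, not_le.1 hcon⟩
        exact (ENNReal.ofReal_le_ofReal this).trans (le_add_right (le_add_right le_rfl))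
      · refine le_add_left ?_
        rw [edist_dist, ← ENNReal.ofReal_pow dist_nonneg, ← ENNReal.ofReal_mul hc0]
        refine ENNReal.ofReal_le_ofReal (hb.trans ?_)
        have h1 : 1 ≤ ((k : ℝ) + 1) * dist a a' := by
          rw [not_lt, div_le_iff₀ (by positivity)] at hd
          linarith
        have h2 : 1 ≤ (((k : ℝ) + 1) * dist a a') ^ 2 := one_le_pow₀ h1
        calc 2 * C ≤ 2 * C * (((k : ℝ) + 1) * dist a a') ^ 2 :=
              le_mul_of_one_le_right (by positivity) h2
          _ = _ := by rw [hc]; ring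
  have hfinal : ‖∫ p, (f p.1 - f p.2) ∂π‖ₑ ≤ ENNReal.ofReal e := by
    calc ‖∫ p, (f p.1 - f p.2) ∂π‖ₑ ≤ ∫⁻ p, ‖f p.1 - f p.2‖ₑ ∂π := enorm_integral_le_lintegral_enorm _
      _ ≤ ∫⁻ p, (ENNReal.ofReal (e / 3) + ENNReal.ofReal (2 * C) * (N k).indicator 1 p.1
            + ENNReal.ofReal c * edist p.1 p.2 ^ 2) ∂π := lintegral_mono hpt
      _ = ENNReal.ofReal (e / 3) + ENNReal.ofReal (2 * C) * μ.toMeasure (N k)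
            + ENNReal.ofReal c * ∫⁻ p, edist p.1 p.2 ^ 2 ∂π := by
          have hm1 : Measurable fun p : U × U => (N k).indicator (1 : U → ℝ≥0∞) p.1 :=
            (measurable_one.indicator (hNo k).measurableSet).comp measurable_fst
          rw [lintegral_add_right _ (by fun_prop), lintegral_add_left (by fun_prop),
            lintegral_const, measure_univ, mul_one, lintegral_const_mul _ hm1,
            lintegral_const_mul _ (by fun_prop), ← hπ₁,
            Measure.map_apply measurable_fst (hNo k).measurableSet]
          congr 3
          rw [← lintegral_indicator_one (measurable_fst (hNo k).measurableSet)]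
          rfl
      _ ≤ ENNReal.ofReal (e / 3) + ENNReal.ofReal (e / 3) + ENNReal.ofReal (e / 3) := by
          refine add_le_add (add_le_add le_rfl hk.le) ((mul_le_mul_right hπ' _).trans ?_)
          rw [← ENNReal.ofReal_mul hc0]
          refine ENNReal.ofReal_le_ofReal ?_
          rw [mul_div_assoc', div_le_iff₀ (by positivity)]
          nlinarith
      _ = ENNReal.ofReal e := by
          rw [← ENNReal.ofReal_add (by positivity) (by positivity),
            ← ENNReal.ofReal_add (by positivity) (by positivity)]
          congr 1; ring
  rw [e1]
  rw [← ofReal_norm] at hfinal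
  exact (ENNReal.ofReal_le_ofReal_iff he.le).1 hfinal

end Measure

/-! ### Admissible controls, averaged drift and running reward -/

section Coefficients

variable {m : ℕ} {U : Type*} [MetricSpace U] [SecondCountableTopology U] [MeasurableSpace U]
  [BorelSpace U] {T ε L s : ℝ} {K : Set (P2 U)} {γ : ℝ → P2 U}

theorem admissible_mono {s' : ℝ} (h : s ≤ s') : admissible K ε L s T ⊆ admissible K ε L s' T :=
  fun _ hγ => ⟨fun r hr => hγ.1 r ⟨h.trans hr.1, hr.2⟩,
    fun r hr t ht => hγ.2 r ⟨h.trans hr.1, hr.2⟩ t ⟨h.trans ht.1, ht.2⟩⟩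

theorem const_mem_admissible {μ : P2 U} (hμ : μ ∈ K) : (fun _ => μ) ∈ admissible K ε L s T :=
  ⟨fun _ _ => hμ, fun _ _ _ _ => by rw [W₂_self]; exact bot_le⟩

/-- A control on `[c, T]` is extended to the left by a constant. -/
theorem extend_mem_admissible {c : ℝ} (hL : 0 ≤ L) (hε : 0 ≤ ε) (hc : c ≤ T)
    (hγ : γ ∈ admissible K ε L c T) : (fun r => γ (max c r)) ∈ admissible K ε L s T := by
  have hmem : ∀ r ∈ Icc s T, max c r ∈ Icc c T := fun r hr => ⟨le_max_left _ _, max_le hc hr.2⟩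
  refine ⟨fun r hr => hγ.1 _ (hmem r hr), fun r hr t ht =>
    (hγ.2 _ (hmem r hr) _ (hmem t ht)).trans (ENNReal.ofReal_le_ofReal ?_)⟩
  have : |max c t - max c r| ≤ |t - r| := by
    simpa using abs_max_sub_max_le_max c t c r
  gcongr

theorem tendsto_W₂_of_mem_admissible (hε : 0 < ε) (hγ : γ ∈ admissible K ε L s T) {r : ℝ}
    (hr : r ∈ Icc s T) {ι : Type*} {l : Filter ι} {u : ι → ℝ} (hu : Tendsto u l (𝓝 r))
    (hu' : ∀ᶠ i in l, u i ∈ Icc s T) : Tendsto (fun i => W₂ (γ r) (γ (u i))) l (𝓝 0) := by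
  have h1 : Tendsto (fun i => ENNReal.ofReal (L * |u i - r| ^ ε)) l (𝓝 0) := by
    have h2 : Continuous fun t : ℝ => ENNReal.ofReal (L * |t - r| ^ ε) :=
      ENNReal.continuous_ofReal.comp (continuous_const.mul
        (((continuous_id.sub continuous_const).abs).rpow_const fun _ => Or.inr hε.le))
    have h3 := (h2.tendsto r).comp hu
    simpa [Function.comp_def, Real.zero_rpow hε.ne'] using h3
  exact tendsto_of_tendsto_of_tendsto_of_le_of_le' tendsto_const_nhds h1
    (Eventually.of_forall fun _ => bot_le) (hu'.mono fun i hi => hγ.2 r hr _ hi)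

/-- The drift `∫_U b(t, x, a) γ_t(da)`. -/
noncomputable def controlledDrift (b : ℝ → Vec m → U → Vec m) (γ : ℝ → P2 U) (t : ℝ) (x : Vec m) :
    Vec m :=
  ∫ a, b t x a ∂(γ t).toMeasure

/-- Averaging against probability measures preserves the bounds, so `C` is chosen before the
control. For continuity along a path, the measure, the state and the time are varied separately; the
time modulus must be uniform in `a` because the measure varies too. -/
theorem IsDrift.exists_isBoundedDrift {b : ℝ → Vec m → U → Vec m} (hb : IsDrift T b) :
    ∃ C, 0 ≤ C ∧ ∀ (K : Set (P2 U)) (ε L s : ℝ) (γ : ℝ → P2 U), 0 < ε → 0 ≤ s →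
      γ ∈ admissible K ε L s T →
      IsBoundedDrift s T C (controlledDrift b γ) := by
  obtain ⟨C₁, hC₁⟩ := hb.bounded
  obtain ⟨C₂, hC₂⟩ := hb.bounded_space
  set C := max (max C₁ C₂) 0
  have hC : 0 ≤ C := le_max_right _ _
  have hbC : ∀ t ∈ Icc 0 T, ∀ x a, ‖b t x a‖ ≤ C := fun t ht x a =>
    (hC₁ t ht x a).trans ((le_max_left _ _).trans (le_max_left _ _))
  have hlip : ∀ t ∈ Icc 0 T, ∀ a x y, ‖b t x a - b t y a‖ ≤ C * ‖x - y‖ := fun t ht a x y =>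
    convex_univ.norm_image_sub_le_of_norm_hasFDerivWithin_le
      (fun z _ => (hb.differentiable_space t ht a z).hasFDerivAt.hasFDerivWithinAt)
      (fun z _ => (hC₂ t ht z a).trans ((le_max_right _ _).trans (le_max_left _ _)))
      (mem_univ y) (mem_univ x)
  have hcont : ∀ t ∈ Icc 0 T, ∀ x, Continuous (b t x) := fun t ht x =>
    hb.continuous.comp_continuous (f := fun a => (t, x, a)) (by fun_prop) fun a => ⟨ht, mem_univ _⟩
  have hint : ∀ t ∈ Icc 0 T, ∀ x (μ : P2 U), Integrable (b t x) μ.toMeasure := fun t ht x μ =>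
    Integrable.of_bound (hcont t ht x).stronglyMeasurable.aestronglyMeasurable C
      (Eventually.of_forall fun a => hbC t ht x a)
  have hsub : ∀ t ∈ Icc 0 T, ∀ t' ∈ Icc 0 T, ∀ x x' (μ : P2 U) (c : ℝ),
      (∀ a, ‖b t x a - b t' x' a‖ ≤ c) →
      ‖(∫ a, b t x a ∂μ.toMeasure) - ∫ a, b t' x' a ∂μ.toMeasure‖ ≤ c := by
    intro t ht t' ht' x x' μ c hc
    rw [← integral_sub (hint t ht x μ) (hint t' ht' x' μ)]
    have := norm_integral_le_of_norm_le_const (μ := μ.toMeasure) (Eventually.of_forall hc)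
    simpa using this
  refine ⟨C, hC, fun K ε L s γ hε hs hγ => ?_⟩
  have hI : ∀ {r}, r ∈ Icc s T → r ∈ Icc 0 T := fun hr => ⟨hs.trans hr.1, hr.2⟩
  refine ⟨fun t ht x => ?_, fun t ht x y => hsub t (hI ht) t (hI ht) x y _ _
    fun a => hlip t (hI ht) a x y, fun x hx r hr => ?_⟩
  · have := norm_integral_le_of_norm_le_const (μ := (γ t).toMeasure)
      (Eventually.of_forall (hbC t (hI ht) x))
    simpa [controlledDrift] using this
  · rw [ContinuousWithinAt, Metric.tendsto_nhds]
    intro e he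
    obtain ⟨δ, hδ, hW⟩ := exists_forall_W₂_lt_norm_integral_sub_le (hcont r (hI hr) (x r)) hC
      (hbC r (hI hr) (x r)) (γ r) (show 0 < e / 4 by positivity)
    have hev : ∀ᶠ t in 𝓝[Icc s T] r, t ∈ Icc s T := self_mem_nhdsWithin
    have h1 := tendsto_W₂_of_mem_admissible hε hγ hr
      (tendsto_id.mono_right nhdsWithin_le_nhds : Tendsto id (𝓝[Icc s T] r) (𝓝 r)) hev
    obtain ⟨ρ, hρ, hρ'⟩ := hb.uniform_time (x r) (e / 4) (by positivity)
    have h2 : ∀ᶠ t in 𝓝[Icc s T] r, dist t r < ρ := nhdsWithin_le_nhds (Metric.ball_mem_nhds r hρ)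
    have h3 : ∀ᶠ t in 𝓝[Icc s T] r, C * ‖x t - x r‖ < e / 4 := by
      have h4 : Tendsto (fun t => C * ‖x t - x r‖) (𝓝[Icc s T] r) (𝓝 (C * ‖x r - x r‖)) :=
        ((hx r hr).sub_const (x r)).norm.const_mul C
      rw [sub_self, norm_zero, mul_zero] at h4
      exact h4.eventually (gt_mem_nhds (by positivity))
    filter_upwards [hev, h1.eventually (gt_mem_nhds hδ), h2, h3] with t ht h1 h2 h3
    rw [dist_eq_norm]
    have f1 := hW (γ t) h1
    have f2 := hsub t (hI ht) r (hI hr) (x t) (x r) (γ t) (e / 4 + e / 4) fun a => by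
      have g1 := hlip t (hI ht) a (x t) (x r)
      have g2 := (hρ' t (hI ht) r (hI hr) (by rwa [Real.dist_eq] at h2) a).le
      have g3 := norm_add_le (b t (x t) a - b t (x r) a) (b t (x r) a - b r (x r) a)
      rw [sub_add_sub_cancel] at g3
      linarith
    have f3 := norm_sub_le
      ((∫ a, b t (x t) a ∂(γ t).toMeasure) - ∫ a, b r (x r) a ∂(γ t).toMeasure)
      ((∫ a, b r (x r) a ∂(γ r).toMeasure) - ∫ a, b r (x r) a ∂(γ t).toMeasure)
    rw [sub_sub_sub_cancel_right] at f3
    simp only [controlledDrift]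
    linarith

/-- The running reward is integrable along a controlled state. -/
theorem IsRunningReward.intervalIntegrable {F : ℝ → Vec m → P2 U → ℝ}
    (hF : IsRunningReward T K F) (hε : 0 < ε) (hs : 0 ≤ s) (hsT : s ≤ T)
    (hγ : γ ∈ admissible K ε L s T) {x : ℝ → Vec m} (hx : ContinuousOn x (Icc s T)) :
    IntervalIntegrable (fun r => F r (x r) (γ r)) volume s T := by
  -- `F` is measurable in time only for frozen state and control. These are frozen at grid times,
  -- the index of the cell of `r` being `κ n r`: countably many cells give measurability, and the
  -- Lipschitz conditions give the pointwise limit. The truncation by `T` keeps every grid time in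
  -- `[s, T]`.
  let t : ℕ → ℕ → ℝ := fun n k => min T (s + k / (n + 1))
  have htI : ∀ n k, t n k ∈ Icc s T := fun n k =>
    ⟨le_min hsT (by have : (0 : ℝ) ≤ k / (n + 1) := by positivity
                    linarith), min_le_left _ _⟩
  have hmeas := fun n k => hF.measurable_time (x (t n k)) (γ (t n k)) (hγ.1 _ (htI n k))
  let κ : ℕ → ℝ → ℕ := fun n r => ⌊(r - s) * (n + 1)⌋₊
  have hκ : ∀ n, Measurable (κ n) := fun n => by
    exact Nat.measurable_floor.comp (by fun_prop)
  have hstep : ∀ n, AEMeasurable (fun r => F r (x (t n (κ n r))) (γ (t n (κ n r))))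
      (volume.restrict (Icc s T)) := by
    intro n
    have hm : Measurable fun p : ℝ × ℕ => (hmeas n p.2).mk _ p.1 :=
      measurable_from_prod_countable_left fun k => (hmeas n k).measurable_mk
    refine AEMeasurable.mono_measure (μ := volume.restrict (Icc 0 T)) ?_
      (Measure.restrict_mono_set _ (Icc_subset_Icc_left hs))
    refine ⟨_, hm.comp (measurable_id.prodMk (hκ n)), ?_⟩
    filter_upwards [ae_all_iff.2 fun k => (hmeas n k).ae_eq_mk] with r hr
    exact hr _
  obtain ⟨C, hC⟩ := hF.bounded
  obtain ⟨Cx, hCx⟩ := hF.lipschitz_space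
  have hae : AEMeasurable (fun r => F r (x r) (γ r)) (volume.restrict (Icc s T)) := by
    refine aemeasurable_of_tendsto_metrizable_ae' hstep ?_
    filter_upwards [ae_restrict_mem measurableSet_Icc] with r hr
    have hr0 : r ∈ Icc 0 T := ⟨hs.trans hr.1, hr.2⟩
    have ht : Tendsto (fun n => t n (κ n r)) atTop (𝓝 r) := by
      have h1 : Tendsto (fun n : ℕ => r - 1 / ((n : ℝ) + 1)) atTop (𝓝 (r - 0)) :=
        tendsto_one_div_add_atTop_nhds_zero_nat.const_sub r
      rw [sub_zero] at h1
      have hfl : ∀ n, s + κ n r / ((n : ℝ) + 1) ≤ r := by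
        intro n
        have := Nat.floor_le (mul_nonneg (sub_nonneg.2 hr.1) (by positivity : (0:ℝ) ≤ n + 1))
        have h2 : (κ n r : ℝ) / ((n : ℝ) + 1) ≤ r - s := by
          rw [div_le_iff₀ (by positivity)]; exact this
        linarith
      refine tendsto_of_tendsto_of_tendsto_of_le_of_le h1 tendsto_const_nhds (fun n => ?_)
        fun n => (min_le_right _ _).trans (hfl n)
      refine le_min (by have : (0 : ℝ) ≤ 1 / ((n : ℝ) + 1) := by positivity
                        linarith [hr.2]) ?_
      have := Nat.lt_floor_add_one ((r - s) * ((n : ℝ) + 1))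
      have h2 : r - s ≤ (κ n r + 1) / ((n : ℝ) + 1) := by
        rw [le_div_iff₀ (by positivity)]; exact this.le
      rw [add_div] at h2
      linarith
    have htI' : ∀ n, t n (κ n r) ∈ Icc s T := fun n => htI _ _
    have hxt : Tendsto (fun n => x (t n (κ n r))) atTop (𝓝 (x r)) :=
      (hx r hr).tendsto.comp (tendsto_nhdsWithin_iff.2 ⟨ht, Eventually.of_forall htI'⟩)
    obtain ⟨Cγ, hCγ⟩ := hF.lipschitz_control r hr0 (x r)
    have hW := tendsto_W₂_of_mem_admissible hε hγ hr ht (Eventually.of_forall htI')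
    have h5 : Tendsto (fun n => ENNReal.ofReal |F r (x r) (γ r) - F r (x r) (γ (t n (κ n r)))|)
        atTop (𝓝 0) := by
      have h6 := ENNReal.Tendsto.const_mul (a := ENNReal.ofReal Cγ) hW
        (Or.inr ENNReal.ofReal_ne_top)
      rw [mul_zero] at h6
      exact tendsto_of_tendsto_of_tendsto_of_le_of_le tendsto_const_nhds h6
        (fun _ => bot_le) fun n => hCγ _ (hγ.1 r hr) _ (hγ.1 _ (htI' n))
    have h7 : Tendsto (fun n => |F r (x r) (γ r) - F r (x r) (γ (t n (κ n r)))|) atTop (𝓝 0) := by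
      have := (ENNReal.tendsto_toReal ENNReal.zero_ne_top).comp h5
      simpa [Function.comp_def, ENNReal.toReal_ofReal (abs_nonneg _)] using this
    have h8 : Tendsto (fun n => Cx * ‖x (t n (κ n r)) - x r‖) atTop (𝓝 0) := by
      have := ((hxt.sub_const (x r)).norm).const_mul Cx
      simpa using this
    rw [tendsto_iff_norm_sub_tendsto_zero]
    refine squeeze_zero (fun _ => norm_nonneg _) (fun n => ?_) (by simpa using h8.add h7)
    rw [Real.norm_eq_abs]
    have g1 := hCx r hr0 (γ (t n (κ n r))) (hγ.1 _ (htI' n)) (x (t n (κ n r))) (x r)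
    rw [abs_sub_comm (F r (x r) (γ r))]
    refine (abs_sub_le _ (F r (x r) (γ (t n (κ n r)))) _).trans ?_
    linarith
  rw [intervalIntegrable_iff_integrableOn_Icc_of_le hsT]
  refine Integrable.of_bound hae.aestronglyMeasurable C ?_
  filter_upwards [ae_restrict_mem measurableSet_Icc] with r hr
  exact hC r ⟨hs.trans hr.1, hr.2⟩ _ _ (hγ.1 r hr)

end Coefficients

/-! ### Solutions are exactly the flow lines -/

section Solutions

variable {m d : ℕ} {U : Type*} [MetricSpace U] [MeasurableSpace U] {T α : ℝ}
  {ζ : ℝ → Vec d} {Z : ℝ → ℝ → Fin d → Fin d → ℝ} {b : ℝ → Vec m → U → Vec m}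
  {σ : ℝ → Vec m → Vec d →L[ℝ] Vec m} {γ γ' : ℝ → P2 U} {x : ℝ → Vec m} {s : ℝ} {y : Vec m}

theorem IsAlmostFlow.mono {E : Type*} [NormedAddCommGroup E] [NormedSpace ℝ E] {C C' : ℝ}
    {A : ℝ → ℝ → E → E} (hA : IsAlmostFlow T α C A) (h : C ≤ C') : IsAlmostFlow T α C' A :=
  ⟨hA.nonneg.trans h,
    fun s t hs hst ht h1 => (hA.regular s t hs hst ht h1).mono
      (mul_le_mul_of_nonneg_right h (Real.rpow_nonneg (sub_nonneg.2 hst) _)),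
    fun s u t hs hsu hut ht h1 => (hA.almost s u t hs hsu hut ht h1).mono
      (mul_le_mul_of_nonneg_right h (Real.rpow_nonneg (sub_nonneg.2 (hsu.trans hut)) _))⟩

theorem IsBoundedDrift.mono_const {E : Type*} [NormedAddCommGroup E] [NormedSpace ℝ E]
    {a C C' : ℝ} {B : ℝ → E → E} (hB : IsBoundedDrift a T C B) (h : C ≤ C') :
    IsBoundedDrift a T C' B :=
  ⟨fun t ht x => (hB.bound t ht x).trans h,
    fun t ht x y => (hB.lip t ht x y).trans (by gcongr), hB.continuousOn⟩

/-- On intervals longer than `h` the uniform bound `M` is at most `M / h ^ μ` times the required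
power. This globalises the flow line estimates, which hold for short intervals. -/
theorem isHolder₂_of_local {V : Type*} [NormedAddCommGroup V] {μ a b h C M : ℝ}
    {g : ℝ → ℝ → V} (hμ : 0 ≤ μ) (hh : 0 < h)
    (hloc : ∀ s t, a ≤ s → s ≤ t → t ≤ b → t - s ≤ h → ‖g s t‖ ≤ C * (t - s) ^ μ)
    (hM : ∀ s t, a ≤ s → s ≤ t → t ≤ b → ‖g s t‖ ≤ M) : IsHolder₂ μ a b g := by
  refine ⟨max C (M / h ^ μ), fun s t hs hst ht => ?_⟩
  have hhμ : 0 < h ^ μ := Real.rpow_pos_of_pos hh _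
  rcases le_or_gt (t - s) h with hτ | hτ
  · refine (hloc s t hs hst ht hτ).trans ?_
    have := Real.rpow_nonneg (sub_nonneg.2 hst) μ
    gcongr
    exact le_max_left _ _
  · have h1 : h ^ μ ≤ (t - s) ^ μ := Real.rpow_le_rpow hh.le hτ.le hμ
    have h2 : 0 ≤ M := (norm_nonneg _).trans (hM s t hs hst ht)
    calc ‖g s t‖ ≤ M := hM s t hs hst ht
      _ = M / h ^ μ * h ^ μ := by field_simp
      _ ≤ max C (M / h ^ μ) * (t - s) ^ μ :=
        mul_le_mul (le_max_right _ _) h1 hhμ.le (le_max_of_le_right (by positivity))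

theorem IsSolution.congr_control (hx : IsSolution T α ζ Z b σ s y γ x)
    (h : ∀ r ∈ Icc s T, γ r = γ' r) : IsSolution T α ζ Z b σ s y γ' x := by
  obtain ⟨hy, κ, hκ, hκ', hc, hμ, Λ, hΛ, hx⟩ := hx
  refine ⟨hy, κ, hκ, hκ', hc, hμ, Λ, hΛ, fun r t hr hrt ht => ?_⟩
  rw [hx r t hr hrt ht]
  congr 2
  refine intervalIntegral.integral_congr fun u hu => ?_
  rw [uIcc_of_le hrt] at hu
  simp only [h u ⟨hr.trans hu.1, hu.2.trans ht⟩]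

/-- The sewn remainder has order `3 κ > 1`, and freezing the drift costs order `1 + κ`. The exponent
depends on the `κ` of the particular solution; the a priori bounds later replace it by `2/3 + α`
with uniform constants. -/
theorem IsSolution.isFlowLine {C : ℝ} (hC : 0 ≤ C)
    (hB : IsBoundedDrift s T C (controlledDrift b γ)) (hx : IsSolution T α ζ Z b σ s y γ x) :
    IsFlowLine s T (driftGerm (roughGerm ζ Z σ) (controlledDrift b γ)) x := by
  obtain ⟨-, κ, hκ, -, hc, -, Λ, ⟨⟨C₁, hΛ⟩, -⟩, hx⟩ := hx
  obtain ⟨C₂, hC₂⟩ := hc.holder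
  have hcont : ContinuousOn x (Icc s T) :=
    continuousOn_of_norm_sub_le (by linarith : 0 < κ) fun r t hr hrt ht _ => hC₂ r t hr hrt ht
  refine ⟨min (3 * κ) (1 + κ), |C₁| + C * |C₂|, lt_min (by linarith) (by linarith), by positivity,
    fun r t hr hrt ht h1 => ?_⟩
  have hτ : 0 ≤ t - r := sub_nonneg.2 hrt
  have hint := hB.norm_integral_sub_le hC (x := x) (x' := fun _ => x r) hcont continuousOn_const
    hr hrt ht (S := |C₂| * (t - r) ^ κ) fun u hu => by
      have := hu.1
      have := hu.2
      refine (hC₂ r u hr hu.1 (hu.2.trans ht)).trans ?_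
      have h0 : 0 ≤ (u - r) ^ κ := Real.rpow_nonneg (by linarith) _
      gcongr
      exact le_abs_self _
  have e : x t - x r - driftGerm (roughGerm ζ Z σ) (controlledDrift b γ) r t (x r)
      = Λ r t + ((∫ u in r..t, controlledDrift b γ u (x u))
        - ∫ u in r..t, controlledDrift b γ u (x r)) := by
    have := hx r t hr hrt ht
    simp only [inc] at this
    rw [this]
    simp only [driftGerm, roughGerm, controlledDrift, inc]
    abel
  have h2 : ‖Λ r t‖ ≤ |C₁| * (t - r) ^ (min (3 * κ) (1 + κ)) := by
    refine (hΛ r t hr hrt ht).trans ?_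
    have h0 : 0 ≤ (t - r) ^ (3 * κ) := Real.rpow_nonneg hτ _
    refine mul_le_mul (le_abs_self _) ?_ h0 (abs_nonneg _)
    exact Real.rpow_le_rpow_of_exponent_ge' hτ h1 (le_min (by linarith) (by linarith))
      (min_le_left _ _)
  have h3 : (t - r) ^ κ * (t - r) ^ (1 : ℝ) ≤ (t - r) ^ (min (3 * κ) (1 + κ)) :=
    rpow_mul_le_rpow hτ h1 (by linarith) (by linarith) (le_min (by linarith) (by linarith))
      ((min_le_right _ _).trans (by linarith))
  rw [Real.rpow_one] at h3
  rw [e, add_mul]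
  refine (norm_add_le _ _).trans (add_le_add h2 (hint.trans ?_))
  calc _ = C * |C₂| * ((t - r) ^ κ * (t - r)) := by ring
    _ ≤ _ := by gcongr

theorem IsRegularCoefficient.norm_sub_le {E F : Type*} [NormedAddCommGroup E] [NormedSpace ℝ E]
    [NormedAddCommGroup F] [NormedSpace ℝ F] {σ : ℝ → E → F} {K : ℝ}
    (hσ : IsRegularCoefficient T K σ) {r t : ℝ} (hr : r ∈ Icc 0 T) (ht : t ∈ Icc 0 T)
    (hrt : r ≤ t) (z w : E) : ‖σ t w - σ r z‖ ≤ K * (t - r) + K * ‖w - z‖ :=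
  (norm_sub_le_norm_sub_add_norm_sub _ (σ r w) _).trans
    (add_le_add (hσ.time r hr t ht hrt w) ((hσ.space r hr).lip w z))

theorem IsRegularCoefficient.norm_fderiv_sub_le {E F : Type*} [NormedAddCommGroup E]
    [NormedSpace ℝ E] [NormedAddCommGroup F] [NormedSpace ℝ F] {σ : ℝ → E → F} {K : ℝ}
    (hσ : IsRegularCoefficient T K σ) {r t : ℝ} (hr : r ∈ Icc 0 T) (ht : t ∈ Icc 0 T)
    (hrt : r ≤ t) (z w : E) : ‖fderiv ℝ (σ t) w - fderiv ℝ (σ r) z‖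
      ≤ K * (t - r) ^ (2 / 3 : ℝ) + K * ‖w - z‖ :=
  (norm_sub_le_norm_sub_add_norm_sub _ (fderiv ℝ (σ r) w) _).trans
    (add_le_add (hσ.time_deriv r hr t ht hrt w) ((hσ.space_deriv r hr).lip w z))

/-- Here `v` is a first-order prediction of `w - z`. With `v = σ_r(x_r) δζ_{rt}` this controls the
remainder of the integrand `σ(t, x_t)`. -/
theorem IsRegularCoefficient.norm_sub_sub_le {E F : Type*} [NormedAddCommGroup E]
    [NormedSpace ℝ E] [NormedAddCommGroup F] [NormedSpace ℝ F] {σ : ℝ → E → F} {K : ℝ}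
    (hσ : IsRegularCoefficient T K σ) {r t : ℝ} (hr : r ∈ Icc 0 T) (ht : t ∈ Icc 0 T)
    (hrt : r ≤ t) (z w v : E) : ‖σ t w - σ r z - fderiv ℝ (σ r) z v‖
      ≤ K * (t - r) + 3 * (K * ‖w - z‖ ^ 2) + K * ‖w - z - v‖ := by
  have e : σ t w - σ r z - fderiv ℝ (σ r) z v
      = (σ t w - σ r w) + (σ r (z + (w - z)) - σ r z - fderiv ℝ (σ r) z (w - z))
        + fderiv ℝ (σ r) z (w - z - v) := by
    rw [add_sub_cancel, map_sub _ (w - z)]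
    abel
  have e2 := (IsBL₂.taylor (v := fun _ => w - z) (V := ‖w - z‖)
    (hσ.hasFDerivAt r hr) (hσ.space_deriv r hr)
    ⟨fun _ => le_rfl, fun _ _ => by simp; positivity⟩).bound z
  rw [e]
  exact norm_add₃_le.trans (add_le_add (add_le_add (hσ.time r hr t ht hrt w) e2)
    ((fderiv ℝ (σ r) z).le_of_opNorm_le ((hσ.space_deriv r hr).bound z) _))

/-- The norm of a difference of compositions. -/
theorem norm_comp_sub_comp_le {E F G : Type*} [NormedAddCommGroup E] [NormedSpace ℝ E]
    [NormedAddCommGroup F] [NormedSpace ℝ F] [NormedAddCommGroup G] [NormedSpace ℝ G] {K a c : ℝ}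
    {f f' : F →L[ℝ] G} {g g' : E →L[ℝ] F} (hf : ‖f - f'‖ ≤ a) (hg : ‖g - g'‖ ≤ c)
    (hf' : ‖f'‖ ≤ K) (hg' : ‖g‖ ≤ K) : ‖f.comp g - f'.comp g'‖ ≤ a * K + K * c := by
  have ha : 0 ≤ a := (norm_nonneg _).trans hf
  have hK : 0 ≤ K := (norm_nonneg _).trans hf'
  have e : f.comp g - f'.comp g' = (f - f').comp g + f'.comp (g - g') := by
    ext; simp
  rw [e]
  exact (norm_add_le _ _).trans (add_le_add
    ((ContinuousLinearMap.opNorm_comp_le _ _).trans (mul_le_mul hf hg' (norm_nonneg _) ha))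
    ((ContinuousLinearMap.opNorm_comp_le _ _).trans (mul_le_mul hf' hg (norm_nonneg _) hK)))

/-- The error of the flow line, with the drift integrated along the path, is the sewing term `Λ`:
its size is the a priori bound, and its cocycle is the defect of the one-step maps evaluated at the
points `x_r` and `x_u`. -/
theorem IsFlowLine.isSolution {K C : ℝ} (hα : 1 / 3 < α) (hα' : α < 1)
    (hζ : IsGeometricRoughPath T α ζ Z) (hσ : IsRegularCoefficient T K σ) (hs : 0 ≤ s)
    (hA : IsAlmostFlow T α C (roughGerm ζ Z σ))
    (hB : IsBoundedDrift s T C (controlledDrift b γ)) (hy : x s = y)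
    (hx : IsFlowLine s T (driftGerm (roughGerm ζ Z σ) (controlledDrift b γ)) x) :
    IsSolution T α ζ Z b σ s y γ x := by
  obtain ⟨h, L, h0, h1, hL, hb⟩ := exists_flowLine_bounds (E := Vec m) hα hα'.le hA.nonneg
  obtain ⟨hcont, hb⟩ := hb s T _ _ x hs hA hB hx
  obtain ⟨c, hc, hcζ⟩ := hζ.exists_bound
  obtain ⟨R, hR⟩ := (isCompact_Icc (a := s) (b := T)).exists_bound_of_continuousOn hcont
  have hC := hA.nonneg
  have hK := hσ.nonneg
  -- The second entry gives `3 κ ≤ 2/3 + α`, the order of the error, and lies strictly between `1/3`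
  -- and `α`. The cap `1/2` makes terms linear in time of order `2 κ`.
  set κ := min (1 / 2) ((2 / 3 + α) / 3) with hκ
  have hκ1 : κ ≤ 1 / 2 := min_le_left _ _
  have hκ2 : 3 * κ ≤ 2 / 3 + α := by linarith [min_le_right (1 / 2) ((2 / 3 + α) / 3)]
  have hκ3 : 1 / 3 < κ := lt_min (by norm_num) (by linarith)
  have hκα : κ < α := by linarith
  have hI : ∀ {r}, s ≤ r → r ≤ T → r ∈ Icc 0 T := fun h h' => ⟨hs.trans h, h'⟩
  -- comparison of powers of the length of a short interval
  have hpow : ∀ {τ p q : ℝ}, 0 ≤ τ → τ ≤ h → 0 ≤ q → q ≤ p → τ ^ p ≤ τ ^ q :=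
    fun h2 h3 h4 h5 => Real.rpow_le_rpow_of_exponent_ge' h2 (h3.trans h1) h4 h5
  set S : ℝ → Vec m → Vec d →L[ℝ] Vec d →L[ℝ] Vec m :=
    fun t z => (fderiv ℝ (σ t) z).comp (σ t z) with hS
  have hSb : ∀ t ∈ Icc 0 T, ∀ z, ‖S t z‖ ≤ K * K := fun t ht z =>
    (ContinuousLinearMap.opNorm_comp_le _ _).trans (mul_le_mul ((hσ.space_deriv t ht).bound z)
      ((hσ.space t ht).bound z) (norm_nonneg _) hK)
  set J := fun r t => x t - x r - roughGerm ζ Z σ r t (x r)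
    - ∫ u in r..t, controlledDrift b γ u (x u) with hJ
  -- global bounds
  set cT := c * T ^ α + c * T ^ (2 * α)
  have hζT : ∀ r t, s ≤ r → r ≤ t → t ≤ T → ‖inc ζ r t‖ ≤ cT ∧ ‖Z r t‖ ≤ cT := by
    intro r t hr hrt ht
    obtain ⟨e1, e2⟩ := hcζ r t (hs.trans hr) hrt ht
    have f1 : (t - r) ^ α ≤ T ^ α := by apply Real.rpow_le_rpow <;> linarith
    have f2 : (t - r) ^ (2 * α) ≤ T ^ (2 * α) := by apply Real.rpow_le_rpow <;> linarith
    have hT : 0 ≤ T := by linarith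
    have g1 : 0 ≤ c * T ^ α := by positivity
    have g2 : 0 ≤ c * T ^ (2 * α) := by positivity
    have g3 := mul_le_mul_of_nonneg_left f1 hc
    have g4 := mul_le_mul_of_nonneg_left f2 hc
    constructor <;> simp only [cT] <;> linarith
  have incT : ∀ r t, s ≤ r → r ≤ t → t ≤ T → ‖inc x r t‖ ≤ 2 * R := by
    intro r t hr hrt ht
    refine (norm_sub_le _ _).trans ?_
    linarith [hR r ⟨hr, hrt.trans ht⟩, hR t ⟨hr.trans hrt, ht⟩]
  have σT : ∀ r t, s ≤ r → r ≤ t → t ≤ T → ‖σ r (x r) (inc ζ r t)‖ ≤ K * cT := by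
    intro r t hr hrt ht
    have := (hσ.space r (hI hr (hrt.trans ht))).bound (x r)
    exact (ContinuousLinearMap.le_opNorm _ _).trans
      (mul_le_mul this (hζT r t hr hrt ht).1 (norm_nonneg _) hK)
  have ST : ∀ r t, s ≤ r → r ≤ t → t ≤ T → ‖S r (x r) (inc ζ r t)‖ ≤ K * K * cT := by
    intro r t hr hrt ht
    exact (ContinuousLinearMap.le_opNorm _ _).trans
      (mul_le_mul (hSb r (hI hr (hrt.trans ht)) (x r)) (hζT r t hr hrt ht).1 (norm_nonneg _)
        (by positivity))
  -- local bounds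
  have loc₁ : ∀ r t, s ≤ r → r ≤ t → t ≤ T → t - r ≤ h → ‖inc x r t‖ ≤ L * (t - r) ^ κ := by
    intro r t hr hrt ht hτ
    refine (hb r t hr hrt ht hτ).1.trans ?_
    have := hpow (sub_nonneg.2 hrt) hτ (by linarith) hκα.le
    gcongr
  have loc₂ : ∀ r t, s ≤ r → r ≤ t → t ≤ T → t - r ≤ h →
      ‖σ t (x t) - σ r (x r)‖ ≤ (K + K * L) * (t - r) ^ κ := by
    intro r t hr hrt ht hτ
    have e1 := hσ.norm_sub_le (hI hr (hrt.trans ht)) (hI (hr.trans hrt) ht) hrt (x r) (x t)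
    have e3 : ‖x t - x r‖ ≤ L * (t - r) ^ κ := loc₁ r t hr hrt ht hτ
    have e4 := le_rpow_of_le_one (sub_nonneg.2 hrt) (hτ.trans h1) (by linarith : 0 ≤ κ)
      (by linarith)
    have e6 := mul_le_mul_of_nonneg_left e3 hK
    have e7 := mul_le_mul_of_nonneg_left e4 hK
    linarith
  have loc₃ : ∀ r t, s ≤ r → r ≤ t → t ≤ T → t - r ≤ h →
      ‖x t - x r - σ r (x r) (inc ζ r t)‖
        ≤ ((d : ℝ) ^ 2 * c * (K * K) + C + L) * (t - r) ^ (2 * κ) := by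
    intro r t hr hrt ht hτ
    have hτ0 := sub_nonneg.2 hrt
    have e : x t - x r - σ r (x r) (inc ζ r t) = contract (S r (x r)) (Z r t)
        + (∫ u in r..t, controlledDrift b γ u (x u)) + J r t := by
      simp only [hJ, roughGerm, hS]; abel
    have e1 := norm_contract_le (S r (x r)) (Z r t)
    have e2 := hB.norm_integral_le x hr hrt ht
    have e3 : ‖J r t‖ ≤ _ := (hb r t hr hrt ht hτ).2
    have f1 := (hcζ r t (hs.trans hr) hrt ht).2
    have f2 := hSb r (hI hr (hrt.trans ht)) (x r)
    have g1 := hpow hτ0 hτ (q := 2 * κ) (p := 2 * α) (by linarith) (by linarith)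
    have g2 := le_rpow_of_le_one hτ0 (hτ.trans h1) (by linarith : 0 ≤ 2 * κ) (by linarith)
    have g3 := hpow hτ0 hτ (q := 2 * κ) (p := 2 / 3 + α) (by linarith) (by linarith)
    have e1' : ‖contract (S r (x r)) (Z r t)‖
        ≤ (d : ℝ) ^ 2 * (c * (t - r) ^ (2 * κ)) * (K * K) := by
      refine e1.trans ?_
      have : ‖Z r t‖ ≤ c * (t - r) ^ (2 * κ) := f1.trans (by gcongr)
      gcongr
    have e2' := mul_le_mul_of_nonneg_left g2 hC
    have e3' := mul_le_mul_of_nonneg_left g3 hL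
    rw [e]
    refine (norm_add₃_le).trans ?_
    linarith
  have loc₄ : ∀ r t, s ≤ r → r ≤ t → t ≤ T → t - r ≤ h →
      ‖S t (x t) - S r (x r)‖ ≤ ((K + K * L) * K + K * (K + K * L)) * (t - r) ^ κ := by
    intro r t hr hrt ht hτ
    have hr' := hI hr (hrt.trans ht)
    have ht' := hI (hr.trans hrt) ht
    have e1 : ‖fderiv ℝ (σ t) (x t) - fderiv ℝ (σ r) (x r)‖ ≤ (K + K * L) * (t - r) ^ κ := by
      have f1 := hσ.norm_fderiv_sub_le hr' ht' hrt (x r) (x t)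
      have f3 : ‖x t - x r‖ ≤ L * (t - r) ^ κ := loc₁ r t hr hrt ht hτ
      have f4 := hpow (sub_nonneg.2 hrt) hτ (q := κ) (p := 2 / 3) (by linarith) (by linarith)
      have f6 := mul_le_mul_of_nonneg_left f3 hK
      have f7 := mul_le_mul_of_nonneg_left f4 hK
      linarith
    refine (norm_comp_sub_comp_le e1 (loc₂ r t hr hrt ht hτ) ((hσ.space_deriv r hr').bound (x r))
      ((hσ.space t ht').bound (x t))).trans (le_of_eq ?_)
    ring
  have loc₅ : ∀ r t, s ≤ r → r ≤ t → t ≤ T → t - r ≤ h →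
      ‖σ t (x t) - σ r (x r) - S r (x r) (inc ζ r t)‖
        ≤ (K + 3 * (K * L ^ 2) + K * ((d : ℝ) ^ 2 * c * (K * K) + C + L)) * (t - r) ^ (2 * κ) := by
    intro r t hr hrt ht hτ
    have hτ0 := sub_nonneg.2 hrt
    have e1 := hσ.norm_sub_sub_le (hI hr (hrt.trans ht)) (hI (hr.trans hrt) ht) hrt (x r) (x t)
      (σ r (x r) (inc ζ r t))
    have f1 := le_rpow_of_le_one hτ0 (hτ.trans h1) (by linarith : 0 ≤ 2 * κ) (by linarith)
    have f2 : ‖x t - x r‖ ^ 2 ≤ L ^ 2 * (t - r) ^ (2 * κ) := by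
      have g1 : ‖x t - x r‖ ≤ L * (t - r) ^ κ := loc₁ r t hr hrt ht hτ
      have g2 := pow_le_pow_left₀ (norm_nonneg _) g1 2
      rwa [mul_pow, ← Real.rpow_natCast ((t - r) ^ κ), ← Real.rpow_mul hτ0, mul_comm κ] at g2
    have k1 := mul_le_mul_of_nonneg_left f1 hK
    have k2 := mul_le_mul_of_nonneg_left f2 hK
    have k3 := mul_le_mul_of_nonneg_left (loc₃ r t hr hrt ht hτ) hK
    refine e1.trans ?_
    linarith
  have hx₁ : IsHolder₁ κ s T x := isHolder₂_of_local (by linarith) h0 loc₁ incT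
  have hσ₁ : IsHolder₁ κ s T (fun t => σ t (x t)) :=
    isHolder₂_of_local (by linarith) h0 loc₂ (M := K + K) fun r t hr hrt ht =>
      (norm_sub_le _ _).trans (add_le_add ((hσ.space t (hI (hr.trans hrt) ht)).bound _)
        ((hσ.space r (hI hr (hrt.trans ht))).bound _))
  refine ⟨hy, κ, hκ3, hκα, ⟨hx₁, hσ₁, isHolder₂_of_local (by linarith) h0 loc₃
    (M := 2 * R + K * cT) fun r t hr hrt ht => (norm_sub_le _ _).trans
      (add_le_add (incT r t hr hrt ht) (σT r t hr hrt ht))⟩, ⟨hσ₁, ?_, ?_⟩, J, ⟨?_, ?_⟩, ?_⟩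
  · exact isHolder₂_of_local (by linarith) h0 loc₄ (M := K * K + K * K) fun r t hr hrt ht =>
      (norm_sub_le _ _).trans (add_le_add (hSb t (hI (hr.trans hrt) ht) _)
        (hSb r (hI hr (hrt.trans ht)) _))
  · exact isHolder₂_of_local (by linarith) h0 loc₅ (M := K + K + K * K * cT)
      fun r t hr hrt ht => (norm_sub_le _ _).trans (add_le_add
        ((norm_sub_le _ _).trans (add_le_add ((hσ.space t (hI (hr.trans hrt) ht)).bound _)
          ((hσ.space r (hI hr (hrt.trans ht))).bound _))) (ST r t hr hrt ht))
  · refine isHolder₂_of_local (by linarith) h0 (C := L) (fun r t hr hrt ht hτ => ?_)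
      (M := 2 * R + (K * cT + (d : ℝ) ^ 2 * cT * (K * K)) + C * T) fun r t hr hrt ht => ?_
    · refine (hb r t hr hrt ht hτ).2.trans ?_
      have := hpow (sub_nonneg.2 hrt) hτ (by linarith) hκ2
      gcongr
    · have e1 := norm_contract_le (S r (x r)) (Z r t)
      have e2 := hB.norm_integral_le x hr hrt ht
      have e3 : C * (t - r) ≤ C * T := by gcongr; linarith
      have e4 := (hζT r t hr hrt ht).2
      have e5 : ‖contract (S r (x r)) (Z r t)‖ ≤ (d : ℝ) ^ 2 * cT * (K * K) := by
        refine e1.trans ?_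
        have := hSb r (hI hr (hrt.trans ht)) (x r)
        have : 0 ≤ cT := (norm_nonneg _).trans e4
        gcongr
      refine (norm_sub_le _ _).trans (add_le_add ((norm_sub_le _ _).trans (add_le_add
        (incT r t hr hrt ht) ((norm_add_le _ _).trans (add_le_add (σT r t hr hrt ht) e5))))
        (e2.trans e3))
  · intro r u t hr hru hut ht
    have h2 := intervalIntegral.integral_add_adjacent_intervals
      (hB.intervalIntegrable hcont hr hru (hut.trans ht))
      (hB.intervalIntegrable hcont (hr.trans hru) hut ht)
    have h3 := roughGerm_defect hζ σ (hs.trans hr) hru hut ht (x r) (x u)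
    have h4 : inc₂ J r u t = -(roughGerm ζ Z σ r t (x r) - roughGerm ζ Z σ r u (x r)
        - roughGerm ζ Z σ u t (x u)) := by
      simp only [inc₂, hJ, ← h2]; abel
    rw [h4, h3, neg_neg]
    rfl
  · intro r t hr hrt ht
    simp only [hJ, roughGerm, inc, controlledDrift]
    abel

end Solutions

/-! ### Estimates for states, rewards and suprema -/

section Value

variable {m d : ℕ} {U : Type*} [MetricSpace U] [SecondCountableTopology U]
  [MeasurableSpace U] [BorelSpace U] {T α : ℝ} {ζ : ℝ → Vec d}
  {Z : ℝ → ℝ → Fin d → Fin d → ℝ} {b : ℝ → Vec m → U → Vec m}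
  {σ : ℝ → Vec m → Vec d →L[ℝ] Vec m}

/-- The controlled equation is solvable, its solutions are continuous, and they depend in a
Lipschitz way on the initial value and in an `α`-Hölder way on the initial time, with constants
that do not depend on the control. -/
theorem exists_solution_estimates (hα : 1 / 3 < α) (hα' : α < 1)
    (hζ : IsGeometricRoughPath T α ζ Z) (hb : IsDrift T b) (hσ : IsCb13 T σ) :
    ∃ h D : ℝ, 0 < h ∧ 0 ≤ D ∧ ∀ (K : Set (P2 U)) (ε L s : ℝ), 0 < ε → s ∈ Icc 0 T →
      ∀ γ ∈ admissible K ε L s T,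
        (∀ y, ∃ x, IsSolution T α ζ Z b σ s y γ x) ∧
        (∀ y x, IsSolution T α ζ Z b σ s y γ x → ContinuousOn x (Icc s T)) ∧
        ∀ s' y y' x x', s ≤ s' → s' ≤ T → s' - s ≤ h →
          IsSolution T α ζ Z b σ s y γ x → IsSolution T α ζ Z b σ s' y' γ x' →
          ∀ t ∈ Icc s' T, ‖x t - x' t‖ ≤ D * (‖y - y'‖ + (s' - s) ^ α) := by
  obtain ⟨Cσ, hσC⟩ := exists_isRegularCoefficient hσ.differentiable_time hσ.contDiff_space
    hσ.bounded_time hσ.bounded_space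
  obtain ⟨C₁, hC₁⟩ := exists_isAlmostFlow_roughGerm hα hζ hσC
  obtain ⟨C₂, hC₂, hdrift⟩ := hb.exists_isBoundedDrift
  set C := max C₁ C₂ with hCdef
  have hC : 0 ≤ C := hC₂.trans (le_max_right _ _)
  have hA : IsAlmostFlow T α C (roughGerm ζ Z σ) := hC₁.mono (le_max_left _ _)
  obtain ⟨h, L₀, hh, -, hL₀, hbounds⟩ := exists_flowLine_bounds (E := Vec m) hα hα'.le hC
  obtain ⟨K₀, hK₀, hstab⟩ := exists_forall_flowLine_sub_le (E := Vec m) T hα hα'.le hC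
  -- `L₀` measures how far the earlier solution has moved by time `s'`, and `K₀` propagates the gap
  -- at `s'` up to `T`.
  refine ⟨h, K₀ * (1 + L₀), hh, by positivity, fun K ε L s hε hs γ hγ => ?_⟩
  have hB : IsBoundedDrift s T C (controlledDrift b γ) :=
    (hdrift K ε L s γ hε hs.1 hγ).mono_const (le_max_right _ _)
  refine ⟨fun y => ?_, fun y x hx => ?_, fun s' y y' x x' hss' hs'T hτ hx hx' t ht => ?_⟩
  · obtain ⟨x, hxs, hx⟩ := (hA.isWeakFlow hB hs.1 hα hα'.le).exists_isFlowLine hα y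
    exact ⟨x, hx.isSolution hα hα' hζ hσC hs.1 hA hB hxs⟩
  · exact (hbounds s T _ _ x hs.1 hA hB (hx.isFlowLine hC hB)).1
  · have hB' := hB.mono hss'
    have hfl := hx.isFlowLine hC hB
    have h0 : 0 ≤ (s' - s) ^ α := Real.rpow_nonneg (sub_nonneg.2 hss') _
    have h1 := ((hbounds s T _ _ x hs.1 hA hB hfl).2 s s' le_rfl hss' hs'T hτ).1
    have h2 := hstab s' _ _ x x' (hs.1.trans hss') hA hB' (hfl.mono hss')
      (hx'.isFlowLine hC hB') t ht
    rw [hx'.1] at h2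
    rw [hx.1] at h1
    have h3 : ‖x s' - y'‖ ≤ ‖y - y'‖ + L₀ * (s' - s) ^ α := by
      have := norm_add_le (x s' - y) (y - y')
      rw [sub_add_sub_cancel] at this
      linarith
    calc ‖x t - x' t‖ ≤ K₀ * (‖y - y'‖ + L₀ * (s' - s) ^ α) := h2.trans (by gcongr)
      _ ≤ K₀ * ((1 + L₀) * (‖y - y'‖ + (s' - s) ^ α)) := by
        have := mul_nonneg hL₀ (norm_nonneg (y - y'))
        gcongr
        nlinarith
      _ = _ := by ring

/-- The rewards of two states that are driven by one control and start at different times. -/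
theorem abs_reward_sub_le {K : Set (P2 U)} {ε L s s' δ CF Cx : ℝ} {CG : NNReal}
    {F : ℝ → Vec m → P2 U → ℝ} {G : Vec m → ℝ} {γ : ℝ → P2 U} {x x' : ℝ → Vec m}
    (hF : IsRunningReward T K F) (hCF : ∀ t ∈ Icc 0 T, ∀ x, ∀ γ ∈ K, |F t x γ| ≤ CF)
    (hCx0 : 0 ≤ Cx) (hCx : ∀ t ∈ Icc 0 T, ∀ γ ∈ K, ∀ x x', |F t x γ - F t x' γ| ≤ Cx * ‖x - x'‖)
    (hCG : LipschitzWith CG G) (hε : 0 < ε) (hs : 0 ≤ s) (hss' : s ≤ s') (hs' : s' ≤ T)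
    (hγ : γ ∈ admissible K ε L s T) (hx : ContinuousOn x (Icc s T))
    (hx' : ContinuousOn x' (Icc s' T)) (hδ : ∀ t ∈ Icc s' T, ‖x t - x' t‖ ≤ δ) :
    |((∫ r in s..T, F r (x r) (γ r)) + G (x T)) - ((∫ r in s'..T, F r (x' r) (γ r)) + G (x' T))|
      ≤ CF * (s' - s) + (T * Cx + CG) * δ := by
  have hi := hF.intervalIntegrable hε hs (hss'.trans hs') hγ hx
  have hi₁ : IntervalIntegrable (fun r => F r (x r) (γ r)) volume s s' :=
    hi.mono_set (by rw [uIcc_of_le hss', uIcc_of_le (hss'.trans hs')]; exact Icc_subset_Icc_right hs')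
  have hi₂ : IntervalIntegrable (fun r => F r (x r) (γ r)) volume s' T :=
    hi.mono_set (by rw [uIcc_of_le hs', uIcc_of_le (hss'.trans hs')]; exact Icc_subset_Icc_left hss')
  have hi₃ := hF.intervalIntegrable hε (hs.trans hss') hs' (admissible_mono hss' hγ) hx'
  have hδ0 : 0 ≤ δ := (norm_nonneg _).trans (hδ T ⟨hs', le_rfl⟩)
  rw [← intervalIntegral.integral_add_adjacent_intervals hi₁ hi₂]
  have e1 : |∫ r in s..s', F r (x r) (γ r)| ≤ CF * (s' - s) := by
    have := intervalIntegral.norm_integral_le_of_norm_le_const (a := s) (b := s') (C := CF)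
      (f := fun r => F r (x r) (γ r)) fun r hr => by
        rw [uIoc_of_le hss'] at hr
        exact hCF r ⟨hs.trans hr.1.le, hr.2.trans hs'⟩ _ _ (hγ.1 r ⟨hr.1.le, hr.2.trans hs'⟩)
    rwa [abs_of_nonneg (sub_nonneg.2 hss')] at this
  have e2 : |(∫ r in s'..T, F r (x r) (γ r)) - ∫ r in s'..T, F r (x' r) (γ r)|
      ≤ Cx * δ * (T - s') := by
    rw [← intervalIntegral.integral_sub hi₂ hi₃]
    have := intervalIntegral.norm_integral_le_of_norm_le_const (a := s') (b := T) (C := Cx * δ)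
      (f := fun r => F r (x r) (γ r) - F r (x' r) (γ r)) fun r hr => by
        rw [uIoc_of_le hs'] at hr
        have hr0 : r ∈ Icc s T := ⟨hss'.trans hr.1.le, hr.2⟩
        refine (hCx r ⟨hs.trans hr0.1, hr.2⟩ _ (hγ.1 r hr0) _ _).trans ?_
        have := hδ r ⟨hr.1.le, hr.2⟩
        gcongr
    rwa [abs_of_nonneg (sub_nonneg.2 hs')] at this
  have e3 : |G (x T) - G (x' T)| ≤ CG * δ := by
    have := hCG.dist_le_mul (x T) (x' T)
    rw [Real.dist_eq, dist_eq_norm] at this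
    refine this.trans ?_
    have := hδ T ⟨hs', le_rfl⟩
    gcongr
  have e4 : Cx * δ * (T - s') ≤ T * Cx * δ := by
    have := mul_nonneg (mul_nonneg hCx0 hδ0) (hs.trans hss')
    nlinarith
  rw [show ∀ p q r u v : ℝ, (p + q + u) - (r + v) = p + (q - r) + (u - v) by intros; ring]
  refine (abs_add_three _ _ _).trans ?_
  linarith

theorem abs_csSup_sub_csSup_le {A B : Set ℝ} {c : ℝ} (hA : A.Nonempty) (hB : B.Nonempty)
    (hA' : BddAbove A) (hB' : BddAbove B) (hAB : ∀ p ∈ A, ∃ q ∈ B, |p - q| ≤ c)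
    (hBA : ∀ q ∈ B, ∃ p ∈ A, |p - q| ≤ c) : |sSup A - sSup B| ≤ c := by
  rw [abs_sub_le_iff]
  constructor
  · rw [sub_le_iff_le_add]
    refine csSup_le hA fun p hp => ?_
    obtain ⟨q, hq, h⟩ := hAB p hp
    linarith [(abs_le.1 h).2, le_csSup hB' hq]
  · rw [sub_le_iff_le_add]
    refine csSup_le hB fun q hq => ?_
    obtain ⟨p, hp, h⟩ := hBA q hq
    linarith [(abs_le.1 h).1, le_csSup hA' hp]

variable {K : Set (P2 U)} {F : ℝ → Vec m → P2 U → ℝ} {G : Vec m → ℝ}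

theorem abs_le_of_mem_rewards {ε L s CF CG : ℝ} {y : Vec m} (hCF0 : 0 ≤ CF)
    (hCF : ∀ t ∈ Icc 0 T, ∀ x, ∀ γ ∈ K, |F t x γ| ≤ CF) (hCG : ∀ x, |G x| ≤ CG)
    (hs : s ∈ Icc 0 T) {J : ℝ} (hJ : J ∈ rewards T α ε L ζ Z b σ K F G s y) :
    |J| ≤ CF * T + CG := by
  obtain ⟨γ, hγ, x, -, rfl⟩ := hJ
  have := intervalIntegral.norm_integral_le_of_norm_le_const (a := s) (b := T) (C := CF)
    (f := fun r => F r (x r) (γ r)) fun r hr => by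
      rw [uIoc_of_le hs.2] at hr
      exact hCF r ⟨hs.1.trans hr.1.le, hr.2⟩ _ _ (hγ.1 r ⟨hr.1.le, hr.2⟩)
  rw [abs_of_nonneg (sub_nonneg.2 hs.2), Real.norm_eq_abs] at this
  refine (abs_add_le _ _).trans (add_le_add (this.trans ?_) (hCG _))
  gcongr
  linarith [hs.1]

end Value

end RoughControl

/-! ### Regularity of the value function -/

theorem mainTheorem6 {m d : ℕ} {U : Type*} [MetricSpace U] [SecondCountableTopology U]
    [MeasurableSpace U] [BorelSpace U]
    (T α : ℝ) (hT : 0 < T) (hα : 1 / 3 < α) (hα' : α < 1)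
    (ζ : ℝ → RoughControl.Vec d) (Z : ℝ → ℝ → Fin d → Fin d → ℝ)
    (hζ : RoughControl.IsGeometricRoughPath T α ζ Z)
    (b : ℝ → RoughControl.Vec m → U → RoughControl.Vec m)
    (hb : RoughControl.IsDrift T b)
    (σ : ℝ → RoughControl.Vec m → RoughControl.Vec d →L[ℝ] RoughControl.Vec m)
    (hσ : RoughControl.IsCb13 T σ)
    (K : Set (RoughControl.P2 U)) (hK : IsCompact K) (hK' : K.Nonempty)
    (F : ℝ → RoughControl.Vec m → RoughControl.P2 U → ℝ)
    (hF : RoughControl.IsRunningReward T K F)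
    (G : RoughControl.Vec m → ℝ) (hG : RoughControl.IsTerminalReward G)
    (hG' : ∃ C, LipschitzWith C G) :
    ∃ C : ℝ, ∀ ε L : ℝ, 0 < ε → 0 < L →
      (∀ s ∈ Icc 0 T, ∀ y : RoughControl.Vec m,
        IsLUB (RoughControl.rewards T α ε L ζ Z b σ K F G s y)
          (RoughControl.value T α ε L ζ Z b σ K F G s y)) ∧
      ∀ s₁ ∈ Icc 0 T, ∀ s₂ ∈ Icc 0 T, ∀ y₁ y₂ : RoughControl.Vec m,
        |RoughControl.value T α ε L ζ Z b σ K F G s₂ y₂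
            - RoughControl.value T α ε L ζ Z b σ K F G s₁ y₁|
          ≤ C * (‖y₁ - y₂‖ + (1 + ‖y₁‖ + ‖y₂‖) * |s₁ - s₂| ^ α) := by
  open RoughControl in
  obtain ⟨μ, hμ⟩ := hK'
  obtain ⟨CF, hCF⟩ := hF.bounded
  obtain ⟨Cx', hCx'⟩ := hF.lipschitz_space
  obtain ⟨M', hM'⟩ := hG.bounded
  obtain ⟨CG, hCG⟩ := hG'
  obtain ⟨h, D, hh, hD, hsol⟩ := exists_solution_estimates hα hα' hζ hb hσ
  have hα0 : 0 ≤ α := by linarith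
  have hCF0 : 0 ≤ CF := (abs_nonneg _).trans (hCF 0 ⟨le_rfl, hT.le⟩ 0 μ hμ)
  have hM'0 : 0 ≤ M' := (abs_nonneg _).trans (hM' 0)
  set Cx := max Cx' 0 with hCxdef
  have hCx0 : 0 ≤ Cx := le_max_right _ _
  have hCx : ∀ t ∈ Icc 0 T, ∀ γ ∈ K, ∀ x x', |F t x γ - F t x' γ| ≤ Cx * ‖x - x'‖ :=
    fun t ht γ hγ x x' => (hCx' t ht γ hγ x x').trans (by gcongr; exact le_max_left _ _)
  set h' := min h 1 with hh'def
  have hh' : 0 < h' := lt_min hh one_pos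
  set M := CF * T + M' with hM
  have hM0 : 0 ≤ M := by positivity
  set P := (T * Cx + CG) * D with hP
  have hP0 : 0 ≤ P := by positivity
  -- `CF` accounts for the running reward before `s₂`, `P` for the distance of the states
  -- afterwards, and the last summand for time gaps exceeding `h'`. All are fixed before `ε` and
  -- `L`.
  set Q := CF + P + 2 * M / h' ^ α with hQ
  have hh'α : 0 < h' ^ α := Real.rpow_pos_of_pos hh' _
  have hR0 : 0 ≤ 2 * M / h' ^ α := by positivity
  refine ⟨Q, fun ε L hε hL => ?_⟩
  have hne : ∀ s ∈ Icc 0 T, ∀ y, (rewards T α ε L ζ Z b σ K F G s y).Nonempty := by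
    intro s hs y
    have hγ := const_mem_admissible (ε := ε) (L := L) (s := s) (T := T) hμ
    obtain ⟨x, hx⟩ := (hsol K ε L s hε hs _ hγ).1 y
    exact ⟨_, _, hγ, x, hx, rfl⟩
  have hab : ∀ s ∈ Icc 0 T, ∀ y, ∀ J ∈ rewards T α ε L ζ Z b σ K F G s y, |J| ≤ M :=
    fun s hs y J hJ => abs_le_of_mem_rewards hCF0 hCF hM' hs hJ
  have hbdd : ∀ s ∈ Icc 0 T, ∀ y, BddAbove (rewards T α ε L ζ Z b σ K F G s y) :=
    fun s hs y => ⟨M, fun J hJ => (le_abs_self J).trans (hab s hs y J hJ)⟩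
  have ordered : ∀ s₁ ∈ Icc 0 T, ∀ s₂ ∈ Icc 0 T, s₁ ≤ s₂ → ∀ y₁ y₂ : Vec m,
      |value T α ε L ζ Z b σ K F G s₁ y₁ - value T α ε L ζ Z b σ K F G s₂ y₂|
        ≤ Q * (‖y₁ - y₂‖ + (s₂ - s₁) ^ α) := by
    intro s₁ hs₁ s₂ hs₂ h12 y₁ y₂
    have hτ0 : 0 ≤ s₂ - s₁ := sub_nonneg.2 h12
    have hτα : 0 ≤ (s₂ - s₁) ^ α := Real.rpow_nonneg hτ0 _
    rcases le_or_gt (s₂ - s₁) h' with hτ | hτ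
    · have hτ' : s₂ - s₁ ≤ (s₂ - s₁) ^ α :=
        le_rpow_of_le_one hτ0 (hτ.trans (min_le_right _ _)) hα0 hα'.le
      have key : ∀ γ ∈ admissible K ε L s₁ T, ∀ x x', IsSolution T α ζ Z b σ s₁ y₁ γ x →
          IsSolution T α ζ Z b σ s₂ y₂ γ x' →
          |((∫ r in s₁..T, F r (x r) (γ r)) + G (x T))
            - ((∫ r in s₂..T, F r (x' r) (γ r)) + G (x' T))|
            ≤ Q * (‖y₁ - y₂‖ + (s₂ - s₁) ^ α) := by
        intro γ hγ x x' hx hx'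
        obtain ⟨-, hc, hd⟩ := hsol K ε L s₁ hε hs₁ γ hγ
        have hc' := (hsol K ε L s₂ hε hs₂ γ (admissible_mono h12 hγ)).2.1
        refine (abs_reward_sub_le hF hCF hCx0 hCx hCG hε hs₁.1 h12 hs₂.2 hγ (hc _ _ hx)
          (hc' _ _ hx')
          (hd s₂ y₁ y₂ x x' h12 hs₂.2 (hτ.trans (min_le_left _ _)) hx hx')).trans ?_
        rw [← mul_assoc, hQ, add_mul, add_mul]
        have h1 : CF * (s₂ - s₁) ≤ CF * (‖y₁ - y₂‖ + (s₂ - s₁) ^ α) := by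
          gcongr
          linarith [norm_nonneg (y₁ - y₂)]
        have h2 : 0 ≤ 2 * M / h' ^ α * (‖y₁ - y₂‖ + (s₂ - s₁) ^ α) := by positivity
        linarith
      refine abs_csSup_sub_csSup_le (hne s₁ hs₁ y₁) (hne s₂ hs₂ y₂) (hbdd s₁ hs₁ y₁)
        (hbdd s₂ hs₂ y₂) ?_ ?_
      · rintro _ ⟨γ, hγ, x, hx, rfl⟩
        have hγ' := admissible_mono h12 hγ
        obtain ⟨x', hx'⟩ := (hsol K ε L s₂ hε hs₂ γ hγ').1 y₂
        exact ⟨_, ⟨γ, hγ', x', hx', rfl⟩, key γ hγ x x' hx hx'⟩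
      · rintro _ ⟨γ, hγ, x', hx', rfl⟩
        -- The control on `[s₂, T]` is held at its value at `s₂` on `[s₁, s₂]`. The extension agrees
        -- with it on `[s₂, T]`, so the later state and its reward are unchanged.
        have hγ' := extend_mem_admissible (s := s₁) hL.le hε.le hs₂.2 hγ
        have hr : ∀ r ∈ Icc s₂ T, γ r = γ (max s₂ r) := fun r hr => by rw [max_eq_right hr.1]
        obtain ⟨x, hx⟩ := (hsol K ε L s₁ hε hs₁ _ hγ').1 y₁
        refine ⟨_, ⟨_, hγ', x, hx, rfl⟩, ?_⟩
        rw [show (∫ r in s₂..T, F r (x' r) (γ r)) = ∫ r in s₂..T, F r (x' r) (γ (max s₂ r)) from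
          intervalIntegral.integral_congr fun r hr' => by
            rw [uIcc_of_le hs₂.2] at hr'
            simp only [hr r hr']]
        exact key _ hγ' x x' hx (hx'.congr_control hr)
    · have hval : ∀ s ∈ Icc 0 T, ∀ y, |value T α ε L ζ Z b σ K F G s y| ≤ M := fun s hs y => by
        obtain ⟨J, hJ⟩ := hne s hs y
        exact abs_le.2 ⟨(abs_le.1 (hab s hs y J hJ)).1.trans (le_csSup (hbdd s hs y) hJ),
          csSup_le ⟨J, hJ⟩ fun J hJ => (le_abs_self J).trans (hab s hs y J hJ)⟩
      have h1 : h' ^ α ≤ (s₂ - s₁) ^ α := Real.rpow_le_rpow hh'.le hτ.le hα0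
      calc _ ≤ M + M := (abs_sub _ _).trans (add_le_add (hval s₁ hs₁ y₁) (hval s₂ hs₂ y₂))
        _ = 2 * M / h' ^ α * h' ^ α := by field_simp; ring
        _ ≤ Q * (‖y₁ - y₂‖ + (s₂ - s₁) ^ α) := by
          refine mul_le_mul ?_ ?_ hh'α.le (by positivity)
          · rw [hQ]; linarith
          · linarith [norm_nonneg (y₁ - y₂)]
  refine ⟨fun s hs y => isLUB_csSup (hne s hs y) (hbdd s hs y), fun s₁ hs₁ s₂ hs₂ y₁ y₂ => ?_⟩
  -- Since `b` and `σ` are bounded, the estimate holds without growth in the initial values; the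
  -- factor `1 + ‖y₁‖ + ‖y₂‖` only weakens it.
  have hfin : Q * (‖y₁ - y₂‖ + |s₁ - s₂| ^ α)
      ≤ Q * (‖y₁ - y₂‖ + (1 + ‖y₁‖ + ‖y₂‖) * |s₁ - s₂| ^ α) := by
    have := Real.rpow_nonneg (abs_nonneg (s₁ - s₂)) α
    have hQ0 : 0 ≤ Q := by positivity
    gcongr
    exact le_mul_of_one_le_left this (by linarith [norm_nonneg y₁, norm_nonneg y₂])
  refine le_trans ?_ hfin
  rcases le_total s₁ s₂ with h12 | h12
  · rw [abs_sub_comm, abs_sub_comm s₁, abs_of_nonneg (sub_nonneg.2 h12)]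
    exact ordered s₁ hs₁ s₂ hs₂ h12 y₁ y₂
  · rw [abs_of_nonneg (sub_nonneg.2 h12), norm_sub_rev]
    exact ordered s₂ hs₂ s₁ hs₁ h12 y₂ y₁
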